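/- **Setting.** Let $\mathcal C\subset\mathbb C^r$ be open and contractible, with coordinates $u=(u_1,\dots,u_r)$. A *local special Kähler geometry* of rank $r$ over $\mathcal C$ consists of a holomorphic fibration $\pi:\mathcal X\to\mathcal C$ of polarized abelian varieties together with a closed, non-degenerate holomorphic $2$-form $L$ on $\mathcal X$ for which the fibres are Lagrangian. In a (constant) symplectic basis of the fibre homology with invariant factors $\Delta=\mathrm{diag}(d_1,\dots,d_r)$, $d_i\ge 1$, $d_i\mid d_{i+1}$, the fibres are $X_u=\mathbb C^r/(\Delta\mathbb Z^r+\tau(u)\mathbb Z^r)$ with $\tau$ holomorphic, $\tau=\tau^t$, $\mathrm{Im}\,\tau>0$, and $\mathcal X$ is the quotient of $\mathcal C\times\mathbb C^r\ni(u,z)$ by $(u,z)\mapsto(u,z+\Delta n+\tau(u)n')$, $n,n'\in\mathbb Z^r$. The geometry is *isotrivial* if $\tau$ is locally constant. It is *completely split* if, for all $u\in\mathcal C$ outside a meagre set, $X_u$ is isomorphic, as a complex torus (ignoring the polarization), to a product of $r$ one-dimensional complex tori. A *scale symmetry* is a holomorphic local $\mathbb C^\times$-action on $\mathcal C$ of the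 form $u_k\mapsto\lambda^{\Delta_k}u_k$ with real weights $\Delta_k$, defined for $\lambda=e^s$ with $(s,u)$ in an open set containing $\{0\}\times\mathcal C$, together with holomorphic lifts to $\mathcal X$ that restrict to isomorphisms of polarized abelian varieties $X_u\to X_{\lambda\circ u}$ (up to translation), are the identity at $s=0$, and pull $L$ back to $\lambda L$. **Theorem.** Let a completely split local special Kähler geometry be given. (1) There are a constant $R\in GL(2r,\mathbb Z)$ and holomorphic maps $G:\mathcal C\to GL(r,\mathbb C)$ and $Z^1,\dots,Z^r:\mathcal C\to\{\mathrm{Im}>0\}$ with $$G(u)\,(\Delta\ \ \tau(u))\,R=(\mathbb 1_r\ \ \mathrm{diag}(Z^1(u),\dots,Z^r(u))),$$ so that $X_u\cong\prod_\ell X_u^\ell$ with $X^\ell_u=\mathbb C/(\mathbb Z+\mathbb ZZ^\ell(u))$. There are holomorphic functions $a_\ell,c_1^\ell,c_0^\ell$ on $\mathcal C$ ($\ell=1,\dots,r$), with $da_1,\dots,da_r$ linearly independent at every point, and functions $x_\ell(u,w),y_\ell(u,w)$, holomorphic away from $w\in\mathbb Z+\mathbb ZZ^\ell(u)$, which identify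 $X_u^\ell$ with the smooth Weierstrass curve $$y_\ell^2=x_\ell^3+c_1^\ell(u)\,x_\ell+c_0^\ell(u),\qquad \frac{dx_\ell}{y_\ell}\Big|_{X_u^\ell}=dw,$$ such that, locally on $\mathcal C$, each of $c_1^\ell$, $c_0^\ell$ and $Z^\ell$ is a holomorphic function of $a_\ell$ alone. Moreover $$L=\sum_\ell da_\ell\wedge\omega^\ell,\qquad \omega^\ell=\frac{dx_\ell}{y_\ell}+m^\ell,$$ where $x_\ell,y_\ell$ are regarded as functions of $(u,z)$ through $w=(G(u)z)_\ell$, $dx_\ell$ is the total differential, the $m^\ell$ are holomorphic $1$-forms on $\mathcal C$, and the equality holds wherever all $x_\ell$ are finite and all $y_\ell\neq0$. Near every point of $\mathcal C$ there is a holomorphic $1$-form $b=\sum_k b^k\,du_k$ with $\sum_\ell da_\ell\wedge m^\ell=db$, so that there one may take $\omega^\ell=dx_\ell/y_\ell+\sum_k(\partial b^k/\partial a_\ell)\,du_k$. (2) Suppose that the geometry also has a scale symmetry. Then the data in (1) can be chosen so that all $c_n^\ell$ are constant on $\mathcal C$ and every $a_\ell$ is homogeneous of weight one, i.e. $a_\ell(\lambda\circ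 u)=\lambda\,a_\ell(u)$ for $\lambda=e^s$ whenever $e^{ts}\circ u\in\mathcal C$ for all $t\in[0,1]$. For every choice of data as in (1) the moduli $Z^\ell$ are constant on $\mathcal C$. Finally, $\tau$ is constant on $\mathcal C$; in particular the geometry is isotrivial. -/

import Mathlib

open scoped Topology Matrix
open Set Filter

noncomputable section

/-- Complex `r`-space. "Holomorphic on an open set" is `DifferentiableOn ℂ` throughout. -/
abbrev CSpace (r : ℕ) : Type := Fin r → ℂ

/-- The wedge product of two covectors: `(α ∧ β)(v, w) = α v β w - α w β v`. -/
def wedge {V : Type*} [NormedAddCommGroup V] [NormedSpace ℂ V] (α β : V →L[ℂ] ℂ) (v w : V) : ℂ :=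
  α v * β w - α w * β v

/-! ### Polarized abelian varieties in a symplectic basis -/

/-- The diagonal matrix `Δ = diag(d₁, …, d_r)` of invariant factors. -/
def invFactorMatrix {r : ℕ} (d : Fin r → ℕ) : Matrix (Fin r) (Fin r) ℤ :=
  Matrix.diagonal fun i => (d i : ℤ)

/-- The polarization `J` (Dirac pairing) on the lattice `ℤ^{2r}`, in a symplectic basis. -/
def diracPairing {r : ℕ} (d : Fin r → ℕ) : Matrix (Fin r ⊕ Fin r) (Fin r ⊕ Fin r) ℤ :=
  Matrix.fromBlocks 0 (invFactorMatrix d) (-invFactorMatrix d) 0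

/-- The period matrix `Π = (Δ  τ)`. -/
def periodMatrix {r : ℕ} (d : Fin r → ℕ) (τ : Matrix (Fin r) (Fin r) ℂ) :
    Matrix (Fin r) (Fin r ⊕ Fin r) ℂ :=
  Matrix.fromCols ((invFactorMatrix d).map (Int.cast : ℤ → ℂ)) τ

/-- The lattice vector `Π n`, for `n ∈ ℤ^{2r}`. -/
def periodVector {r : ℕ} (d : Fin r → ℕ) (τ : Matrix (Fin r) (Fin r) ℂ)
    (n : Fin r ⊕ Fin r → ℤ) : CSpace r :=
  periodMatrix d τ *ᵥ fun i => (n i : ℂ)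

/-- The deck transformation `(u, z) ↦ (u, z + Π(u) n)` of the universal cover of the fibres. -/
def deckMap {r : ℕ} (d : Fin r → ℕ) (τ : CSpace r → Matrix (Fin r) (Fin r) ℂ)
    (n : Fin r ⊕ Fin r → ℤ) (p : CSpace r × CSpace r) : CSpace r × CSpace r :=
  (p.1, p.2 + periodVector d (τ p.1) n)

/-! ### Local special Kähler geometries -/

/-- A local special Kähler geometry of rank `r`, as a holomorphic Lagrangian fibration of polarized
abelian varieties over an open contractible patch `C`, with complex coordinates `u ∈ ℂ^r`.

The first homology of the fibres carries a constant polarization `J`, written in a symplectic basis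
with invariant factors `d`, and the fibre coordinates `z` are normalised so that the period matrix
is `(Δ  τ(u))`. So `X_u = ℂ^r / (Δ ℤ^r + τ(u) ℤ^r)`, the Riemann conditions are `τ = τᵗ`, `Im τ > 0`,
and the total space is the quotient `X` of `C × ℂ^r` by the deck transformations
`(u, z) ↦ (u, z + Π(u) n)`. A holomorphic form on `X` is the same as a holomorphic form on
`C × ℂ^r` which is invariant under these; this is how the symplectic form `L` is given. -/
structure LocalSK (r : ℕ) where
  /-- the patch of the Coulomb branch -/
  C : Set (CSpace r)
  isOpen_C : IsOpen C
  contractible_C : ContractibleSpace C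
  /-- the invariant factors of the polarization -/
  d : Fin r → ℕ
  d_pos : ∀ i, 0 < d i
  d_dvd : ∀ i j, i ≤ j → d i ∣ d j
  /-- the complex modulus of the fibres (the matrix of low-energy couplings) -/
  τ : CSpace r → Matrix (Fin r) (Fin r) ℂ
  τ_holo : ∀ i j, DifferentiableOn ℂ (fun u => τ u i j) C
  τ_symm : ∀ u ∈ C, (τ u).IsSymm
  τ_pos : ∀ u ∈ C, ((τ u).map Complex.im).PosDef
  /-- the holomorphic symplectic form, lifted to `C × ℂ^r` -/
  L : CSpace r × CSpace r → (CSpace r × CSpace r) [⋀^Fin 2]→L[ℂ] ℂ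
  L_holo : DifferentiableOn ℂ L (C ×ˢ univ)
  /-- `L` descends to the total space of the fibration -/
  L_invariant : ∀ n : Fin r ⊕ Fin r → ℤ, ∀ p ∈ C ×ˢ (univ : Set (CSpace r)),
    (L (deckMap d τ n p)).compContinuousLinearMap (fderiv ℂ (deckMap d τ n) p) = L p
  L_closed : ∀ p ∈ C ×ˢ (univ : Set (CSpace r)), extDeriv L p = 0
  L_nondegenerate : ∀ p ∈ C ×ˢ (univ : Set (CSpace r)), ∀ v, (∀ w, L p ![v, w] = 0) → v = 0
  /-- the fibres are Lagrangian -/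
  L_lagrangian : ∀ p ∈ C ×ˢ (univ : Set (CSpace r)), ∀ v w : CSpace r,
    L p ![((0 : CSpace r), v), ((0 : CSpace r), w)] = 0

namespace LocalSK

variable {r : ℕ}

/-- The period matrix of the fibre over `u`. -/
def period (S : LocalSK r) (u : CSpace r) : Matrix (Fin r) (Fin r ⊕ Fin r) ℂ :=
  periodMatrix S.d (S.τ u)

/-- The lattice of the fibre `X_u = ℂ^r / Λ_u`. -/
def lattice (S : LocalSK r) (u : CSpace r) : Set (CSpace r) :=
  range (periodVector S.d (S.τ u))

/-- The complex torus `X_u` (without regard to its polarization) is isomorphic to a product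
`∏ ℂ/(ℤ p_ℓ + ℤ q_ℓ)` of `r` complex tori of dimension one. -/
def FibreCompletelySplit (S : LocalSK r) (u : CSpace r) : Prop :=
  ∃ (F : CSpace r ≃ₗ[ℂ] CSpace r) (p q : Fin r → ℂ),
    (∀ l, LinearIndependent ℝ ![p l, q l]) ∧
    ∀ z : CSpace r, z ∈ S.lattice u ↔ ∀ l, F z l ∈ AddSubgroup.closure {p l, q l}

/-- The generic fibre is completely split: the fibres over the points of `C` outside some meagre
set (for instance, outside a proper analytic subset, or outside the empty set) are so. -/
def CompletelySplit (S : LocalSK r) : Prop :=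
  IsMeagre {u | u ∈ S.C ∧ ¬ S.FibreCompletelySplit u}

/-- The geometry is isotrivial: `τ` is locally constant. -/
def Isotrivial (S : LocalSK r) : Prop :=
  ∀ u₀ ∈ S.C, ∀ᶠ u in 𝓝 u₀, S.τ u = S.τ u₀

end LocalSK

/-! ### Weierstrass curves -/

/-- The functions `x`, `y` on `ℂ`, with poles on the lattice `Λ`, identify `ℂ/Λ` with the smooth
(projective) Weierstrass curve `y² = x³ + c₁ x + c₀`: they are `Λ`-periodic, induce a bijection
from `(ℂ ∖ Λ)/Λ` to the affine curve, send `Λ` to the point at infinity, and pull the holomorphic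
differential `dx/y` back to `dw`. -/
structure IsWeierstrassUniformization (Λ : AddSubgroup ℂ) (c₁ c₀ : ℂ) (x y : ℂ → ℂ) : Prop where
  smooth : 4 * c₁ ^ 3 + 27 * c₀ ^ 2 ≠ 0
  hasDerivAt_x : ∀ w, w ∉ Λ → HasDerivAt x (y w) w
  differentiableAt_y : ∀ w, w ∉ Λ → DifferentiableAt ℂ y w
  equation : ∀ w, w ∉ Λ → y w ^ 2 = x w ^ 3 + c₁ * x w + c₀
  pole : ∀ w, w ∈ Λ → Tendsto x (𝓝[≠] w) (Bornology.cobounded ℂ)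
  surjective : ∀ X Y : ℂ, Y ^ 2 = X ^ 3 + c₁ * X + c₀ → ∃ w, w ∉ Λ ∧ x w = X ∧ y w = Y
  injective : ∀ w w', w ∉ Λ → w' ∉ Λ → ((x w = x w' ∧ y w = y w') ↔ w - w' ∈ Λ)

/-- The lattice `ℤ + ℤ Z`. -/
def ellLattice (Z : ℂ) : AddSubgroup ℂ := AddSubgroup.closure {1, Z}

/-- Locally on `C`, the function `f` is a holomorphic function of `g` alone. -/
def LocallyFunctionOf {r : ℕ} (C : Set (CSpace r)) (f g : CSpace r → ℂ) : Prop :=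
  ∀ u₀ ∈ C, ∃ U : Set (CSpace r), IsOpen U ∧ u₀ ∈ U ∧ U ⊆ C ∧
    ∃ (V : Set ℂ) (h : ℂ → ℂ), IsOpen V ∧ MapsTo g U V ∧ DifferentiableOn ℂ h V ∧
      ∀ u ∈ U, f u = h (g u)

/-! ### The local form of a completely split geometry -/

/-- A presentation of a local special Kähler geometry as a fibre product of Weierstrass curves
`y_ℓ² = x_ℓ³ + c₁^ℓ(a_ℓ) x_ℓ + c₀^ℓ(a_ℓ)` with symplectic form `L = ∑ da_ℓ ∧ ω^ℓ`. -/
structure SplitNormalForm {r : ℕ} (S : LocalSK r) where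
  /-- the change of homology basis, from the symplectic basis to the split basis -/
  R : Matrix (Fin r ⊕ Fin r) (Fin r ⊕ Fin r) ℤ
  R_unit : IsUnit R.det
  /-- the change of basis of the holomorphic one-forms of the fibres: `w = G(u) z` are the
  coordinates of the elliptic factors -/
  G : CSpace r → Matrix (Fin r) (Fin r) ℂ
  G_holo : ∀ i j, DifferentiableOn ℂ (fun u => G u i j) S.C
  /-- the moduli of the elliptic factors `X_u^ℓ = ℂ/(ℤ + ℤ Z^ℓ(u))` -/
  Z : Fin r → CSpace r → ℂ
  Z_holo : ∀ l, DifferentiableOn ℂ (Z l) S.C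
  Z_pos : ∀ l, ∀ u ∈ S.C, 0 < (Z l u).im
  /-- in the split basis the period matrix is `(1  diag(Z¹, …, Z^r))` -/
  period_split : ∀ u ∈ S.C, G u * S.period u * R.map (Int.cast : ℤ → ℂ) =
    Matrix.fromCols 1 (Matrix.diagonal fun l => Z l u)
  /-- the coordinates `a_ℓ` of the base -/
  a : Fin r → CSpace r → ℂ
  a_holo : ∀ l, DifferentiableOn ℂ (a l) S.C
  a_indep : ∀ u ∈ S.C, LinearIndependent ℂ fun l => fderiv ℂ (a l) u
  /-- the Weierstrass coefficients -/
  c₁ : Fin r → CSpace r → ℂ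
  c₀ : Fin r → CSpace r → ℂ
  c₁_holo : ∀ l, DifferentiableOn ℂ (c₁ l) S.C
  c₀_holo : ∀ l, DifferentiableOn ℂ (c₀ l) S.C
  /-- the coordinates `x_ℓ`, `y_ℓ` as functions of `u` and of the uniformizing coordinate `w^ℓ` -/
  x : Fin r → CSpace r → ℂ → ℂ
  y : Fin r → CSpace r → ℂ → ℂ
  x_holo : ∀ l, DifferentiableOn ℂ (fun q : CSpace r × ℂ => x l q.1 q.2)
    {q | q.1 ∈ S.C ∧ q.2 ∉ ellLattice (Z l q.1)}
  y_holo : ∀ l, DifferentiableOn ℂ (fun q : CSpace r × ℂ => y l q.1 q.2)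
    {q | q.1 ∈ S.C ∧ q.2 ∉ ellLattice (Z l q.1)}
  /-- `X_u^ℓ` is the curve `y² = x³ + c₁^ℓ(u) x + c₀^ℓ(u)`, and `dx_ℓ/y_ℓ` has period `1` along the
  first basic cycle -/
  curve : ∀ l, ∀ u ∈ S.C,
    IsWeierstrassUniformization (ellLattice (Z l u)) (c₁ l u) (c₀ l u) (x l u) (y l u)
  c₁_dep : ∀ l, LocallyFunctionOf S.C (c₁ l) (a l)
  c₀_dep : ∀ l, LocallyFunctionOf S.C (c₀ l) (a l)
  Z_dep : ∀ l, LocallyFunctionOf S.C (Z l) (a l)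
  /-- the base part of the one-form `ω^ℓ = dx_ℓ/y_ℓ + m^ℓ` -/
  m : Fin r → CSpace r → CSpace r →L[ℂ] ℂ
  m_holo : ∀ l, DifferentiableOn ℂ (m l) S.C
  /-- `L = ∑ da_ℓ ∧ (dx_ℓ/y_ℓ + m^ℓ)` wherever `x_ℓ` is finite and `y_ℓ` does not vanish. Here
  `dx_ℓ` is the total differential of `x_ℓ`, as a function of `(u, z)`. -/
  L_eq : ∀ u ∈ S.C, ∀ z : CSpace r,
    (∀ l, (G u *ᵥ z) l ∉ ellLattice (Z l u) ∧ y l u ((G u *ᵥ z) l) ≠ 0) →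
    ∀ v v' : CSpace r × CSpace r, S.L (u, z) ![v, v'] =
      ∑ l, wedge ((fderiv ℂ (a l) u).comp (ContinuousLinearMap.fst ℂ (CSpace r) (CSpace r)))
        ((y l u ((G u *ᵥ z) l))⁻¹ •
            fderiv ℂ (fun p : CSpace r × CSpace r => x l p.1 ((G p.1 *ᵥ p.2) l)) (u, z)
          + (m l u).comp (ContinuousLinearMap.fst ℂ (CSpace r) (CSpace r))) v v'
  /-- Locally `∑ da_ℓ ∧ m^ℓ = db` for a holomorphic one-form `b = ∑ b^k du_k`, so that `m^ℓ` may be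
  replaced there by `∑_k (∂b^k/∂a_ℓ) du_k`. -/
  base_exact : ∀ u₀ ∈ S.C, ∃ U : Set (CSpace r), IsOpen U ∧ u₀ ∈ U ∧ U ⊆ S.C ∧
    ∃ b : Fin r → CSpace r → ℂ, (∀ k, DifferentiableOn ℂ (b k) U) ∧
      ∀ u ∈ U, ∀ v v' : CSpace r, ∑ l, wedge (fderiv ℂ (a l) u) (m l u) v v' =
        ∑ k, wedge (fderiv ℂ (b k) u) (ContinuousLinearMap.proj k) v v'

/-! ### Scale symmetry -/

/-- The action `u_k ↦ λ^{Δ_k} u_k` of `λ = e^s` with the weights `Δ_k`. -/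
def scalePoint {r : ℕ} (wt : Fin r → ℝ) (s : ℂ) (u : CSpace r) : CSpace r :=
  fun k => Complex.exp ((wt k : ℂ) * s) * u k

/-- A complex scale symmetry of a local special Kähler geometry, with respect to which `L` has
weight one. Since `C` is only a contractible patch, `λ = e^s` acts as a local action: it is given
on an open set `dom` of pairs `(s, u)` which contains all `(0, u)`. The action is lifted to the
total space by `(u, z) ↦ (λ ∘ u, A(s,u) z + t(s,u))`, which identifies `X_u` and `X_{λ ∘ u}` as
polarized abelian varieties up to translation, and pulls `L` back to `λ L`. -/
structure ScaleSymmetry {r : ℕ} (S : LocalSK r) where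
  /-- the (real) scaling weights of the coordinates `u_k` -/
  wt : Fin r → ℝ
  dom : Set (ℂ × CSpace r)
  isOpen_dom : IsOpen dom
  zero_mem_dom : ∀ u ∈ S.C, ((0 : ℂ), u) ∈ dom
  mem_of_dom : ∀ q ∈ dom, q.2 ∈ S.C ∧ scalePoint wt q.1 q.2 ∈ S.C
  A : ℂ × CSpace r → Matrix (Fin r) (Fin r) ℂ
  t : ℂ × CSpace r → CSpace r
  A_holo : ∀ i j, DifferentiableOn ℂ (fun q => A q i j) dom
  t_holo : DifferentiableOn ℂ t dom
  A_zero : ∀ u ∈ S.C, A (0, u) = 1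
  t_zero : ∀ u ∈ S.C, t (0, u) = 0
  /-- the fibres are preserved, with their polarization -/
  fibre_iso : ∀ q ∈ dom, ∃ M : Matrix (Fin r ⊕ Fin r) (Fin r ⊕ Fin r) ℤ,
    Mᵀ * diracPairing S.d * M = diracPairing S.d ∧
    A q * S.period q.2 = S.period (scalePoint wt q.1 q.2) * M.map (Int.cast : ℤ → ℂ)
  /-- `λ = e^s` maps `L` to `λ L` -/
  L_weight : ∀ q ∈ dom, ∀ z : CSpace r,
    (S.L (scalePoint wt q.1 q.2, A q *ᵥ z + t q)).compContinuousLinearMap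
      (fderiv ℂ (fun p : CSpace r × CSpace r =>
        (scalePoint wt q.1 p.1, A (q.1, p.1) *ᵥ p.2 + t (q.1, p.1))) (q.2, z))
      = Complex.exp q.1 • S.L (q.2, z)

/-- `f` is homogeneous of weight one: `f(λ ∘ u) = λ f(u)` for `λ = e^s`, whenever the orbit segment
from `u` to `λ ∘ u` stays in `C`. -/
def HomogeneousWeightOne {r : ℕ} (C : Set (CSpace r)) (wt : Fin r → ℝ) (f : CSpace r → ℂ) : Prop :=
  ∀ u ∈ C, ∀ s : ℂ, (∀ t ∈ Icc (0 : ℝ) 1, scalePoint wt ((t : ℂ) * s) u ∈ C) →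
    f (scalePoint wt s u) = Complex.exp s * f u

end

/-! Splitting. A splitting of one fibre is a unimodular integral `R` after which the columns of the
period matrix form proportional pairs. Only countably many `R` exist, so by Baire one of them works
on a set that is dense in some nonempty open set. Proportionality is the vanishing of holomorphic
2×2 minors, so by the identity theorem it holds on all of the connected set `C`
(`CompletelySplit.exists_basis`). The ratio `Z^ℓ` is never real, because the periods are independent
over the reals, so its imaginary part keeps its sign.

Symplectic form. The mixed (horizontal-vertical) part of `L` is periodic along each fibre, hence
constant by Liouville (`bil_mixed`). Closedness then makes the horizontal part affine in `z`.
Invariance under the constant periods removes the linear term, and invariance under the remaining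
ones makes the contraction of `L` with every lattice vector a closed form on the base
(`periodForm_closed`). Let `θ_ℓ` be the contraction with the first period of the `ℓ`-th factor.
Since `C` is contractible, `θ_ℓ = da_ℓ`. The second period gives `Z^ℓ da_ℓ`, which is closed too;
hence `dZ^ℓ ∧ da_ℓ = 0`, and `Z^ℓ` is locally a function of `a_ℓ`. Nondegeneracy of `L` makes the
`da_ℓ` independent.

Curves. Take `x = 4℘` and `y = 4℘'`, jointly holomorphic in modulus and argument. The `dZ^ℓ` term of
`dx_ℓ` dies against `da_ℓ`, so `da_ℓ ∧ dx_ℓ/y_ℓ = da_ℓ ∧ dw^ℓ`. These terms sum to the mixed part of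
`L`; the horizontal part is a closed two-form on the base and supplies the `m^ℓ` and `b`.

Scaling. The lift acts on homology by an integral matrix, which is the identity near `s = 0`; there
the action preserves `τ` and multiplies `θ_ℓ` by `λ`. With `E` the Euler field, Cartan's formula
gives `d(θ_ℓ(E)) = θ_ℓ`, so `a_ℓ = θ_ℓ(E)` is a primitive of weight one. Also `dZ^ℓ(E) = 0`. If
`dZ^ℓ` were nonzero at a point, then `dZ^ℓ ∧ θ_ℓ = 0` would force `θ_ℓ(E) = 0` nearby and so `θ_ℓ =
0`, which is impossible. Thus the `Z^ℓ` are constant, and they determine `τ`. -/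

/-! ### Holomorphic functions of several variables -/

section SeveralComplexVariables

variable {E F : Type*} [NormedAddCommGroup E] [NormedSpace ℂ E]
  [NormedAddCommGroup F] [NormedSpace ℂ F]

/-- Cauchy estimate for the Fréchet derivative. -/
theorem norm_fderiv_le_of_norm_le_on_ball {f : E → F} {c : E} {R C : ℝ} (hR : 0 < R)
    (hd : DifferentiableOn ℂ f (Metric.ball c R)) (hC : ∀ x ∈ Metric.ball c R, ‖f x‖ ≤ C) :
    ‖fderiv ℂ f c‖ ≤ 2 * C / R := by
  -- The factor 2 arises because `f` maps the ball into the closed ball of radius `2 * C` about `f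
  -- c`.
  refine Complex.norm_fderiv_le_div_of_mapsTo_ball hd (fun x hx => ?_) hR
  rw [mem_closedBall_iff_norm]
  have h1 := hC x hx
  have h2 := hC c (Metric.mem_ball_self hR)
  linarith [norm_sub_le (f x) (f c)]

/-- A locally normally convergent series of holomorphic functions of several variables is
holomorphic. -/
theorem differentiableAt_tsum_of_summable_norm_on_ball {ι : Type*} [CompleteSpace F]
    {f : ι → E → F} {u : ι → ℝ} {c : E} {R : ℝ} (hR : 0 < R) (hu : Summable u)
    (hf : ∀ i, DifferentiableOn ℂ (f i) (Metric.ball c R))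
    (hfu : ∀ i, ∀ x ∈ Metric.ball c R, ‖f i x‖ ≤ u i) :
    DifferentiableAt ℂ (fun x => ∑' i, f i x) c := by
  have hsub : ∀ x ∈ Metric.ball c (R / 2), Metric.ball x (R / 2) ⊆ Metric.ball c R := by
    intro x hx
    refine Metric.ball_subset_ball' ?_
    rw [Metric.mem_ball] at hx
    linarith
  have hc : c ∈ Metric.ball c (R / 2) := Metric.mem_ball_self (by positivity)
  let _ : NormedSpace ℝ E := NormedSpace.restrictScalars ℝ ℂ E
  -- Around each point of the half ball there is still room for a ball of radius `R / 2`, so the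
  -- Cauchy estimate bounds the series of derivatives by a convergent one.
  refine (hasFDerivAt_tsum_of_isPreconnected (u := fun i => 2 * u i / (R / 2))
    (f' := fun i x => fderiv ℂ (f i) x) (s := Metric.ball c (R / 2)) ?_
    Metric.isOpen_ball (convex_ball c _).isPreconnected (fun i x hx => ?_) (fun i x hx => ?_)
    hc ?_ hc).differentiableAt
  · exact (hu.mul_left 2).div_const _
  · exact ((hf i).differentiableAt (Metric.isOpen_ball.mem_nhds
      (hsub x hx (Metric.mem_ball_self (by positivity))))).hasFDerivAt
  · exact norm_fderiv_le_of_norm_le_on_ball (by positivity) ((hf i).mono (hsub x hx))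
      fun y hy => hfu i y (hsub x hx hy)
  · exact Summable.of_norm_bounded hu fun i => hfu i c (Metric.mem_ball_self hR)

/-- The derivative of a holomorphic function of several variables is continuous. -/
theorem DifferentiableOn.continuousOn_fderiv_complex {f : E → F} {U : Set E} (hU : IsOpen U)
    (hf : DifferentiableOn ℂ f U) : ContinuousOn (fderiv ℂ f) U := by
  let _ : NormedSpace ℝ E := NormedSpace.restrictScalars ℝ ℂ E
  intro x hx
  obtain ⟨ε, hε, hεU, hb⟩ : ∃ ε > 0, Metric.ball x (4 * ε) ⊆ U ∧
      ∀ y ∈ Metric.ball x (4 * ε), ‖f y‖ ≤ ‖f x‖ + 1 := by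
    have h1 : ∀ᶠ y in 𝓝 x, ‖f y‖ < ‖f x‖ + 1 :=
      ((hf.continuousOn.continuousAt (hU.mem_nhds hx)).norm).eventually
        (gt_mem_nhds (lt_add_one _))
    obtain ⟨ε, hε, h⟩ := Metric.mem_nhds_iff.1 (inter_mem (hU.mem_nhds hx) h1)
    refine ⟨ε / 4, by positivity, fun y hy => (h ?_).1, fun y hy => (h ?_).2.le⟩ <;>
    · convert hy using 2; ring
  have hball : ∀ y ∈ Metric.ball x (2 * ε), Metric.ball y (2 * ε) ⊆ Metric.ball x (4 * ε) := by
    intro y hy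
    refine Metric.ball_subset_ball' ?_
    rw [Metric.mem_ball] at hy
    linarith
  set K : ℝ := 2 * (‖f x‖ + 1) / (2 * ε) with hK
  have hK0 : 0 ≤ K := by positivity
  have hder : ∀ y ∈ Metric.ball x (2 * ε), ‖fderiv ℂ f y‖ ≤ K := fun y hy =>
    norm_fderiv_le_of_norm_le_on_ball (by positivity) (hf.mono ((hball y hy).trans hεU))
      fun z hz => hb z (hball y hy hz)
  have hdiff : ∀ y ∈ Metric.ball x (4 * ε), DifferentiableAt ℂ f y := fun y hy =>
    hf.differentiableAt (hU.mem_nhds (hεU hy))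
  have hlip : ∀ y ∈ Metric.ball x (2 * ε), ∀ z ∈ Metric.ball x (2 * ε),
      ‖f z - f y‖ ≤ K * ‖z - y‖ := fun y hy z hz =>
    (convex_ball x (2 * ε)).norm_image_sub_le_of_norm_fderiv_le (𝕜 := ℂ)
      (fun w hw => hdiff w (Metric.ball_subset_ball (by linarith) hw)) hder hy hz
  -- The Cauchy estimate is applied to the difference `f (z + (y - x)) - f z`, which is bounded by
  -- `K * ‖y - x‖`; so `fderiv ℂ f` is Lipschitz at `x`.
  have key : ∀ y ∈ Metric.ball x ε, ‖fderiv ℂ f y - fderiv ℂ f x‖ ≤ 2 * K / ε * ‖y - x‖ := by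
    intro y hy
    have hy' : ‖y - x‖ < ε := by rwa [mem_ball_iff_norm] at hy
    have e1 : fderiv ℂ (fun z => f (z + (y - x)) - f z) x = fderiv ℂ f y - fderiv ℂ f x := by
      have hyd : HasFDerivAt f (fderiv ℂ f y) (x + (y - x)) := by
        rw [add_sub_cancel]
        exact (hdiff y (Metric.ball_subset_ball (by linarith) hy)).hasFDerivAt
      have h2 := hyd.comp x ((hasFDerivAt_id x).add_const (y - x))
      rw [ContinuousLinearMap.comp_id] at h2
      exact (h2.sub (hdiff x (Metric.mem_ball_self (by positivity))).hasFDerivAt).fderiv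
    have hshift : ∀ z ∈ Metric.ball x ε, z + (y - x) ∈ Metric.ball x (2 * ε) := by
      intro z hz
      rw [mem_ball_iff_norm] at hz ⊢
      calc ‖z + (y - x) - x‖ = ‖(z - x) + (y - x)‖ := by congr 1; abel
        _ ≤ ‖z - x‖ + ‖y - x‖ := norm_add_le _ _
        _ < 2 * ε := by linarith
    rw [← e1]
    have h3 := norm_fderiv_le_of_norm_le_on_ball (f := fun z => f (z + (y - x)) - f z) (c := x)
      (R := ε) (C := K * ‖y - x‖) hε ?_ ?_
    · exact h3.trans_eq (by ring)
    · intro z hz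
      have hz1 := hdiff _ (Metric.ball_subset_ball (by linarith) (hshift z hz))
      have hz2 := hdiff z (Metric.ball_subset_ball (by linarith) hz)
      exact ((hz1.comp z (differentiableAt_id.add_const (y - x))).sub hz2).differentiableWithinAt
    · intro z hz
      refine (hlip z (Metric.ball_subset_ball (by linarith) hz) _ (hshift z hz)).trans_eq ?_
      congr 2; abel
  refine ContinuousAt.continuousWithinAt ?_
  rw [ContinuousAt, tendsto_iff_norm_sub_tendsto_zero]
  refine squeeze_zero' (Eventually.of_forall fun _ => norm_nonneg _)
    (eventually_of_mem (Metric.ball_mem_nhds x hε) key) ?_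
  have : ContinuousAt (fun y => 2 * K / ε * ‖y - x‖) x := by fun_prop
  simpa [ContinuousAt] using this

/-- The identity theorem for holomorphic functions of several variables. -/
theorem DifferentiableOn.eqOn_zero_of_isPreconnected {f : E → F} [CompleteSpace F] {U : Set E}
    (hU : IsOpen U)
    (hc : IsPreconnected U) (hf : DifferentiableOn ℂ f U) {x₀ : E} (hx₀ : x₀ ∈ U)
    (h₀ : ∀ᶠ x in 𝓝 x₀, f x = 0) : ∀ x ∈ U, f x = 0 := by
  -- `V` is open; that it is also closed in `U` follows by restricting `f` to the complex line
  -- through a nearby point `p` of `V` and using the identity theorem in one variable.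
  set V : Set E := {x | ∀ᶠ y in 𝓝 x, f y = 0} with hV
  have hVo : IsOpen V := isOpen_setOfPred_eventually_nhds
  suffices h : U ⊆ V from fun x hx => (h hx).self_of_nhds
  refine hc.subset_of_closure_inter_subset hVo ⟨x₀, hx₀, h₀⟩ ?_
  rintro x ⟨hxV, hxU⟩
  obtain ⟨ε, hε, hεU⟩ := Metric.isOpen_iff.1 hU x hxU
  obtain ⟨p, hp, hpx⟩ := Metric.mem_closure_iff.1 hxV ε hε
  have hpb : p ∈ Metric.ball x ε := by rwa [Metric.mem_ball, dist_comm]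
  refine eventually_of_mem (Metric.ball_mem_nhds x hε) fun y hy => ?_
  let _ : NormedSpace ℝ E := NormedSpace.restrictScalars ℝ ℂ E
  set W : Set ℂ := (fun t : ℂ => p + t • (y - p)) ⁻¹' Metric.ball x ε with hW
  have hcont : Continuous fun t : ℂ => p + t • (y - p) := by fun_prop
  have hWo : IsOpen W := Metric.isOpen_ball.preimage hcont
  have hWc : IsPreconnected W := by
    have : Convex ℝ W := by
      have := (convex_ball x ε).affine_preimage
        ((AffineMap.const ℝ ℂ p) + ((LinearMap.toSpanSingleton ℂ E (y - p)).restrictScalars ℝ).toAffineMap)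
      exact this
    exact this.isPreconnected
  have hd : DifferentiableOn ℂ (fun t : ℂ => f (p + t • (y - p))) W := by
    intro t ht
    refine DifferentiableAt.differentiableWithinAt ?_
    exact (hf.differentiableAt (hU.mem_nhds (hεU ht))).comp t (by fun_prop)
  have h0W : (0 : ℂ) ∈ W := by simpa [hW] using hpb
  have hz : (fun t : ℂ => f (p + t • (y - p))) =ᶠ[𝓝 0] 0 := by
    have : Tendsto (fun t : ℂ => p + t • (y - p)) (𝓝 0) (𝓝 p) := by
      have := hcont.tendsto 0
      simpa using this
    exact this.eventually hp
  have := (hd.analyticOnNhd hWo).eqOn_zero_of_preconnected_of_eventuallyEq_zero hWc h0W hz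
    (x := 1) (by simpa [hW] using hy)
  simpa using this

end SeveralComplexVariables

/-! ### Poincaré lemma for two-forms on a ball -/

section ClosedForms

set_option maxSynthPendingDepth 3

/-- Differentiation under the integral sign over `[0, 1]`, for an integrand which is continuously
differentiable in the parameter. -/
theorem hasFDerivAt_intervalIntegral_of_continuousOn {E G : Type*} [NormedAddCommGroup E]
    [NormedSpace ℂ E] [ProperSpace E] [NormedAddCommGroup G] [NormedSpace ℂ G]
    {U : Set E} (hU : IsOpen U) {f : E → ℝ → G} {f' : E → ℝ → E →L[ℂ] G}
    (hf : ContinuousOn (Function.uncurry f) (U ×ˢ Icc 0 1))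
    (hf' : ContinuousOn (Function.uncurry f') (U ×ˢ Icc 0 1))
    (hd : ∀ x ∈ U, ∀ t ∈ Icc (0 : ℝ) 1, HasFDerivAt (fun x => f x t) (f' x t) x)
    {x₀ : E} (hx₀ : x₀ ∈ U) :
    HasFDerivAt (fun x => ∫ t in (0 : ℝ)..1, f x t) (∫ t in (0 : ℝ)..1, f' x₀ t) x₀ := by
  obtain ⟨ε, hε, hεU⟩ := Metric.nhds_basis_closedBall.mem_iff.1 (hU.mem_nhds hx₀)
  have hK : IsCompact (Metric.closedBall x₀ ε ×ˢ Icc (0 : ℝ) 1) :=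
    (isCompact_closedBall x₀ ε).prod isCompact_Icc
  obtain ⟨C, hC⟩ := hK.exists_bound_of_continuousOn (hf'.mono (prod_mono hεU Subset.rfl))
  have hI : uIoc (0 : ℝ) 1 ⊆ Icc (0 : ℝ) 1 := by
    rw [uIoc_of_le zero_le_one]; exact Ioc_subset_Icc_self
  have hsec : ∀ x ∈ U, ContinuousOn (f x) (Icc 0 1) := fun x hx =>
    hf.comp (f := fun t => (x, t)) (by fun_prop) fun t ht => ⟨hx, ht⟩
  have hsec' : ∀ x ∈ U, ContinuousOn (f' x) (Icc 0 1) := fun x hx =>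
    hf'.comp (f := fun t => (x, t)) (by fun_prop) fun t ht => ⟨hx, ht⟩
  refine intervalIntegral.hasFDerivAt_integral_of_dominated_of_fderiv_le (bound := fun _ => C)
    (F' := f') (Metric.closedBall_mem_nhds x₀ hε) ?_ ?_ ?_ ?_ intervalIntegrable_const ?_
  · filter_upwards [hU.mem_nhds hx₀] with x hx
    exact ((hsec x hx).mono hI).aestronglyMeasurable measurableSet_uIoc
  · refine ContinuousOn.intervalIntegrable ?_
    rw [uIcc_of_le zero_le_one]; exact hsec x₀ hx₀
  · exact ((hsec' x₀ hx₀).mono hI).aestronglyMeasurable measurableSet_uIoc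
  · exact Eventually.of_forall fun t ht x hx => hC (x, t) ⟨hx, hI ht⟩
  · exact Eventually.of_forall fun t ht x hx => hd x (hεU hx) t (hI ht)

/-- The Poincaré lemma for holomorphic two-forms on a ball. -/
theorem exists_primitive_of_closed_two_form {E : Type*} [NormedAddCommGroup E]
    [NormedSpace ℂ E] [ProperSpace E] {N : E → E →L[ℂ] E →L[ℂ] ℂ} {x₀ : E} {R : ℝ}
    (hd : DifferentiableOn ℂ N (Metric.ball x₀ R))
    (halt : ∀ x ∈ Metric.ball x₀ R, ∀ v w, N x v w = -N x w v)
    (hcl : ∀ x ∈ Metric.ball x₀ R, ∀ u v w,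
      fderiv ℂ N x u v w + fderiv ℂ N x v w u + fderiv ℂ N x w u v = 0) :
    ∃ b : E → E →L[ℂ] ℂ, ∀ x ∈ Metric.ball x₀ R, DifferentiableAt ℂ b x ∧
      ∀ v w, fderiv ℂ b x v w - fderiv ℂ b x w v = N x v w := by
  set U := Metric.ball x₀ R with hU
  have hUo : IsOpen U := Metric.isOpen_ball
  have hseg : ∀ x ∈ U, ∀ t ∈ Icc (0 : ℝ) 1, x₀ + (t : ℂ) • (x - x₀) ∈ U := by
    intro x hx t ht
    rw [hU, mem_ball_iff_norm] at hx ⊢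
    rw [add_sub_cancel_left, norm_smul, Complex.norm_real, Real.norm_of_nonneg ht.1]
    nlinarith [norm_nonneg (x - x₀), ht.1, ht.2]
  -- The radial homotopy operator: `b(x) = ∫₀¹ t N(x₀ + t (x - x₀))(x - x₀, ·) dt`.
  set f : E → ℝ → E →L[ℂ] ℂ := fun x t => (t : ℂ) • N (x₀ + (t : ℂ) • (x - x₀)) (x - x₀) with hf
  set f' : E → ℝ → E →L[ℂ] E →L[ℂ] ℂ := fun x t =>
    (t : ℂ) • (N (x₀ + (t : ℂ) • (x - x₀)) +
      ((t : ℂ) • fderiv ℂ N (x₀ + (t : ℂ) • (x - x₀))).flip (x - x₀)) with hf'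
  have hγ : ContinuousOn (fun p : E × ℝ => x₀ + (p.2 : ℂ) • (p.1 - x₀)) (U ×ˢ Icc 0 1) := by
    fun_prop
  have hγm : MapsTo (fun p : E × ℝ => x₀ + (p.2 : ℂ) • (p.1 - x₀)) (U ×ˢ Icc 0 1) U :=
    fun p hp => hseg p.1 hp.1 p.2 hp.2
  have hNc := hd.continuousOn.comp hγ hγm
  have hDc := (hd.continuousOn_fderiv_complex hUo).comp hγ
    hγm
  have hfc : ContinuousOn (Function.uncurry f) (U ×ˢ Icc 0 1) := by
    have h1 : ContinuousOn (fun p : E × ℝ => (p.2 : ℂ)) (U ×ˢ Icc 0 1) := by fun_prop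
    have h2 : ContinuousOn (fun p : E × ℝ => p.1 - x₀) (U ×ˢ Icc 0 1) := by fun_prop
    exact h1.smul (hNc.clm_apply h2)
  have hfc' : ContinuousOn (Function.uncurry f') (U ×ˢ Icc 0 1) := by
    have h1 : ContinuousOn (fun p : E × ℝ => (p.2 : ℂ)) (U ×ˢ Icc 0 1) := by fun_prop
    have h2 : ContinuousOn (fun p : E × ℝ => p.1 - x₀) (U ×ˢ Icc 0 1) := by fun_prop
    have h3 := (ContinuousLinearMap.flipₗᵢ ℂ E E (E →L[ℂ] ℂ)).continuous.comp_continuousOn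
      (h1.smul hDc)
    exact h1.smul (hNc.add (h3.clm_apply h2))
  have hder : ∀ x ∈ U, ∀ t ∈ Icc (0 : ℝ) 1, HasFDerivAt (fun x => f x t) (f' x t) x := by
    intro x hx t ht
    have h1 : HasFDerivAt (fun x : E => x₀ + (t : ℂ) • (x - x₀))
        ((t : ℂ) • ContinuousLinearMap.id ℂ E) x :=
      (((hasFDerivAt_id x).sub_const x₀).const_smul (t : ℂ)).const_add x₀
    have h2 := (hd.differentiableAt (hUo.mem_nhds (hseg x hx t ht))).hasFDerivAt.comp x h1
    have h3 := (h2.clm_apply ((hasFDerivAt_id x).sub_const x₀)).const_smul (t : ℂ)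
    refine h3.congr_fderiv ?_
    ext v w
    simp [hf', -map_sub, -Complex.coe_smul]
  refine ⟨fun x => ∫ t in (0 : ℝ)..1, f x t, fun x hx => ?_⟩
  have hmain := hasFDerivAt_intervalIntegral_of_continuousOn hUo hfc hfc' hder hx
  refine ⟨hmain.differentiableAt, fun v w => ?_⟩
  rw [hmain.fderiv]
  have hint : IntervalIntegrable (f' x) MeasureTheory.volume 0 1 := by
    refine ContinuousOn.intervalIntegrable ?_
    rw [uIcc_of_le zero_le_one]
    exact hfc'.comp (f := fun t => (x, t)) (by fun_prop) fun t ht => ⟨hx, ht⟩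
  let ev : E → E → (E →L[ℂ] E →L[ℂ] ℂ) →L[ℂ] ℂ := fun v w =>
    (ContinuousLinearMap.apply ℂ ℂ w).comp (ContinuousLinearMap.apply ℂ (E →L[ℂ] ℂ) v)
  have hev : ∀ v w, (∫ t in (0 : ℝ)..1, f' x t) v w = ∫ t in (0 : ℝ)..1, f' x t v w := fun v w =>
    ((ev v w).intervalIntegral_comp_comm hint).symm
  have hevi : ∀ v w, IntervalIntegrable (fun t => f' x t v w) MeasureTheory.volume 0 1 :=
    fun v w => ⟨(ev v w).integrable_comp hint.1, (ev v w).integrable_comp hint.2⟩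
  rw [hev, hev, ← intervalIntegral.integral_sub (hevi v w) (hevi w v)]
  -- By closedness and antisymmetry the integrand of `db(v, w)` is the exact derivative of `t² N(v,
  -- w)` along the segment; the boundary values give `N x v w`.
  have hg : ∀ t ∈ uIcc (0 : ℝ) 1, HasDerivAt
      (fun t : ℝ => (t : ℂ) ^ 2 * N (x₀ + (t : ℂ) • (x - x₀)) v w) (f' x t v w - f' x t w v) t := by
    intro t ht
    rw [uIcc_of_le zero_le_one] at ht
    have h1 : HasDerivAt (fun s : ℂ => x₀ + s • (x - x₀)) (x - x₀) (t : ℂ) := by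
      simpa using ((hasDerivAt_id (t : ℂ)).smul_const (x - x₀)).const_add x₀
    have h2 := (hd.differentiableAt (hUo.mem_nhds (hseg x hx t ht))).hasFDerivAt.comp_hasDerivAt
      (t : ℂ) h1
    have h3 := (ev v w).hasFDerivAt.comp_hasDerivAt (t : ℂ) h2
    have h4 := (((hasDerivAt_id (t : ℂ)).pow 2).mul h3).comp_ofReal
    refine h4.congr_deriv ?_
    have e1 := hcl _ (hseg x hx t ht) (x - x₀) v w
    have e2 := halt _ (hseg x hx t ht) w v
    have e3 : fderiv ℂ N (x₀ + (t : ℂ) • (x - x₀)) v (x - x₀) w =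
        - fderiv ℂ N (x₀ + (t : ℂ) • (x - x₀)) v w (x - x₀) := by
      have hdA := (hd.differentiableAt (hUo.mem_nhds (hseg x hx t ht))).hasFDerivAt
      have k1 := (ev (x - x₀) w).hasFDerivAt.comp _ hdA
      have k2 := ((ev w (x - x₀)).hasFDerivAt.comp _ hdA).neg
      have k3 := k1.congr_of_eventuallyEq (f₁ := fun y => -(ev w (x - x₀)) (N y)) (by
        filter_upwards [hUo.mem_nhds (hseg x hx t ht)] with y hy
        simp [ev, halt y hy w (x - x₀), -map_sub])
      simpa [ev, -map_sub] using congrArg (fun A => A v) (k3.unique k2)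
    simp [hf', ev, -map_sub, -Complex.coe_smul]
    linear_combination (t : ℂ) ^ 2 * e1 + (t : ℂ) * e2 - (t : ℂ) ^ 2 * e3
  rw [intervalIntegral.integral_eq_sub_of_hasDerivAt hg ((hevi v w).sub (hevi w v))]
  simp

end ClosedForms

/-! ### Global primitives on contractible sets -/

section Primitives

set_option maxSynthPendingDepth 3

/-- The complex numbers with the discrete topology. -/
def DiscreteComplex : Type := ℂ

instance : TopologicalSpace DiscreteComplex := ⊥

instance : DiscreteTopology DiscreteComplex := ⟨rfl⟩

/-- The local primitives of a locally exact one-form, as a fibre bundle with discrete fibre: the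
transition functions are the (locally constant) differences of local primitives. -/
def primitiveBundle {X : Type*} [TopologicalSpace X] (B : X → Set X) (hB : ∀ x, IsOpen (B x))
    (hm : ∀ x, x ∈ B x) (f : X → X → ℂ)
    (hf : ∀ i j, ∀ x ∈ B i ∩ B j, ∀ᶠ y in 𝓝 x, f j y - f i y = f j x - f i x) :
    FiberBundleCore X X DiscreteComplex where
  baseSet := B
  isOpen_baseSet := hB
  indexAt := id
  mem_baseSet_at := hm
  coordChange i j x v := (show ℂ from v) + (f j x - f i x)
  coordChange_self i x _ v := by rw [sub_self]; exact add_zero (show ℂ from v)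
  continuousOn_coordChange i j := by
    rintro ⟨x, v⟩ ⟨hx, -⟩
    refine ContinuousAt.continuousWithinAt ?_
    have h1 : ∀ᶠ p : X × DiscreteComplex in 𝓝 (x, v), f j p.1 - f i p.1 = f j x - f i x :=
      (continuous_fst.tendsto (x, v)).eventually (hf i j x hx)
    have h2 : ∀ᶠ p : X × DiscreteComplex in 𝓝 (x, v), p.2 = v :=
      (continuous_snd.tendsto (x, v)).eventually (p := fun w => w = v) (by simp [nhds_discrete])
    refine (continuousAt_const
      (y := (show DiscreteComplex from (show ℂ from v) + (f j x - f i x)))).congr ?_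
    filter_upwards [h1, h2] with p hp1 hp2
    rw [hp1, hp2]
  coordChange_comp i j k x _ v := by
    show (show ℂ from v) + _ + _ = (show ℂ from v) + _
    ring

/-- A closed holomorphic one-form on a contractible open set has a primitive. -/
theorem exists_primitive_of_closed_of_contractible {E : Type*} [NormedAddCommGroup E]
    [NormedSpace ℂ E] {U : Set E} (hU : IsOpen U) (hUc : ContractibleSpace U)
    {θ : E → E →L[ℂ] ℂ} (hθ : DifferentiableOn ℂ θ U)
    (hcl : ∀ x ∈ U, ∀ v w, fderiv ℂ θ x v w = fderiv ℂ θ x w v) :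
    ∃ a : E → ℂ, ∀ x ∈ U, HasFDerivAt a (θ x) x := by
  classical
  let _ : NormedSpace ℝ E := NormedSpace.restrictScalars ℝ ℂ E
  have hloc : ∀ x : U, ∃ (B : Set E) (f : E → ℂ), IsOpen B ∧ x.1 ∈ B ∧ B ⊆ U ∧
      ∀ y ∈ B, HasFDerivAt f (θ y) y := by
    intro x
    obtain ⟨ε, hε, hb⟩ := Metric.isOpen_iff.1 hU x.1 x.2
    obtain ⟨f, hf⟩ := (convex_ball x.1 ε).exists_forall_hasFDerivAt_of_fderiv_symmetric
      Metric.isOpen_ball (ω := θ) (𝕜 := ℂ)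
      (fun y hy => ((hθ.differentiableAt
        (hU.mem_nhds (hb hy))).restrictScalars ℝ).differentiableWithinAt)
      (fun y hy v w => by
        have h := (hθ.differentiableAt (hU.mem_nhds (hb hy)))
        rw [h.fderiv_restrictScalars ℝ]
        exact hcl y (hb hy) v w)
    exact ⟨_, f, Metric.isOpen_ball, Metric.mem_ball_self hε, hb, hf⟩
  choose B f hBo hmB hBU hf using hloc
  have hconst : ∀ i j : U, ∀ x : U, x ∈ (Subtype.val ⁻¹' B i ∩ Subtype.val ⁻¹' B j : Set U) →
      ∀ᶠ y : U in 𝓝 x, f j y - f i y = f j x - f i x := by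
    intro i j x hx
    obtain ⟨ε, hε, hb⟩ := Metric.isOpen_iff.1 ((hBo i).inter (hBo j)) x.1 hx
    have hcst : ∀ y ∈ Metric.ball x.1 ε, f j y - f i y = f j x - f i x := by
      intro y hy
      refine (convex_ball x.1 ε).is_const_of_fderivWithin_eq_zero (𝕜 := ℂ)
        (f := fun y => f j y - f i y) (fun z hz => ?_) (fun z hz => ?_) hy
        (Metric.mem_ball_self hε)
      · exact ((hf j z (hb hz).2).sub (hf i z (hb hz).1)).differentiableAt.differentiableWithinAt
      · have h := (hf j z (hb hz).2).sub (hf i z (hb hz).1)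
        rw [sub_self] at h
        exact (h.hasFDerivWithinAt (s := Metric.ball x.1 ε)).fderivWithin
          (Metric.isOpen_ball.uniqueDiffWithinAt hz)
    exact (continuous_subtype_val.tendsto x).eventually
      (eventually_of_mem (Metric.ball_mem_nhds x.1 hε) hcst)
  -- The fibre is discrete, so this bundle is a covering of the contractible set `U`, and the
  -- identity of `U` lifts to a global section.
  let Z := primitiveBundle (fun i : U => Subtype.val ⁻¹' B i)
    (fun i => (hBo i).preimage continuous_subtype_val) hmB (fun i y => f i y) hconst
  have hcov : IsCoveringMap Z.proj := FiberBundle.isCoveringMap (F := DiscreteComplex) (E := Z.Fiber)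
  have : LocallyPathConnectedSpace U := hU.locallyPathConnectedSpace
  obtain ⟨x₀⟩ : Nonempty U := inferInstance
  obtain ⟨s, ⟨-, hs⟩, -⟩ := hcov.existsUnique_continuousMap_lifts (ContinuousMap.id U) x₀
    (⟨x₀, (0 : ℂ)⟩ : Z.TotalSpace) rfl
  have hs1 : ∀ x, (s x).1 = x := fun x => congrFun hs x
  have key : ∀ i x : U, x.1 ∈ B i → ∀ᶠ y : U in 𝓝 x,
      ((Z.localTriv i) (s y)).2 = ((Z.localTriv i) (s x)).2 := by
    intro i x hx
    have h1 : ContinuousAt (fun y => ((Z.localTriv i) (s y)).2) x := by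
      refine continuous_snd.continuousAt.comp ?_
      refine ContinuousAt.comp ?_ s.continuous.continuousAt
      refine (Z.localTriv i).continuousAt ?_
      rw [Z.mem_localTriv_source]
      show (s x).1.1 ∈ B i
      rw [hs1]; exact hx
    have := h1.eventually (p := fun v => v = ((Z.localTriv i) (s x)).2) (by simp [nhds_discrete])
    exact this
  -- The transition functions are such that `f i` minus the `i`-th coordinate of the section is
  -- independent of the chart `i`. That coordinate is locally constant, so the difference is a
  -- global primitive.
  let a : E → ℂ := fun x => if hx : x ∈ U then
    f ⟨x, hx⟩ x - (show ℂ from (s ⟨x, hx⟩).2) else 0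
  refine ⟨a, fun x hx => ?_⟩
  have htriv : ∀ i y : U, a y = f i y - (show ℂ from ((Z.localTriv i) (s y)).2) := by
    intro i y
    have h1 : ((Z.localTriv i) (s y)).2 =
        ((show ℂ from (s y).2) + (f i (s y).1 - f (s y).1 (s y).1) : ℂ) := rfl
    rw [h1, hs1 y]
    show (if hx : y.1 ∈ U then f ⟨y, hx⟩ y - (show ℂ from (s ⟨y, hx⟩).2) else 0) = _
    rw [dif_pos y.2]
    ring
  have h2 := key ⟨x, hx⟩ ⟨x, hx⟩ (hmB ⟨x, hx⟩)
  rw [nhds_subtype_eq_comap, eventually_comap] at h2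
  refine ((hf ⟨x, hx⟩ x (hmB ⟨x, hx⟩)).sub_const
    (show ℂ from ((Z.localTriv ⟨x, hx⟩) (s ⟨x, hx⟩)).2)).congr_of_eventuallyEq ?_
  filter_upwards [h2, hU.mem_nhds hx] with y hy hyU
  rw [htriv ⟨x, hx⟩ ⟨y, hyU⟩, hy ⟨y, hyU⟩ rfl]

end Primitives

/-! ### Functional dependence -/

section FunctionalDependence

set_option maxSynthPendingDepth 3

/-- If `df ∧ dg = 0` and `dg` has no zeros, then `f` is locally a holomorphic function of `g`. -/
theorem locallyFunctionOf_of_wedge_eq_zero {r : ℕ} {C : Set (CSpace r)} (hC : IsOpen C)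
    {f g : CSpace r → ℂ} (hf : DifferentiableOn ℂ f C) (hg : DifferentiableOn ℂ g C)
    (hdg : ∀ u ∈ C, fderiv ℂ g u ≠ 0)
    (hw : ∀ u ∈ C, ∀ v w, fderiv ℂ f u v * fderiv ℂ g u w = fderiv ℂ f u w * fderiv ℂ g u v) :
    LocallyFunctionOf C f g := by
  intro u₀ hu₀
  set ℓ := fderiv ℂ g u₀ with hℓ
  obtain ⟨e, he⟩ : ∃ e, ℓ e = 1 := by
    obtain ⟨v, hv⟩ : ∃ v, ℓ v ≠ 0 := by
      by_contra! h
      exact hdg u₀ hu₀ (ContinuousLinearMap.ext h)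
    exact ⟨(ℓ v)⁻¹ • v, by simp [hv]⟩
  -- A change of coordinates, tangent to the identity at `u₀`, after which `g` becomes the affine
  -- function `g u₀ + ℓ (· - u₀)`.
  set Φ : CSpace r → CSpace r := fun u => u + (g u - g u₀ - ℓ (u - u₀)) • e with hΦ
  have hΦ₀ : Φ u₀ = u₀ := by simp [hΦ]
  have hΦℓ : ∀ u, ℓ (Φ u - u₀) = g u - g u₀ := by
    intro u
    have : Φ u - u₀ = (u - u₀) + (g u - g u₀ - ℓ (u - u₀)) • e := by simp only [hΦ]; abel
    rw [this, map_add, map_smul, he, smul_eq_mul]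
    ring
  have hgd : ∀ u ∈ C, HasFDerivAt g (fderiv ℂ g u) u := fun u hu =>
    (hg.differentiableAt (hC.mem_nhds hu)).hasFDerivAt
  have hΦd : ∀ u ∈ C, HasFDerivAt Φ
      (ContinuousLinearMap.id ℂ _ + (fderiv ℂ g u - ℓ).smulRight e) u := by
    intro u hu
    exact (hasFDerivAt_id u).add ((((hgd u hu).sub_const _).sub
      (ℓ.hasFDerivAt.comp u ((hasFDerivAt_id u).sub_const u₀))).smul_const e)
  have hΦ1 : ContDiffAt ℂ 1 Φ u₀ := by
    rw [contDiffAt_one_iff]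
    refine ⟨_, C, hC.mem_nhds hu₀, ?_, hΦd⟩
    have h1 := hg.continuousOn_fderiv_complex hC
    exact continuousOn_const.add
      ((ContinuousLinearMap.smulRightL ℂ (CSpace r) (CSpace r)).flip e |>.continuous.comp_continuousOn
        (h1.sub continuousOn_const))
  have hΦ' : HasFDerivAt Φ ((ContinuousLinearEquiv.refl ℂ (CSpace r) : _ ≃L[ℂ] _) : _ →L[ℂ] _)
      u₀ := by
    refine (hΦd u₀ hu₀).congr_fderiv ?_
    rw [← hℓ, sub_self]
    ext v
    simp
  set Ψ := hΦ1.localInverse hΦ' one_ne_zero with hΨ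
  have hΨ1 : ContDiffAt ℂ 1 Ψ u₀ := by
    have := hΦ1.to_localInverse hΦ' one_ne_zero
    rwa [hΦ₀] at this
  have hst : HasStrictFDerivAt Φ ((ContinuousLinearEquiv.refl ℂ (CSpace r) : _ ≃L[ℂ] _) : _ →L[ℂ] _)
      u₀ := hΦ1.hasStrictFDerivAt' hΦ' one_ne_zero
  have hright : ∀ᶠ p in 𝓝 u₀, Φ (Ψ p) = p := by
    have := hst.eventually_right_inverse
    rwa [hΦ₀] at this
  have hleft : ∀ᶠ u in 𝓝 u₀, Ψ (Φ u) = u := hst.eventually_left_inverse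
  have hΨ₀ : Ψ u₀ = u₀ := by
    have := hleft.self_of_nhds
    rwa [hΦ₀] at this
  have hΨC : ∀ᶠ p in 𝓝 u₀, Ψ p ∈ C := by
    refine hΨ1.continuousAt.eventually_mem ?_
    rw [hΨ₀]
    exact hC.mem_nhds hu₀
  have hΨd : ∀ᶠ p in 𝓝 u₀, DifferentiableAt ℂ Ψ p :=
    (hΨ1.eventually (by simp)).mono fun p hp => hp.differentiableAt one_ne_zero
  obtain ⟨ρ, hρ, hball⟩ := Metric.eventually_nhds_iff_ball.1 (hright.and (hΨC.and hΨd))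
  -- In the straightened coordinates `df ∧ dg = 0` says that `f` does not vary in the directions of
  -- `ker ℓ`.
  have hker : ∀ p ∈ Metric.ball u₀ ρ, ∀ v, ℓ v = 0 → fderiv ℂ (fun p => f (Ψ p)) p v = 0 := by
    intro p hp v hv
    obtain ⟨-, hpC, hpd⟩ := hball p hp
    have hfp := (hf.differentiableAt (hC.mem_nhds hpC)).hasFDerivAt.comp p hpd.hasFDerivAt
    have hgp := (hgd _ hpC).comp p hpd.hasFDerivAt
    have hgp' : HasFDerivAt (g ∘ Ψ) ℓ p := by
      have h1 : HasFDerivAt (fun p => g u₀ + ℓ (p - u₀)) ℓ p :=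
        (ℓ.hasFDerivAt.comp p ((hasFDerivAt_id p).sub_const u₀)).const_add (g u₀)
      refine h1.congr_of_eventuallyEq ?_
      filter_upwards [Metric.isOpen_ball.mem_nhds hp] with q hq
      have := hΦℓ (Ψ q)
      rw [(hball q hq).1] at this
      simp [this]
    have e1 : fderiv ℂ g (Ψ p) (fderiv ℂ Ψ p v) = 0 := by
      rw [← hv]
      exact congrArg (fun A => A v) (hgp.unique hgp')
    have e2 : fderiv ℂ (fun p => f (Ψ p)) p v = fderiv ℂ f (Ψ p) (fderiv ℂ Ψ p v) :=
      congrArg (fun A => A v) hfp.fderiv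
    rw [e2]
    obtain ⟨y, hy⟩ : ∃ y, fderiv ℂ g (Ψ p) y ≠ 0 := by
      by_contra! h
      exact hdg _ hpC (ContinuousLinearMap.ext h)
    have := hw _ hpC (fderiv ℂ Ψ p v) y
    rw [e1, mul_zero] at this
    exact (mul_eq_zero.1 this).resolve_right hy
  have hcst : ∀ p ∈ Metric.ball u₀ ρ, ∀ q ∈ Metric.ball u₀ ρ, ℓ (p - q) = 0 →
      f (Ψ p) = f (Ψ q) := by
    intro p hp q hq hpq
    have hd : ∀ t ∈ Icc (0 : ℝ) 1, HasDerivAt (fun t : ℝ => f (Ψ (q + (t : ℂ) • (p - q)))) 0 t := by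
      intro t ht
      have hm : q + (t : ℂ) • (p - q) ∈ Metric.ball u₀ ρ := by
        have := (convex_ball u₀ ρ).add_smul_sub_mem hq hp ht
        simpa using this
      have h1 : HasDerivAt (fun s : ℂ => q + s • (p - q)) (p - q) (t : ℂ) := by
        simpa using ((hasDerivAt_id (t : ℂ)).smul_const (p - q)).const_add q
      have h2 : DifferentiableAt ℂ (fun p => f (Ψ p)) (q + (t : ℂ) • (p - q)) :=
        (hf.differentiableAt (hC.mem_nhds (hball _ hm).2.1)).comp _ (hball _ hm).2.2
      have h3 := (h2.hasFDerivAt.comp_hasDerivAt (t : ℂ) h1).comp_ofReal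
      rwa [hker _ hm _ hpq] at h3
    have := constant_of_has_deriv_right_zero
      (fun t ht => (hd t ht).continuousAt.continuousWithinAt)
      (fun t ht => (hd t (Ico_subset_Icc_self ht)).hasDerivWithinAt) 1 (by simp)
    simpa using this
  -- A transversal to the level sets of `ℓ`; restricting `f ∘ Ψ` to it gives the function of one
  -- variable.
  set κ : ℂ → CSpace r := fun s => u₀ + (s - g u₀) • e with hκ
  have hκc : Continuous κ := by fun_prop
  have hκg : Tendsto (fun u => κ (g u)) (𝓝 u₀) (𝓝 u₀) := by
    have : ContinuousAt (fun u => κ (g u)) u₀ :=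
      hκc.continuousAt.comp (hgd u₀ hu₀).continuousAt
    simpa [ContinuousAt, hκ] using this
  have hΦt : Tendsto Φ (𝓝 u₀) (𝓝 u₀) := by
    have := hΦ1.continuousAt
    rwa [ContinuousAt, hΦ₀] at this
  have hb := Metric.ball_mem_nhds u₀ hρ
  obtain ⟨U, hU, hUo, hu₀U⟩ := eventually_nhds_iff.1 (hleft.and ((hC.eventually_mem hu₀).and
    ((hκg.eventually_mem hb).and (hΦt.eventually_mem hb))))
  refine ⟨U, hUo, hu₀U, fun u hu => (hU u hu).2.1, κ ⁻¹' Metric.ball u₀ ρ,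
    fun s => f (Ψ (κ s)), Metric.isOpen_ball.preimage hκc, fun u hu => (hU u hu).2.2.1, ?_, ?_⟩
  · intro s hs
    refine DifferentiableAt.differentiableWithinAt ?_
    have h2 : DifferentiableAt ℂ (fun p => f (Ψ p)) (κ s) :=
      (hf.differentiableAt (hC.mem_nhds (hball _ hs).2.1)).comp _ (hball _ hs).2.2
    exact h2.comp s (by fun_prop)
  · intro u hu
    obtain ⟨h1, -, h3, h4⟩ := hU u hu
    have := hcst _ h4 _ h3 (by
      have : Φ u - κ (g u) = (Φ u - u₀) - (g u - g u₀) • e := by simp only [hκ]; abel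
      rw [this, map_sub, map_smul, hΦℓ, he]
      simp)
    rwa [h1] at this

/-- Composition with a holomorphic function preserves local functional dependence. -/
theorem LocallyFunctionOf.comp_left {r : ℕ} {C : Set (CSpace r)} {f g : CSpace r → ℂ}
    (h : LocallyFunctionOf C f g) {D : Set ℂ} (hD : IsOpen D) {k : ℂ → ℂ}
    (hk : DifferentiableOn ℂ k D) (hfD : MapsTo f C D) :
    LocallyFunctionOf C (fun u => k (f u)) g := by
  intro u₀ hu₀
  obtain ⟨U, hUo, hu₀U, hUC, V, φ, hVo, hgV, hφ, hfg⟩ := h u₀ hu₀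
  refine ⟨U, hUo, hu₀U, hUC, V ∩ φ ⁻¹' D, fun s => k (φ s),
    hφ.continuousOn.isOpen_inter_preimage hVo hD, fun u hu => ⟨hgV hu, ?_⟩, ?_, fun u hu => ?_⟩
  · rw [mem_preimage, ← hfg u hu]
    exact hfD (hUC hu)
  · exact hk.comp (hφ.mono inter_subset_left) fun s hs => hs.2
  · show k (f u) = k (φ (g u))
    rw [hfg u hu]

end FunctionalDependence

/-! ### Uniformization by the Weierstrass function -/

section WeierstrassUniformization

/-- Two holomorphic solutions of `f'' = (3 f² + c) / 2` with the same initial values agree. -/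
theorem eventuallyEq_of_deriv_deriv_eq {c z₀ : ℂ} {f g : ℂ → ℂ} (hf : AnalyticAt ℂ f z₀)
    (hg : AnalyticAt ℂ g z₀) (hf2 : ∀ᶠ z in 𝓝 z₀, deriv (deriv f) z = (3 * f z ^ 2 + c) / 2)
    (hg2 : ∀ᶠ z in 𝓝 z₀, deriv (deriv g) z = (3 * g z ^ 2 + c) / 2)
    (h0 : f z₀ = g z₀) (h1 : deriv f z₀ = deriv g z₀) : f =ᶠ[𝓝 z₀] g := by
  have hd : AnalyticAt ℂ (f - g) z₀ := hf.sub hg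
  have e1 : deriv (f - g) =ᶠ[𝓝 z₀] deriv f - deriv g := by
    filter_upwards [hf.eventually_analyticAt, hg.eventually_analyticAt] with z hz hz'
    exact deriv_sub hz.differentiableAt hz'.differentiableAt
  -- `f - g` vanishes together with its derivative at `z₀`. Differentiating twice lowers a finite
  -- order of vanishing by two, yet the second derivative is a multiple of `f - g`; so the order is
  -- infinite.
  have e2 : deriv (deriv (f - g)) =ᶠ[𝓝 z₀] (fun z => 3 / 2 * (f z + g z)) * (f - g) := by
    filter_upwards [e1.deriv, hf2, hg2, hf.deriv.eventually_analyticAt,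
      hg.deriv.eventually_analyticAt] with z hz h2 h3 h4 h5
    rw [hz, deriv_sub h4.differentiableAt h5.differentiableAt, h2, h3]
    simp only [Pi.mul_apply, Pi.sub_apply]
    ring
  have o1 := hd.analyticOrderAt_deriv_add_one
  have o2 := hd.deriv.analyticOrderAt_deriv_add_one
  have z1 : (f - g) z₀ = 0 := by simp [h0]
  have z2 : deriv (f - g) z₀ = 0 := by rw [e1.self_of_nhds]; simp [h1]
  simp only [z1, z2, sub_zero] at o1 o2
  rw [analyticOrderAt_congr e2, analyticOrderAt_mul (by fun_prop) hd] at o2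
  have htop : analyticOrderAt (f - g) z₀ = ⊤ := by
    by_contra hne
    obtain ⟨n, hn⟩ := ENat.ne_top_iff_exists.1 hne
    have h3 : analyticOrderAt (f - g) z₀ + 1 + 1 ≤ analyticOrderAt (f - g) z₀ := by
      conv_rhs => rw [← o1, ← o2]
      gcongr
      exact le_add_self
    rw [← hn] at h3
    have : n + 1 + 1 ≤ n := by exact_mod_cast h3
    omega
  filter_upwards [analyticOrderAt_eq_top.1 htop] with z hz
  exact sub_eq_zero.1 hz

namespace PeriodPair

variable (L : PeriodPair)

theorem hasDerivAt_weierstrassP {w : ℂ} (hw : w ∉ L.lattice) :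
    HasDerivAt L.weierstrassP (L.derivWeierstrassP w) w := by
  rw [← L.deriv_weierstrassP]
  exact (L.differentiableOn_weierstrassP.differentiableAt
    (L.isClosed_lattice.isOpen_compl.mem_nhds hw)).hasDerivAt

theorem tendsto_weierstrassP_cobounded {l : ℂ} (hl : l ∈ L.lattice) :
    Tendsto L.weierstrassP (𝓝[≠] l) (Bornology.cobounded ℂ) := by
  refine tendsto_cobounded_of_meromorphicOrderAt_neg ?_
  rw [L.order_weierstrassP l hl]
  decide

theorem eventually_notMem_lattice (w : ℂ) : ∀ᶠ z in 𝓝[≠] w, z ∉ L.lattice := by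
  filter_upwards [self_mem_nhdsWithin, mem_nhdsWithin_of_mem_nhds
    (L.compl_lattice_sdiff_singleton_mem_nhds w)] with z hz hz' h
  exact hz' ⟨h, hz⟩

theorem countable_lattice : (L.lattice : Set ℂ).Countable := by
  have : Countable L.lattice := L.latticeEquivProd.toEquiv.injective.countable
  exact this.to_set

theorem isPreconnected_compl_lattice : IsPreconnected (L.lattice : Set ℂ)ᶜ :=
  (L.countable_lattice.isPathConnected_compl_of_one_lt_rank
    (by rw [Complex.rank_real_complex]; exact Cardinal.one_lt_two)).isConnected.isPreconnected

theorem not_eqOn_weierstrassP_const (c : ℂ) :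
    ¬ EqOn L.weierstrassP (fun _ => c) (L.lattice : Set ℂ)ᶜ := by
  intro h
  have h0 := L.tendsto_weierstrassP_cobounded (zero_mem L.lattice)
  have h1 : Tendsto (fun _ : ℂ => c) (𝓝[≠] (0 : ℂ)) (Bornology.cobounded ℂ) :=
    h0.congr' ((L.eventually_notMem_lattice 0).mono fun z hz => h hz)
  exact not_tendsto_const_atTop _ _ (tendsto_norm_cobounded_atTop.comp h1)

/-- The second order differential equation of `4℘`. -/
theorem deriv_derivWeierstrassP {w : ℂ} (hw : w ∉ L.lattice) :
    4 * deriv L.derivWeierstrassP w = (3 * (4 * L.weierstrassP w) ^ 2 + -4 * L.g₂) / 2 := by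
  have hopen := L.isClosed_lattice.isOpen_compl
  set k : ℂ → ℂ := fun w => 4 * deriv L.derivWeierstrassP w -
    (3 * (4 * L.weierstrassP w) ^ 2 + -4 * L.g₂) / 2 with hk
  have hA : AnalyticOnNhd ℂ k (L.lattice : Set ℂ)ᶜ := by
    intro z hz
    have h1 := L.analyticOnNhd_weierstrassP z hz
    have h2 := (L.analyticOnNhd_derivWeierstrassP z hz).deriv
    fun_prop
  have hB : AnalyticOnNhd ℂ L.derivWeierstrassP (L.lattice : Set ℂ)ᶜ :=
    L.analyticOnNhd_derivWeierstrassP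
  have hmul : ∀ z ∈ (L.lattice : Set ℂ)ᶜ, (k * L.derivWeierstrassP) z = 0 := by
    intro z hz
    have h1 : HasDerivAt L.weierstrassP (L.derivWeierstrassP z) z := L.hasDerivAt_weierstrassP hz
    have h2 := (hB z hz).differentiableAt.hasDerivAt
    have h3 := h2.pow 2
    have h4 := (((h1.pow 3).const_mul 4).sub (h1.const_mul L.g₂)).sub_const L.g₃
    have h5 := h3.unique (h4.congr_of_eventuallyEq
      (eventually_of_mem (hopen.mem_nhds hz) fun y hy => L.derivWeierstrassP_sq y hy))
    simp only [Pi.mul_apply, hk]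
    norm_num at h5
    linear_combination 2 * h5
  rcases hA.eq_zero_or_eq_zero_of_mul_eq_zero hB hmul L.isPreconnected_compl_lattice with h | h
  · exact sub_eq_zero.1 (h w hw)
  · exfalso
    refine L.not_eqOn_weierstrassP_const (L.weierstrassP w) fun z hz => ?_
    refine hopen.is_const_of_deriv_eq_zero L.isPreconnected_compl_lattice
      L.differentiableOn_weierstrassP (fun y hy => ?_) hz hw
    rw [L.deriv_weierstrassP]
    exact h y hy

theorem deriv_deriv_weierstrassP_comp {w : ℂ} (hw : w ∉ L.lattice) :
    ∀ᶠ t in 𝓝 (0 : ℂ), deriv (deriv fun t => 4 * L.weierstrassP (t + w)) t =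
      (3 * (4 * L.weierstrassP (t + w)) ^ 2 + -4 * L.g₂) / 2 := by
  have h1 : deriv (fun t => 4 * L.weierstrassP (t + w)) =
      fun t => 4 * L.derivWeierstrassP (t + w) := by
    ext t
    rw [deriv_const_mul_field, deriv_comp_add_const, L.deriv_weierstrassP]
  rw [h1]
  have h2 : ∀ᶠ t in 𝓝 (0 : ℂ), t + w ∉ L.lattice := by
    have : Tendsto (fun t : ℂ => t + w) (𝓝 0) (𝓝 w) := by
      have : ContinuousAt (fun t : ℂ => t + w) 0 := by fun_prop
      simpa [ContinuousAt] using this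
    exact this.eventually (L.isClosed_lattice.isOpen_compl.mem_nhds hw)
  filter_upwards [h2] with t ht
  rw [deriv_const_mul_field, deriv_comp_add_const]
  exact L.deriv_derivWeierstrassP ht

theorem analyticAt_weierstrassP_comp {w : ℂ} (hw : w ∉ L.lattice) :
    AnalyticAt ℂ (fun t => 4 * L.weierstrassP (t + w)) 0 := by
  have h1 : AnalyticAt ℂ L.weierstrassP (0 + w) := by
    rw [zero_add]; exact L.analyticOnNhd_weierstrassP w hw
  exact analyticAt_const.mul (h1.comp_of_eq (by fun_prop) rfl)

theorem deriv_weierstrassP_comp (w : ℂ) :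
    deriv (fun t => 4 * L.weierstrassP (t + w)) 0 = 4 * L.derivWeierstrassP w := by
  rw [deriv_const_mul_field, deriv_comp_add_const, L.deriv_weierstrassP, zero_add]

/-- `℘` takes every value. -/
theorem exists_weierstrassP_eq (c : ℂ) : ∃ w, w ∉ L.lattice ∧ L.weierstrassP w = c := by
  classical
  by_contra! hne
  -- If `℘` omitted `c`, then `1 / (℘ - c)`, set to zero at the poles, would be entire and periodic,
  -- hence constant by Liouville; its value at a lattice point is zero, at a half period it is not.
  set g : ℂ → ℂ := fun w => if w ∈ L.lattice then 0 else (L.weierstrassP w - c)⁻¹ with hg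
  have hoff : ∀ w, w ∉ L.lattice → DifferentiableAt ℂ g w := by
    intro w hw
    have h1 : DifferentiableAt ℂ (fun w => (L.weierstrassP w - c)⁻¹) w :=
      ((L.hasDerivAt_weierstrassP hw).differentiableAt.sub_const c).inv
        (sub_ne_zero.2 (hne w hw))
    refine h1.congr_of_eventuallyEq ?_
    filter_upwards [L.isClosed_lattice.isOpen_compl.mem_nhds hw] with z hz
    exact if_neg hz
  have hdiff : Differentiable ℂ g := by
    intro w
    by_cases hw : w ∈ L.lattice
    · refine (Complex.analyticAt_of_differentiable_on_punctured_nhds_of_continuousAt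
        ((L.eventually_notMem_lattice w).mono hoff) ?_).differentiableAt
      rw [continuousAt_iff_punctured_nhds]
      have hgw : g w = 0 := if_pos hw
      rw [hgw]
      have h1 : Tendsto (fun w => (L.weierstrassP w - c)⁻¹) (𝓝[≠] w) (𝓝 0) := by
        refine tendsto_inv₀_cobounded.comp ?_
        rw [← tendsto_norm_atTop_iff_cobounded]
        refine tendsto_atTop_mono (fun z => norm_sub_norm_le _ _) ?_
        exact tendsto_atTop_add_const_right _ (-‖c‖)
          (tendsto_norm_cobounded_atTop.comp (L.tendsto_weierstrassP_cobounded hw))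
      refine h1.congr' ((L.eventually_notMem_lattice w).mono fun z hz => ?_)
      exact (if_neg hz).symm
    · exact hoff w hw
  have hper : ∀ z, ∀ l ∈ L.lattice, g (z + l) = g z := by
    intro z l hl
    have h1 : z + l ∈ L.lattice ↔ z ∈ L.lattice := L.lattice.add_mem_iff_left hl
    simp only [hg, h1, L.weierstrassP_add_coe z ⟨l, hl⟩]
  have hbdd := (IsZLattice.isCompact_range_of_periodic L.lattice g hdiff.continuous
    hper).isBounded
  have h0 := hdiff.apply_eq_apply_of_bounded hbdd (L.ω₁ / 2) 0
  have h1 : g 0 = 0 := if_pos (zero_mem _)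
  have h2 : g (L.ω₁ / 2) = (L.weierstrassP (L.ω₁ / 2) - c)⁻¹ :=
    if_neg L.ω₁_div_two_notMem_lattice
  rw [h1, h2, inv_eq_zero] at h0
  exact hne _ L.ω₁_div_two_notMem_lattice (sub_eq_zero.1 h0)

/-- The translates of `4℘` by `w` and by `w'` solve the same second order equation with the same
data at `0`, so they agree near `0`, and by continuation off their poles. The first has a pole at
`-w`; hence so must the second. -/
theorem sub_mem_lattice_of_weierstrassP_eq {w w' : ℂ} (hw : w ∉ L.lattice) (hw' : w' ∉ L.lattice)
    (h0 : L.weierstrassP w = L.weierstrassP w')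
    (h1 : L.derivWeierstrassP w = L.derivWeierstrassP w') : w - w' ∈ L.lattice := by
  by_contra hne
  have hloc := eventuallyEq_of_deriv_deriv_eq (L.analyticAt_weierstrassP_comp hw)
    (L.analyticAt_weierstrassP_comp hw') (L.deriv_deriv_weierstrassP_comp hw)
    (L.deriv_deriv_weierstrassP_comp hw') (by simp [h0])
    (by rw [L.deriv_weierstrassP_comp, L.deriv_weierstrassP_comp, h1])
  -- The excluded set is countable, so its complement is connected.
  set S : Set ℂ := (fun t => t + w) ⁻¹' L.lattice ∪ (fun t => t + w') ⁻¹' L.lattice with hS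
  have hScount : S.Countable :=
    (L.countable_lattice.preimage (add_left_injective w)).union
      (L.countable_lattice.preimage (add_left_injective w'))
  have hSconn : IsPreconnected Sᶜ :=
    (hScount.isPathConnected_compl_of_one_lt_rank
      (by rw [Complex.rank_real_complex]; exact Cardinal.one_lt_two)).isConnected.isPreconnected
  have hA : ∀ v, (fun t => t + v) ⁻¹' L.lattice ⊆ S →
      AnalyticOnNhd ℂ (fun t => 4 * L.weierstrassP (t + v)) Sᶜ := by
    intro v hv t ht
    have h2 : t + v ∉ L.lattice := fun h => ht (hv h)
    exact analyticAt_const.mul ((L.analyticOnNhd_weierstrassP _ h2).comp_of_eq (by fun_prop) rfl)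
  have heq := (hA w subset_union_left).eqOn_of_preconnected_of_eventuallyEq
    (hA w' subset_union_right) hSconn (z₀ := 0) (by simp [hS, hw, hw']) hloc
  have hm : -w + w' ∉ L.lattice := fun h => hne (by simpa [add_comm, sub_eq_add_neg] using neg_mem h)
  have hpole : Tendsto (fun t => L.weierstrassP (t + w)) (𝓝[≠] (-w)) (Bornology.cobounded ℂ) := by
    refine (L.tendsto_weierstrassP_cobounded (zero_mem _)).comp ?_
    refine tendsto_nhdsWithin_iff.2 ⟨?_, ?_⟩
    · have : ContinuousAt (fun t : ℂ => t + w) (-w) := by fun_prop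
      have := this.tendsto
      rw [neg_add_cancel] at this
      exact this.mono_left nhdsWithin_le_nhds
    · filter_upwards [self_mem_nhdsWithin] with t ht h
      exact ht (eq_neg_of_add_eq_zero_left h)
  have hfin : Tendsto (fun t => L.weierstrassP (t + w')) (𝓝[≠] (-w))
      (𝓝 (L.weierstrassP (-w + w'))) := by
    have h2 : ContinuousAt L.weierstrassP (-w + w') := (L.hasDerivAt_weierstrassP hm).continuousAt
    have h3 : ContinuousAt (fun t => L.weierstrassP (t + w')) (-w) :=
      ContinuousAt.comp (f := fun t => t + w') h2 (by fun_prop)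
    exact h3.tendsto.mono_left nhdsWithin_le_nhds
  have hev : ∀ᶠ t in 𝓝[≠] (-w), L.weierstrassP (t + w) = L.weierstrassP (t + w') := by
    have h2 : ∀ᶠ t in 𝓝[≠] (-w), t + w ∉ L.lattice := by
      have : Tendsto (fun t => t + w) (𝓝[≠] (-w)) (𝓝[≠] 0) := by
        refine tendsto_nhdsWithin_iff.2 ⟨?_, ?_⟩
        · have : ContinuousAt (fun t : ℂ => t + w) (-w) := by fun_prop
          have := this.tendsto
          rw [neg_add_cancel] at this
          exact this.mono_left nhdsWithin_le_nhds
        · filter_upwards [self_mem_nhdsWithin] with t ht h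
          exact ht (eq_neg_of_add_eq_zero_left h)
      exact this.eventually (L.eventually_notMem_lattice 0)
    have h3 : ∀ᶠ t in 𝓝[≠] (-w), t + w' ∉ L.lattice := by
      have : ContinuousAt (fun t : ℂ => t + w') (-w) := by fun_prop
      exact (this.eventually (L.isClosed_lattice.isOpen_compl.mem_nhds hm)).filter_mono
        nhdsWithin_le_nhds
    filter_upwards [h2, h3] with t ht ht'
    have := heq (x := t) (by simp [hS, ht, ht'])
    simpa using this
  exact not_tendsto_nhds_of_tendsto_atTop (tendsto_norm_cobounded_atTop.comp hpole) _
    ((hfin.congr' (hev.mono fun t ht => ht.symm)).norm)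

/-- `4℘` and `4℘'` uniformize the curve `y² = x³ - 4 g₂ x - 16 g₃`. -/
theorem isWeierstrassUniformization :
    IsWeierstrassUniformization L.lattice.toAddSubgroup (-4 * L.g₂) (-16 * L.g₃)
      (fun w => 4 * L.weierstrassP w) (fun w => 4 * L.derivWeierstrassP w) := by
  have heqn : ∀ w, w ∉ L.lattice → (4 * L.derivWeierstrassP w) ^ 2 =
      (4 * L.weierstrassP w) ^ 3 + -4 * L.g₂ * (4 * L.weierstrassP w) + -16 * L.g₃ := by
    intro w hw
    linear_combination 16 * L.derivWeierstrassP_sq w hw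
  have hsurj : ∀ X Y : ℂ, Y ^ 2 = X ^ 3 + -4 * L.g₂ * X + -16 * L.g₃ →
      ∃ w, w ∉ L.lattice ∧ 4 * L.weierstrassP w = X ∧ 4 * L.derivWeierstrassP w = Y := by
    intro X Y hXY
    obtain ⟨w, hw, hwX⟩ := L.exists_weierstrassP_eq (X / 4)
    have hX : 4 * L.weierstrassP w = X := by rw [hwX]; ring
    have h1 := heqn w hw
    rw [hX, ← hXY, sq_eq_sq_iff_eq_or_eq_neg] at h1
    rcases h1 with h1 | h1
    · exact ⟨w, hw, hX, h1⟩
    · refine ⟨-w, fun h => hw (by simpa using neg_mem h), ?_, ?_⟩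
      · rw [L.weierstrassP_neg, hX]
      · rw [L.derivWeierstrassP_neg, mul_neg, h1, neg_neg]
  refine ⟨?_, fun w hw => (L.hasDerivAt_weierstrassP hw).const_mul 4, fun w hw => ?_, heqn,
    fun w hw => ?_, hsurj, fun w w' hw hw' => ⟨?_, ?_⟩⟩
  -- A singular cubic has a double root `e`. At a point where `4℘ = e` and `℘' = 0`, the constant
  -- `e` solves the same second order equation with the same data, so `℘` would be constant.
  · intro hdisc
    set c₁ := -4 * L.g₂ with hc₁
    set c₀ := -16 * L.g₃ with hc₀
    obtain ⟨e, he1, he0⟩ : ∃ e : ℂ, 3 * e ^ 2 + c₁ = 0 ∧ e ^ 3 + c₁ * e + c₀ = 0 := by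
      by_cases h : c₁ = 0
      · have : c₀ = 0 := by simpa [h] using hdisc
        exact ⟨0, by simp [h], by simp [this]⟩
      -- The double root of `x³ + c₁ x + c₀` when the discriminant vanishes and `c₁ ≠ 0`.
      · refine ⟨-(3 * c₀) / (2 * c₁), ?_, ?_⟩
        · field_simp
          linear_combination hdisc
        · field_simp
          linear_combination (-c₀) * hdisc
    obtain ⟨w, hw, hwX, hwY⟩ := hsurj e 0 (by rw [he0]; ring)
    have hloc := eventuallyEq_of_deriv_deriv_eq (g := fun _ => e) (c := c₁)
      (L.analyticAt_weierstrassP_comp hw) analyticAt_const (L.deriv_deriv_weierstrassP_comp hw)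
      (Eventually.of_forall fun z => by simp [he1]) (by simp [hwX])
      (by rw [L.deriv_weierstrassP_comp, hwY]; simp)
    have hloc' : L.weierstrassP =ᶠ[𝓝 w] fun _ => e / 4 := by
      have h1 : Tendsto (fun z : ℂ => z - w) (𝓝 w) (𝓝 0) := by
        have : ContinuousAt (fun z : ℂ => z - w) w := by fun_prop
        simpa [ContinuousAt] using this
      filter_upwards [h1.eventually hloc] with z hz
      rw [← hz]
      simp
    exact L.not_eqOn_weierstrassP_const (e / 4)
      (L.analyticOnNhd_weierstrassP.eqOn_of_preconnected_of_eventuallyEq analyticOnNhd_const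
        L.isPreconnected_compl_lattice hw hloc')
  · exact (L.analyticOnNhd_derivWeierstrassP w hw).differentiableAt.const_mul 4
  · have h1 : Tendsto (fun z : ℂ => 4 * z) (Bornology.cobounded ℂ) (Bornology.cobounded ℂ) := by
      rw [← tendsto_norm_atTop_iff_cobounded]
      simp only [norm_mul]
      exact tendsto_norm_cobounded_atTop.const_mul_atTop (by simp)
    exact h1.comp (L.tendsto_weierstrassP_cobounded hw)
  · rintro ⟨h0, h1⟩
    exact L.sub_mem_lattice_of_weierstrassP_eq hw hw' (mul_left_cancel₀ (by norm_num : (4 : ℂ) ≠ 0) h0)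
      (mul_left_cancel₀ (by norm_num : (4 : ℂ) ≠ 0) h1)
  · intro h
    have h0 := L.weierstrassP_add_coe w' ⟨w - w', h⟩
    have h1 := L.derivWeierstrassP_add_coe w' ⟨w - w', h⟩
    simp only [add_sub_cancel] at h0 h1
    exact ⟨by rw [h0], by rw [h1]⟩

end PeriodPair

end WeierstrassUniformization

/-! ### The Weierstrass functions in families -/

section WeierstrassFamily

/-- The point `m + n Z` of the lattice `ℤ + ℤ Z`. -/
def ellPoint (Z : ℂ) (p : ℤ × ℤ) : ℂ := p.1 + p.2 * Z

theorem mem_ellLattice {Z w : ℂ} : w ∈ ellLattice Z ↔ ∃ p, ellPoint Z p = w := by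
  simp [ellLattice, AddSubgroup.mem_closure_pair, ellPoint]

theorem linearIndependent_one_of_im_pos {Z : ℂ} (hZ : 0 < Z.im) :
    LinearIndependent ℝ ![(1 : ℂ), Z] := by
  rw [LinearIndependent.pair_iff]
  intro s t h
  have him := congrArg Complex.im h
  have hre := congrArg Complex.re h
  simp at him hre
  rcases him with ht | h0
  · exact ⟨by simpa [ht] using hre, ht⟩
  · exact absurd h0 hZ.ne'

/-- The pair of periods `1, Z`. -/
noncomputable def ellPair (Z : ℂ) (hZ : 0 < Z.im) : PeriodPair := ⟨1, Z, linearIndependent_one_of_im_pos hZ⟩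

theorem ellPair_lattice {Z : ℂ} (hZ : 0 < Z.im) :
    (ellPair Z hZ).lattice.toAddSubgroup = ellLattice Z := by
  rw [PeriodPair.lattice, Submodule.span_int_eq_addSubgroupClosure]
  rfl

theorem mem_ellPair_lattice {Z : ℂ} (hZ : 0 < Z.im) {w : ℂ} :
    w ∈ (ellPair Z hZ).lattice ↔ w ∈ ellLattice Z := by
  rw [← ellPair_lattice hZ]; rfl

theorem ellPair_latticeEquivProd_symm {Z : ℂ} (hZ : 0 < Z.im) (p : ℤ × ℤ) :
    (((ellPair Z hZ).latticeEquivProd.symm.toEquiv p : (ellPair Z hZ).lattice) : ℂ) =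
      ellPoint Z p := by
  refine ((ellPair Z hZ).latticeEquiv_symm_apply p).trans ?_
  simp [ellPair, ellPoint]

/-- The normalized `℘`-function `x = 4℘` of the lattice `ℤ + ℤ Z`. -/
noncomputable def weierstrassX (Z w : ℂ) : ℂ :=
  4 * ∑' p : ℤ × ℤ, (1 / (w - ellPoint Z p) ^ 2 - 1 / ellPoint Z p ^ 2)

/-- The derivative `y = 4℘'` of `x = 4℘`, for the lattice `ℤ + ℤ Z`. -/
noncomputable def weierstrassY (Z w : ℂ) : ℂ :=
  4 * -∑' p : ℤ × ℤ, 2 / (w - ellPoint Z p) ^ 3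

/-- Summing over the fixed index set `ℤ × ℤ`, instead of over a lattice that moves with `Z`, makes
the series a function of two variables whose terms can be estimated uniformly. -/
theorem weierstrassX_eq {Z : ℂ} (hZ : 0 < Z.im) (w : ℂ) :
    weierstrassX Z w = 4 * (ellPair Z hZ).weierstrassP w := by
  rw [weierstrassX, PeriodPair.weierstrassP,
    ← (ellPair Z hZ).latticeEquivProd.symm.toEquiv.tsum_eq]
  simp only [ellPair_latticeEquivProd_symm]

theorem weierstrassY_eq {Z : ℂ} (hZ : 0 < Z.im) (w : ℂ) :
    weierstrassY Z w = 4 * (ellPair Z hZ).derivWeierstrassP w := by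
  rw [weierstrassY, PeriodPair.derivWeierstrassP,
    ← (ellPair Z hZ).latticeEquivProd.symm.toEquiv.tsum_eq]
  simp only [ellPair_latticeEquivProd_symm]

theorem summable_one_add_norm_inv_pow_three :
    Summable fun p : ℤ × ℤ => ((1 + ‖p‖) ^ 3)⁻¹ := by
  have h := (EisensteinSeries.summable_one_div_norm_rpow (k := 3) (by norm_num))
  rw [← (finTwoArrowEquiv ℤ).symm.summable_iff] at h
  refine Summable.of_norm_bounded_eventually h ?_
  -- The comparison fails only at the origin, where `0 ^ (-3 : ℝ) = 0`.
  refine (Set.finite_singleton (0 : ℤ × ℤ)).subset ?_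
  intro p hp
  by_contra hne
  refine hp ?_
  have hp0 : 0 < ‖p‖ := norm_pos_iff.2 hne
  have hnorm : ‖(finTwoArrowEquiv ℤ).symm p‖ = ‖p‖ := by
    simp [finTwoArrowEquiv, Prod.norm_def, Pi.norm_def, Finset.univ_fin2] 
  show ‖((1 + ‖p‖) ^ 3)⁻¹‖ ≤ ‖(finTwoArrowEquiv ℤ).symm p‖ ^ (-3 : ℝ)
  rw [hnorm, Real.rpow_neg hp0.le, Real.norm_of_nonneg (by positivity)]
  norm_cast
  gcongr
  linarith

/-- A lower bound for `|m + n Z|`. -/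
theorem norm_le_mul_norm_ellPoint {Z : ℂ} (hZ : 0 < Z.im) :
    ∃ K > 0, ∀ p : ℤ × ℤ, ‖p‖ ≤ K * ‖ellPoint Z p‖ := by
  -- The imaginary part of `m + n Z` bounds `|n|` by `|m + n Z| / Im Z`; subtracting `n Z` then
  -- bounds `|m|`.
  refine ⟨1 + (1 + ‖Z‖) / Z.im, by positivity, fun p => ?_⟩
  have h2 : |(p.2 : ℝ)| * Z.im ≤ ‖ellPoint Z p‖ := by
    have := Complex.abs_im_le_norm (ellPoint Z p)
    simpa [ellPoint, abs_mul, abs_of_pos hZ] using this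
  have h2' : |(p.2 : ℝ)| ≤ ‖ellPoint Z p‖ / Z.im := by rwa [le_div_iff₀ hZ]
  have h1 : |(p.1 : ℝ)| ≤ ‖ellPoint Z p‖ + |(p.2 : ℝ)| * ‖Z‖ := by
    have := norm_sub_le (ellPoint Z p) (p.2 * Z)
    simpa [ellPoint] using this
  have h0 := norm_nonneg (ellPoint Z p)
  have h3 : (1 + (1 + ‖Z‖) / Z.im) * ‖ellPoint Z p‖ =
    ‖ellPoint Z p‖ + (‖ellPoint Z p‖ / Z.im) * ‖Z‖ + ‖ellPoint Z p‖ / Z.im := by ring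
  rw [h3, Prod.norm_def, Int.norm_eq_abs, Int.norm_eq_abs]
  have h4 : |(p.2 : ℝ)| * ‖Z‖ ≤ (‖ellPoint Z p‖ / Z.im) * ‖Z‖ := by gcongr
  have h5 : 0 ≤ ‖ellPoint Z p‖ / Z.im := by positivity
  have h6 : 0 ≤ |(p.2 : ℝ)| * ‖Z‖ := by positivity
  exact max_le (by linarith) (by linarith)

/-- Near a point `w₀` off the lattice, the distances `|w - (m + n Z)|` and `|m + n Z|` grow at least
linearly, uniformly in `Z` and `w`. -/
theorem exists_uniform_lattice_bound {Z₀ w₀ : ℂ} (hZ : 0 < Z₀.im) (hw : w₀ ∉ ellLattice Z₀) :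
    ∃ c > 0, ∃ δ > 0, ∀ q ∈ Metric.ball (Z₀, w₀) δ, ∀ p : ℤ × ℤ,
      c * (1 + ‖p‖) ≤ ‖q.2 - ellPoint q.1 p‖ ∧ (p ≠ 0 → c * (1 + ‖p‖) ≤ ‖ellPoint q.1 p‖) := by
  obtain ⟨K, hK, hKp⟩ := norm_le_mul_norm_ellPoint hZ
  have hclosed := (ellPair Z₀ hZ).isClosed_lattice
  set d := Metric.infDist w₀ ((ellPair Z₀ hZ).lattice : Set ℂ) with hd
  have hd0 : 0 < d := (hclosed.notMem_iff_infDist_pos ⟨0, zero_mem _⟩).1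
    fun h => hw ((mem_ellPair_lattice hZ).1 h)
  have hdp : ∀ p, d ≤ ‖w₀ - ellPoint Z₀ p‖ := by
    intro p
    rw [← dist_eq_norm]
    exact Metric.infDist_le_dist_of_mem ((mem_ellPair_lattice hZ).2 (mem_ellLattice.2 ⟨p, rfl⟩))
  -- From `‖p‖ ≤ K * (‖w₀ - ellPoint Z₀ p‖ + ‖w₀‖)`; the constant `1 + K * ‖w₀‖` is absorbed using
  -- the distance `d` of `w₀` from the lattice.
  set A := (1 + K * ‖w₀‖) / d + K with hA
  have hA0 : 0 < A := by positivity
  have h1 : ∀ p : ℤ × ℤ, 1 + ‖p‖ ≤ A * ‖w₀ - ellPoint Z₀ p‖ := by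
    intro p
    have e1 := hKp p
    have e2 : ‖ellPoint Z₀ p‖ ≤ ‖w₀ - ellPoint Z₀ p‖ + ‖w₀‖ := by
      have := norm_sub_le w₀ (w₀ - ellPoint Z₀ p)
      rw [sub_sub_cancel] at this
      linarith
    have e3 : 1 + K * ‖w₀‖ ≤ (1 + K * ‖w₀‖) / d * ‖w₀ - ellPoint Z₀ p‖ := by
      rw [div_mul_eq_mul_div, le_div_iff₀ hd0]
      exact mul_le_mul_of_nonneg_left (hdp p) (by positivity)
    have e4 : K * ‖ellPoint Z₀ p‖ ≤ K * (‖w₀ - ellPoint Z₀ p‖ + ‖w₀‖) := by gcongr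
    rw [hA]
    linarith
  have h2 : ∀ p : ℤ × ℤ, p ≠ 0 → 1 + ‖p‖ ≤ 2 * K * ‖ellPoint Z₀ p‖ := by
    intro p hp
    have : 1 ≤ ‖p‖ := by
      rw [Prod.norm_def]
      by_cases h : p.1 = 0
      · have h2 : p.2 ≠ 0 := fun h2 => hp (Prod.ext h h2)
        exact le_max_of_le_right (by rw [Int.norm_eq_abs]; exact_mod_cast Int.one_le_abs h2)
      · exact le_max_of_le_left (by rw [Int.norm_eq_abs]; exact_mod_cast Int.one_le_abs h)
    linarith [hKp p]
  set B := max A (2 * K) with hB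
  have hB0 : 0 < B := lt_max_of_lt_left hA0
  -- At `(Z₀, w₀)` the growth rate is at least `1 / B`. Moving `Z` and `w` by less than `1 / (2 *
  -- B)` costs at most `(1 + ‖p‖) / (2 * B)`, that is, half of it.
  refine ⟨1 / (2 * B), by positivity, 1 / (2 * B), by positivity, fun q hq p => ?_⟩
  have hq1 : ‖q.1 - Z₀‖ < 1 / (2 * B) := by
    rw [← dist_eq_norm]; exact (max_lt_iff.1 hq).1
  have hq2 : ‖q.2 - w₀‖ < 1 / (2 * B) := by
    rw [← dist_eq_norm]; exact (max_lt_iff.1 hq).2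
  have hp2 : ‖(p.2 : ℂ)‖ ≤ ‖p‖ := by
    rw [Complex.norm_intCast, ← Int.norm_eq_abs]
    exact norm_snd_le p
  have hpert : ‖ellPoint q.1 p - ellPoint Z₀ p‖ ≤ ‖p‖ * (1 / (2 * B)) := by
    have : ellPoint q.1 p - ellPoint Z₀ p = p.2 * (q.1 - Z₀) := by simp only [ellPoint]; ring
    rw [this, norm_mul]
    gcongr
  have hsplit : 1 / (2 * B) * (1 + ‖p‖) = 1 / B * (1 + ‖p‖) - 1 / (2 * B) * (1 + ‖p‖) := by
    field_simp; ring
  constructor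
  · have e1 : 1 / B * (1 + ‖p‖) ≤ ‖w₀ - ellPoint Z₀ p‖ := by
      rw [one_div_mul_eq_div, div_le_iff₀ hB0, mul_comm]
      exact (h1 p).trans (by gcongr; exact le_max_left _ _)
    have e2 : ‖w₀ - ellPoint Z₀ p‖ ≤ ‖q.2 - ellPoint q.1 p‖ + (‖q.2 - w₀‖ +
        ‖ellPoint q.1 p - ellPoint Z₀ p‖) := by
      have : w₀ - ellPoint Z₀ p = (q.2 - ellPoint q.1 p) + (-(q.2 - w₀) +
        (ellPoint q.1 p - ellPoint Z₀ p)) := by ring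
      rw [this]
      refine (norm_add_le _ _).trans (add_le_add_right ?_ _)
      exact (norm_add_le _ _).trans_eq (by rw [norm_neg])
    rw [hsplit]
    linarith
  · intro hp
    have e1 : 1 / B * (1 + ‖p‖) ≤ ‖ellPoint Z₀ p‖ := by
      rw [one_div_mul_eq_div, div_le_iff₀ hB0, mul_comm]
      exact (h2 p hp).trans (by gcongr; exact le_max_right _ _)
    have e2 : ‖ellPoint Z₀ p‖ ≤ ‖ellPoint q.1 p‖ + ‖ellPoint q.1 p - ellPoint Z₀ p‖ := by
      have := norm_sub_le (ellPoint q.1 p) (ellPoint q.1 p - ellPoint Z₀ p)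
      rwa [sub_sub_cancel] at this
    have e3 : 0 < 1 / (2 * B) := by positivity
    rw [hsplit]
    linarith

theorem differentiable_ellPoint (p : ℤ × ℤ) :
    Differentiable ℂ fun q : ℂ × ℂ => ellPoint q.1 p := by
  unfold ellPoint; fun_prop

/-- `4℘` is holomorphic in the modulus and the argument. -/
theorem differentiableAt_weierstrassX {Z w : ℂ} (hZ : 0 < Z.im) (hw : w ∉ ellLattice Z) :
    DifferentiableAt ℂ (fun q : ℂ × ℂ => weierstrassX q.1 q.2) (Z, w) := by
  obtain ⟨c, hc, δ, hδ, hb⟩ := exists_uniform_lattice_bound hZ hw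
  -- The first summand of the constant bounds the terms with `p ≠ 0`, where the difference of
  -- inverse squares is of third order; `(c⁻¹) ^ 2` is for `p = 0`.
  refine (differentiableAt_tsum_of_summable_norm_on_ball hδ
    (summable_one_add_norm_inv_pow_three.mul_left
      (2 * (‖w‖ + δ) * (c⁻¹) ^ 3 + (c⁻¹) ^ 2)) ?_ ?_).const_mul 4
  · intro p q hq
    refine DifferentiableAt.differentiableWithinAt ?_
    have h1 : q.2 - ellPoint q.1 p ≠ 0 := by
      have := (hb q hq p).1
      refine norm_pos_iff.1 (lt_of_lt_of_le ?_ this)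
      positivity
    have hd := (differentiable_ellPoint p) q
    have hd1 : DifferentiableAt ℂ (fun q : ℂ × ℂ => q.2 - ellPoint q.1 p) q :=
      differentiableAt_snd.sub hd
    have hd2 := ((hd1.fun_pow 2).fun_inv (pow_ne_zero 2 h1)).const_mul 1
    simp only [← div_eq_mul_inv] at hd2
    refine hd2.fun_sub ?_
    by_cases hp : p = 0
    · simp [hp, ellPoint]
    · simp only [one_div]
      refine (hd.fun_pow 2).fun_inv (pow_ne_zero 2 ?_)
      have := (hb q hq p).2 hp
      refine norm_pos_iff.1 (lt_of_lt_of_le ?_ this)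
      positivity
  · intro p q hq
    obtain ⟨h1, h2⟩ := hb q hq p
    set M := 1 + ‖p‖ with hM
    have hM1 : 1 ≤ M := by linarith [norm_nonneg p]
    have hcM : 0 < c * M := by positivity
    have hq2 : ‖q.2‖ ≤ ‖w‖ + δ := by
      have h3 : ‖q.2 - w‖ < δ := by rw [← dist_eq_norm]; exact (max_lt_iff.1 hq).2
      have := norm_add_le (q.2 - w) w
      rw [sub_add_cancel] at this
      linarith
    have hn1 : 0 < ‖q.2 - ellPoint q.1 p‖ := hcM.trans_le h1
    have hi1 : ‖(q.2 - ellPoint q.1 p)⁻¹‖ ≤ c⁻¹ * M⁻¹ := by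
      rw [norm_inv, ← mul_inv]; gcongr
    by_cases hp : p = 0
    · subst hp
      -- At the origin the convention `1 / 0 = 0` leaves only the polar term of `℘`.
      have e1 : (1 : ℂ) / (q.2 - ellPoint q.1 0) ^ 2 - 1 / ellPoint q.1 0 ^ 2 =
          (q.2 - ellPoint q.1 0)⁻¹ ^ 2 := by simp [ellPoint]
      rw [e1, norm_pow]
      have hM' : M = 1 := by simp [hM]
      rw [hM'] at hi1 ⊢
      have e2 : ‖(q.2 - ellPoint q.1 0)⁻¹‖ ^ 2 ≤ (c⁻¹) ^ 2 := by
        gcongr; simpa using hi1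
      have e3 : 0 ≤ 2 * (‖w‖ + δ) * (c⁻¹) ^ 3 := by positivity
      simp only [one_pow, inv_one, mul_one]
      linarith
    · have hn2 : 0 < ‖ellPoint q.1 p‖ := hcM.trans_le (h2 hp)
      have hi2 : ‖(ellPoint q.1 p)⁻¹‖ ≤ c⁻¹ * M⁻¹ := by
        rw [norm_inv, ← mul_inv]; gcongr; exact h2 hp
      have hne1 := norm_pos_iff.1 hn1
      have hne2 := norm_pos_iff.1 hn2
      have e1 : (1 : ℂ) / (q.2 - ellPoint q.1 p) ^ 2 - 1 / ellPoint q.1 p ^ 2 =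
          q.2 * ((q.2 - ellPoint q.1 p)⁻¹ ^ 2 * (ellPoint q.1 p)⁻¹ -
            (q.2 - ellPoint q.1 p)⁻¹ * (ellPoint q.1 p)⁻¹ ^ 2) := by
        field_simp
        ring
      have e2 : ‖(q.2 - ellPoint q.1 p)⁻¹ ^ 2 * (ellPoint q.1 p)⁻¹ -
            (q.2 - ellPoint q.1 p)⁻¹ * (ellPoint q.1 p)⁻¹ ^ 2‖ ≤
          (c⁻¹ * M⁻¹) ^ 2 * (c⁻¹ * M⁻¹) + (c⁻¹ * M⁻¹) * (c⁻¹ * M⁻¹) ^ 2 := by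
        refine (norm_sub_le _ _).trans ?_
        rw [norm_mul, norm_mul, norm_pow, norm_pow]
        gcongr
      have e3 : 0 ≤ (c⁻¹) ^ 2 * (M ^ 3)⁻¹ := by positivity
      rw [e1, norm_mul]
      calc _ ≤ (‖w‖ + δ) * ((c⁻¹ * M⁻¹) ^ 2 * (c⁻¹ * M⁻¹) + (c⁻¹ * M⁻¹) * (c⁻¹ * M⁻¹) ^ 2) := by
            gcongr
        _ = 2 * (‖w‖ + δ) * (c⁻¹) ^ 3 * (M ^ 3)⁻¹ := by rw [← inv_pow M]; ring
        _ ≤ _ := by rw [add_mul]; linarith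

/-- `4℘'` is holomorphic in the modulus and the argument. -/
theorem differentiableAt_weierstrassY {Z w : ℂ} (hZ : 0 < Z.im) (hw : w ∉ ellLattice Z) :
    DifferentiableAt ℂ (fun q : ℂ × ℂ => weierstrassY q.1 q.2) (Z, w) := by
  obtain ⟨c, hc, δ, hδ, hb⟩ := exists_uniform_lattice_bound hZ hw
  refine (differentiableAt_tsum_of_summable_norm_on_ball hδ
    (summable_one_add_norm_inv_pow_three.mul_left (2 * (c⁻¹) ^ 3)) ?_ ?_).fun_neg.const_mul 4
  · intro p q hq
    refine DifferentiableAt.differentiableWithinAt ?_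
    have h1 : q.2 - ellPoint q.1 p ≠ 0 := by
      have := (hb q hq p).1
      refine norm_pos_iff.1 (lt_of_lt_of_le ?_ this)
      positivity
    have hd1 : DifferentiableAt ℂ (fun q : ℂ × ℂ => q.2 - ellPoint q.1 p) q :=
      differentiableAt_snd.sub ((differentiable_ellPoint p) q)
    have hd2 := ((hd1.fun_pow 3).fun_inv (pow_ne_zero 3 h1)).const_mul 2
    simp only [← div_eq_mul_inv] at hd2
    exact hd2
  · intro p q hq
    have h1 := (hb q hq p).1
    have hcM : 0 < c * (1 + ‖p‖) := by positivity
    rw [norm_div, norm_pow, div_eq_mul_inv, Complex.norm_ofNat, mul_assoc, inv_pow, ← mul_inv,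
      ← mul_pow]
    gcongr

/-- The coefficient `c₁` of the Weierstrass curve of `ℂ / (ℤ + ℤ Z)`, through the values of `x` at
the half periods. -/
noncomputable def weierstrassC₁ (Z : ℂ) : ℂ :=
  -(weierstrassX Z (1 / 2) ^ 2 + weierstrassX Z (1 / 2) * weierstrassX Z (Z / 2) +
    weierstrassX Z (Z / 2) ^ 2)

/-- The coefficient `c₀` of the Weierstrass curve of `ℂ / (ℤ + ℤ Z)`. -/
noncomputable def weierstrassC₀ (Z : ℂ) : ℂ :=
  -(weierstrassX Z (1 / 2) ^ 3 + weierstrassC₁ Z * weierstrassX Z (1 / 2))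

theorem half_notMem_ellLattice {Z : ℂ} (hZ : 0 < Z.im) : 1 / 2 ∉ ellLattice Z :=
  fun h => (ellPair Z hZ).ω₁_div_two_notMem_lattice ((mem_ellPair_lattice hZ).2 h)

theorem half_modulus_notMem_ellLattice {Z : ℂ} (hZ : 0 < Z.im) : Z / 2 ∉ ellLattice Z :=
  fun h => (ellPair Z hZ).ω₂_div_two_notMem_lattice ((mem_ellPair_lattice hZ).2 h)

/-- `℘'` is odd and periodic. -/
theorem derivWeierstrassP_half_eq_zero (L : PeriodPair) {l : ℂ} (hl : l ∈ L.lattice) :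
    L.derivWeierstrassP (l / 2) = 0 := by
  have h1 := L.derivWeierstrassP_add_coe (-(l / 2)) ⟨l, hl⟩
  rw [L.derivWeierstrassP_neg] at h1
  have h2 : -(l / 2) + l = l / 2 := by ring
  rw [h2] at h1
  exact self_eq_neg.1 h1

/-- The values of `x` at two half periods are distinct roots of the cubic and thus determine its
coefficients. In this form `c₁` and `c₀` inherit holomorphy in `Z` from `weierstrassX`, with no
separate study of Eisenstein series. -/
theorem isWeierstrassUniformization_ellLattice {Z : ℂ} (hZ : 0 < Z.im) :
    IsWeierstrassUniformization (ellLattice Z) (weierstrassC₁ Z) (weierstrassC₀ Z)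
      (weierstrassX Z) (weierstrassY Z) := by
  have h := (ellPair Z hZ).isWeierstrassUniformization
  rw [ellPair_lattice hZ, ← funext (weierstrassX_eq hZ), ← funext (weierstrassY_eq hZ)] at h
  set c₁ := -4 * (ellPair Z hZ).g₂
  set c₀ := -16 * (ellPair Z hZ).g₃
  have hy1 : weierstrassY Z (1 / 2) = 0 := by
    rw [weierstrassY_eq hZ]
    simp [show (1 / 2 : ℂ) = (ellPair Z hZ).ω₁ / 2 from rfl,
      derivWeierstrassP_half_eq_zero _ (ellPair Z hZ).ω₁_mem_lattice, -one_div]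
  have hy2 : weierstrassY Z (Z / 2) = 0 := by
    rw [weierstrassY_eq hZ, show Z / 2 = (ellPair Z hZ).ω₂ / 2 from rfl,
      derivWeierstrassP_half_eq_zero _ (ellPair Z hZ).ω₂_mem_lattice, mul_zero]
  have e1 := h.equation _ (half_notMem_ellLattice hZ)
  have e2 := h.equation _ (half_modulus_notMem_ellLattice hZ)
  rw [hy1] at e1
  rw [hy2] at e2
  have hne : weierstrassX Z (1 / 2) - weierstrassX Z (Z / 2) ≠ 0 := by
    intro h0
    have h1 := (h.injective _ _ (half_notMem_ellLattice hZ)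
      (half_modulus_notMem_ellLattice hZ)).1 ⟨sub_eq_zero.1 h0, by rw [hy1, hy2]⟩
    rw [← mem_ellPair_lattice hZ] at h1
    have h2 := (PeriodPair.mul_ω₁_add_mul_ω₂_mem_lattice (L := ellPair Z hZ)
      (α := 1 / 2) (β := -(1 / 2))).1 (by
        convert h1 using 1
        simp [ellPair]
        ring)
    norm_num at h2
  have hc₁ : c₁ = weierstrassC₁ Z := by
    refine mul_left_cancel₀ hne ?_
    rw [weierstrassC₁]
    linear_combination e2 - e1
  have hc₀ : c₀ = weierstrassC₀ Z := by
    rw [weierstrassC₀, ← hc₁]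
    linear_combination -e1
  rwa [hc₁, hc₀] at h

theorem isOpen_im_pos : IsOpen {Z : ℂ | 0 < Z.im} := isOpen_lt continuous_const Complex.continuous_im

theorem differentiableOn_weierstrassC₁ : DifferentiableOn ℂ weierstrassC₁ {Z : ℂ | 0 < Z.im} := by
  intro Z hZ
  have h1 : DifferentiableAt ℂ (fun Z => weierstrassX Z (1 / 2)) Z :=
    (differentiableAt_weierstrassX hZ (half_notMem_ellLattice hZ)).comp (f := fun Z => (Z, 1 / 2)) Z
      (by fun_prop)
  have h2 : DifferentiableAt ℂ (fun Z => weierstrassX Z (Z / 2)) Z :=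
    (differentiableAt_weierstrassX hZ (half_modulus_notMem_ellLattice hZ)).comp
      (f := fun Z => (Z, Z / 2)) Z (by fun_prop)
  exact (((h1.fun_pow 2).fun_add (h1.fun_mul h2)).fun_add (h2.fun_pow 2)).fun_neg.differentiableWithinAt

theorem differentiableOn_weierstrassC₀ : DifferentiableOn ℂ weierstrassC₀ {Z : ℂ | 0 < Z.im} := by
  intro Z hZ
  have h1 : DifferentiableAt ℂ (fun Z => weierstrassX Z (1 / 2)) Z :=
    (differentiableAt_weierstrassX hZ (half_notMem_ellLattice hZ)).comp (f := fun Z => (Z, 1 / 2)) Z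
      (by fun_prop)
  have h2 := differentiableOn_weierstrassC₁.differentiableAt (isOpen_im_pos.mem_nhds hZ)
  exact ((h1.fun_pow 3).fun_add (h2.fun_mul h1)).fun_neg.differentiableWithinAt

end WeierstrassFamily

/-! ### Real coordinates with respect to the period lattice -/

section Periods

variable {r : ℕ}

/-- The real span of the period lattice: `Π y` for a real vector `y`. -/
def realPeriod (d : Fin r → ℕ) (τ : Matrix (Fin r) (Fin r) ℂ) (y : Fin r ⊕ Fin r → ℝ) : CSpace r :=
  periodMatrix d τ *ᵥ fun i => (y i : ℂ)

theorem realPeriod_apply (d : Fin r → ℕ) (τ : Matrix (Fin r) (Fin r) ℂ) (y : Fin r ⊕ Fin r → ℝ)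
    (i : Fin r) : realPeriod d τ y i = d i * y (Sum.inl i) + ∑ j, τ i j * y (Sum.inr j) := by
  simp only [realPeriod, periodMatrix, invFactorMatrix, Matrix.fromCols_mulVec, Pi.add_apply]
  congr 1
  rw [Matrix.diagonal_map (by simp), Matrix.mulVec_diagonal]
  simp

theorem realPeriod_add (d : Fin r → ℕ) (τ : Matrix (Fin r) (Fin r) ℂ)
    (y y' : Fin r ⊕ Fin r → ℝ) :
    realPeriod d τ (y + y') = realPeriod d τ y + realPeriod d τ y' := by
  rw [realPeriod, realPeriod, realPeriod, ← Matrix.mulVec_add]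
  congr 1
  ext i
  simp

theorem realPeriod_intCast (d : Fin r → ℕ) (τ : Matrix (Fin r) (Fin r) ℂ)
    (n : Fin r ⊕ Fin r → ℤ) : realPeriod d τ (fun i => (n i : ℝ)) = periodVector d τ n := by
  simp [realPeriod, periodVector]

theorem continuous_realPeriod (d : Fin r → ℕ) (τ : Matrix (Fin r) (Fin r) ℂ) :
    Continuous (realPeriod d τ) := by
  refine continuous_pi fun i => ?_
  simp only [realPeriod_apply]
  fun_prop

/-- The imaginary part involves only the second half of `y`, through the invertible matrix `Im τ`;
the real part then kills the first half. -/
theorem eq_zero_of_realPeriod_eq_zero {d : Fin r → ℕ} (hd : ∀ i, 0 < d i)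
    {τ : Matrix (Fin r) (Fin r) ℂ} (hτ : (τ.map Complex.im).PosDef) {y : Fin r ⊕ Fin r → ℝ}
    (h : realPeriod d τ y = 0) : y = 0 := by
  have h2 : (fun j => y (Sum.inr j)) = 0 := by
    refine Matrix.eq_zero_of_mulVec_eq_zero hτ.det_pos.ne' ?_
    ext i
    have := congrArg Complex.im (congrFun h i)
    rw [realPeriod_apply] at this
    simpa [Matrix.mulVec, dotProduct] using this
  have h2' : ∀ j, y (Sum.inr j) = 0 := congrFun h2
  ext i
  rcases i with i | i
  · have := congrArg Complex.re (congrFun h i)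
    rw [realPeriod_apply] at this
    simpa [h2', (hd i).ne'] using this
  · exact h2' i

theorem exists_realPeriod_eq {d : Fin r → ℕ} (hd : ∀ i, 0 < d i)
    {τ : Matrix (Fin r) (Fin r) ℂ} (hτ : (τ.map Complex.im).PosDef) (z : CSpace r) :
    ∃ y, realPeriod d τ y = z := by
  have hu : IsUnit (τ.map Complex.im).det := hτ.det_pos.ne'.isUnit
  set y2 : Fin r → ℝ := (τ.map Complex.im)⁻¹ *ᵥ fun i => (z i).im with hy2
  have h2 : (τ.map Complex.im) *ᵥ y2 = fun i => (z i).im := by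
    rw [hy2, Matrix.mulVec_mulVec, Matrix.mul_nonsing_inv _ hu, Matrix.one_mulVec]
  refine ⟨Sum.elim (fun i => ((z i).re - ∑ j, (τ i j).re * y2 j) / d i) y2, ?_⟩
  ext i
  have hdi : (d i : ℝ) ≠ 0 := by exact_mod_cast (hd i).ne'
  rw [realPeriod_apply]
  apply Complex.ext
  · simp only [Sum.elim_inl, Sum.elim_inr, Complex.add_re, Complex.mul_re, Complex.re_sum,
      Complex.ofReal_re, Complex.ofReal_im, Complex.natCast_re, Complex.natCast_im]
    simp only [mul_zero, sub_zero]
    field_simp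
    ring
  · simp only [Sum.elim_inl, Sum.elim_inr, Complex.add_im, Complex.mul_im, Complex.im_sum,
      Complex.ofReal_re, Complex.ofReal_im, Complex.natCast_re, Complex.natCast_im]
    have := congrFun h2 i
    simpa [Matrix.mulVec, dotProduct] using this

/-- A continuous function which is periodic under the period lattice is bounded. -/
theorem isBounded_range_of_periodVector_periodic {d : Fin r → ℕ} (hd : ∀ i, 0 < d i)
    {τ : Matrix (Fin r) (Fin r) ℂ} (hτ : (τ.map Complex.im).PosDef) {F : Type*}
    [PseudoMetricSpace F] {f : CSpace r → F} (hf : Continuous f)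
    (hper : ∀ z n, f (z + periodVector d τ n) = f z) : Bornology.IsBounded (range f) := by
  -- Every value of `f` is taken on the image of the unit cube, a compact fundamental domain.
  have hK : IsCompact (univ.pi fun _ : Fin r ⊕ Fin r => Icc (0 : ℝ) 1) :=
    isCompact_univ_pi fun _ => isCompact_Icc
  refine (hK.image (hf.comp (continuous_realPeriod d τ))).isBounded.subset ?_
  rintro _ ⟨z, rfl⟩
  obtain ⟨y, rfl⟩ := exists_realPeriod_eq hd hτ z
  refine ⟨fun i => Int.fract (y i), fun i _ => ⟨Int.fract_nonneg _, (Int.fract_lt_one _).le⟩, ?_⟩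
  show f (realPeriod d τ fun i => Int.fract (y i)) = _
  rw [← hper _ fun i => ⌊y i⌋, ← realPeriod_intCast, ← realPeriod_add]
  congr 2
  ext i
  exact Int.fract_add_floor (y i)

end Periods

/-! ### Two-forms as bilinear forms -/

section SymplecticForm

set_option maxSynthPendingDepth 3

theorem update_pair_zero {V : Type*} (v w x : V) : Function.update ![v, w] 0 x = ![x, w] := by
  ext i; fin_cases i <;> rfl

theorem update_pair_one {V : Type*} (v w x : V) : Function.update ![v, w] 1 x = ![v, x] := by
  ext i; fin_cases i <;> rfl

/-- An alternating two-form as a bilinear form. -/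
noncomputable def twoFormToBilin (V : Type*) [NormedAddCommGroup V] [NormedSpace ℂ V] :
    (V [⋀^Fin 2]→L[ℂ] ℂ) →L[ℂ] V →L[ℂ] V →L[ℂ] ℂ :=
  LinearMap.mkContinuous₂
    (LinearMap.mk₂ ℂ (fun (ω : V [⋀^Fin 2]→L[ℂ] ℂ) (v : V) => LinearMap.mkContinuous
        { toFun := fun w => ω ![v, w]
          map_add' := fun w w' => by
            have := ω.map_update_add ![v, w] 1 w w'
            rwa [update_pair_one, update_pair_one, update_pair_one] at this
          map_smul' := fun c w => by
            have := ω.map_update_smul ![v, w] 1 c w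
            rwa [update_pair_one, update_pair_one] at this } (‖ω‖ * ‖v‖) (fun w => by
            have := ω.le_opNorm ![v, w]
            simpa [Fin.prod_univ_two, mul_assoc] using this))
      (fun ω ω' v => by ext w; simp)
      (fun c ω v => by ext w; simp)
      (fun ω v v' => by
        ext w
        have := ω.map_update_add ![v, w] 0 v v'
        rwa [update_pair_zero, update_pair_zero, update_pair_zero] at this)
      (fun c ω v => by
        ext w
        have := ω.map_update_smul ![v, w] 0 c v
        rwa [update_pair_zero, update_pair_zero] at this))
    1 (fun ω v => by
      rw [one_mul]
      refine ContinuousLinearMap.opNorm_le_bound _ (by positivity) fun w => ?_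
      show ‖ω ![v, w]‖ ≤ _
      have := ω.le_opNorm ![v, w]
      simpa [Fin.prod_univ_two, mul_assoc] using this)

theorem twoFormToBilin_apply {V : Type*} [NormedAddCommGroup V] [NormedSpace ℂ V]
    (ω : V [⋀^Fin 2]→L[ℂ] ℂ) (v w : V) : twoFormToBilin V ω v w = ω ![v, w] := rfl

theorem twoForm_swap {V : Type*} [NormedAddCommGroup V] [NormedSpace ℂ V]
    (ω : V [⋀^Fin 2]→L[ℂ] ℂ) (v w : V) : ω ![v, w] = -ω ![w, v] := by
  have h := ω.map_swap ![w, v] (i := 0) (j := 1) (by decide)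
  have e : ![w, v] ∘ Equiv.swap (0 : Fin 2) 1 = ![v, w] := by
    ext i; fin_cases i <;> rfl
  rwa [e] at h

end SymplecticForm

/-! ### Structure of the symplectic form -/

section LagrangianFibration

set_option maxSynthPendingDepth 3

namespace LocalSK

variable {r : ℕ} (S : LocalSK r)

/-- The lattice vector `Π(u) n`, as a function of `u`. -/
def periodSection (n : Fin r ⊕ Fin r → ℤ) (u : CSpace r) : CSpace r := periodVector S.d (S.τ u) n

theorem periodSection_apply (n : Fin r ⊕ Fin r → ℤ) (u : CSpace r) (i : Fin r) :
    S.periodSection n u i = S.d i * n (Sum.inl i) + ∑ j, S.τ u i j * n (Sum.inr j) := by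
  rw [periodSection, ← realPeriod_intCast, realPeriod_apply]
  simp

theorem differentiableAt_periodSection (n : Fin r ⊕ Fin r → ℤ) {u : CSpace r} (hu : u ∈ S.C) :
    DifferentiableAt ℂ (S.periodSection n) u := by
  rw [differentiableAt_pi]
  intro i
  simp only [periodSection_apply]
  have h : ∀ j, DifferentiableAt ℂ (fun u => S.τ u i j) u := fun j =>
    (S.τ_holo i j).differentiableAt (S.isOpen_C.mem_nhds hu)
  fun_prop

theorem isOpen_total : IsOpen (S.C ×ˢ (univ : Set (CSpace r))) := S.isOpen_C.prod isOpen_univ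

theorem L_differentiableAt {u : CSpace r} (hu : u ∈ S.C) (z : CSpace r) :
    DifferentiableAt ℂ S.L (u, z) :=
  S.L_holo.differentiableAt (S.isOpen_total.mem_nhds ⟨hu, mem_univ _⟩)

/-- The symplectic form as a bilinear form. -/
noncomputable def bil (p : CSpace r × CSpace r) :
    (CSpace r × CSpace r) →L[ℂ] (CSpace r × CSpace r) →L[ℂ] ℂ :=
  twoFormToBilin _ (S.L p)

theorem bil_apply (p v w : CSpace r × CSpace r) : S.bil p v w = S.L p ![v, w] := rfl

theorem bil_swap (p v w : CSpace r × CSpace r) : S.bil p v w = -S.bil p w v := twoForm_swap _ v w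

theorem bil_vert {u : CSpace r} (hu : u ∈ S.C) (z v w : CSpace r) :
    S.bil (u, z) (0, v) (0, w) = 0 := S.L_lagrangian _ ⟨hu, mem_univ _⟩ v w

theorem differentiableAt_bil {u : CSpace r} (hu : u ∈ S.C) (z : CSpace r) :
    DifferentiableAt ℂ S.bil (u, z) :=
  (twoFormToBilin (CSpace r × CSpace r)).differentiableAt.comp _ (S.L_differentiableAt hu z)

theorem hasFDerivAt_deckMap (n : Fin r ⊕ Fin r → ℤ) {u : CSpace r} (hu : u ∈ S.C) (z : CSpace r) :
    HasFDerivAt (deckMap S.d S.τ n)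
      ((ContinuousLinearMap.fst ℂ (CSpace r) (CSpace r)).prod
        (ContinuousLinearMap.snd ℂ (CSpace r) (CSpace r) +
          (fderiv ℂ (S.periodSection n) u).comp (ContinuousLinearMap.fst ℂ _ _))) (u, z) :=
  hasFDerivAt_fst.prodMk (hasFDerivAt_snd.add
    (HasFDerivAt.comp (g := S.periodSection n) (u, z)
      (S.differentiableAt_periodSection n hu).hasFDerivAt hasFDerivAt_fst))

/-- The periods vary with `u`, so a deck transformation shears horizontal vectors by the derivative
of the lattice vector. -/
theorem bil_deck (n : Fin r ⊕ Fin r → ℤ) {u : CSpace r} (hu : u ∈ S.C) (z : CSpace r)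
    (v w : CSpace r × CSpace r) :
    S.bil (u, z + S.periodSection n u) (v.1, v.2 + fderiv ℂ (S.periodSection n) u v.1)
      (w.1, w.2 + fderiv ℂ (S.periodSection n) u w.1) = S.bil (u, z) v w := by
  have h := congrArg (fun ω => twoFormToBilin _ ω v w) (S.L_invariant n (u, z) ⟨hu, mem_univ _⟩)
  rw [(S.hasFDerivAt_deckMap n hu z).fderiv] at h
  refine Eq.trans ?_ h
  rw [twoFormToBilin_apply, ContinuousAlternatingMap.compContinuousLinearMap_apply, bil_apply]
  congr 1
  ext i : 1
  fin_cases i <;> rfl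

/-- Splitting of the bilinear form into its components. -/
theorem bil_decompose {u : CSpace r} (hu : u ∈ S.C) (z v e w f : CSpace r) :
    S.bil (u, z) (v, e) (w, f) =
      S.bil (u, z) (v, 0) (0, f) - S.bil (u, z) (w, 0) (0, e) + S.bil (u, z) (v, 0) (w, 0) := by
  have h1 : (v, e) = (v, 0) + (0, e) := by simp
  have h2 : (w, f) = (w, 0) + (0, f) := by simp
  have h3 := S.bil_vert hu z e f
  have h4 := S.bil_swap (u, z) (0, e) (w, 0)
  rw [h1, h2]
  simp only [map_add, add_apply]
  rw [h3, h4]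
  ring

/-- The pull-back of a bilinear form under a pair of linear maps. -/
noncomputable def pullBilin {E V : Type*} [NormedAddCommGroup E] [NormedSpace ℂ E]
    [NormedAddCommGroup V] [NormedSpace ℂ V] (ι κ : E →L[ℂ] V) (B : V →L[ℂ] V →L[ℂ] ℂ) :
    E →L[ℂ] E →L[ℂ] ℂ :=
  ((ContinuousLinearMap.compL ℂ E V ℂ).flip κ).comp (B.comp ι)

theorem differentiableAt_pullBilin {E V W : Type*} [NormedAddCommGroup E] [NormedSpace ℂ E]
    [NormedAddCommGroup V] [NormedSpace ℂ V] [NormedAddCommGroup W] [NormedSpace ℂ W]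
    (ι κ : E →L[ℂ] V) {B : W → V →L[ℂ] V →L[ℂ] ℂ}
    {x : W} (hB : DifferentiableAt ℂ B x) :
    DifferentiableAt ℂ (fun w => pullBilin ι κ (B w)) x ∧
    ∀ a v w, fderiv ℂ (fun w => pullBilin ι κ (B w)) x a v w = fderiv ℂ B x a (ι v) (κ w) := by
  have h := (hasFDerivAt_const ((ContinuousLinearMap.compL ℂ E V ℂ).flip κ) x).clm_comp
    (hB.hasFDerivAt.clm_comp (hasFDerivAt_const ι x))
  refine ⟨h.differentiableAt, fun a v w => ?_⟩
  have h' : fderiv ℂ (fun w => pullBilin ι κ (B w)) x = _ := h.fderiv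
  rw [h']
  simp

/-- The mixed component of `L`: a one-form on the base for every vertical vector. -/
noncomputable def mixed (u : CSpace r) : CSpace r →L[ℂ] CSpace r →L[ℂ] ℂ :=
  pullBilin (ContinuousLinearMap.inl ℂ (CSpace r) (CSpace r))
    (ContinuousLinearMap.inr ℂ (CSpace r) (CSpace r)) (S.bil (u, 0))

/-- The horizontal component of `L`: a two-form on the base. -/
noncomputable def horiz (u : CSpace r) : CSpace r →L[ℂ] CSpace r →L[ℂ] ℂ :=
  pullBilin (ContinuousLinearMap.inl ℂ (CSpace r) (CSpace r))
    (ContinuousLinearMap.inl ℂ (CSpace r) (CSpace r)) (S.bil (u, 0))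

theorem horiz_apply (u v w : CSpace r) : S.horiz u v w = S.bil (u, 0) (v, 0) (w, 0) := rfl

theorem hasFDerivAt_bil_zero {u : CSpace r} (hu : u ∈ S.C) :
    HasFDerivAt (fun u => S.bil (u, 0))
      ((fderiv ℂ S.bil (u, 0)).comp (ContinuousLinearMap.inl ℂ _ _)) u :=
  HasFDerivAt.comp (f := fun u : CSpace r => (u, (0 : CSpace r))) u
    (S.differentiableAt_bil hu 0).hasFDerivAt (hasFDerivAt_prodMk_left u 0)

theorem differentiableAt_mixed {u : CSpace r} (hu : u ∈ S.C) : DifferentiableAt ℂ S.mixed u :=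
  (differentiableAt_pullBilin _ _ (S.hasFDerivAt_bil_zero hu).differentiableAt).1

theorem differentiableAt_horiz {u : CSpace r} (hu : u ∈ S.C) : DifferentiableAt ℂ S.horiz u :=
  (differentiableAt_pullBilin _ _ (S.hasFDerivAt_bil_zero hu).differentiableAt).1

theorem fderiv_horiz {u : CSpace r} (hu : u ∈ S.C) (a v w : CSpace r) :
    fderiv ℂ S.horiz u a v w = fderiv ℂ S.bil (u, 0) (a, 0) (v, 0) (w, 0) := by
  have h := S.hasFDerivAt_bil_zero hu
  have := (differentiableAt_pullBilin (ContinuousLinearMap.inl ℂ (CSpace r) (CSpace r))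
    (ContinuousLinearMap.inl ℂ (CSpace r) (CSpace r)) h.differentiableAt).2 a v w
  rw [h.fderiv] at this
  exact this

theorem hasFDerivAt_bil_apply {p : CSpace r × CSpace r} (hp : p.1 ∈ S.C)
    (v w : CSpace r × CSpace r) :
    HasFDerivAt (fun p => S.bil p v w) (((fderiv ℂ S.bil p).flip v).flip w) p := by
  have h := (S.differentiableAt_bil hp p.2).hasFDerivAt
  have h2 := (h.clm_apply (hasFDerivAt_const v p)).clm_apply (hasFDerivAt_const w p)
  refine h2.congr_fderiv ?_
  ext a <;> simp

theorem bil_closed {p : CSpace r × CSpace r} (hp : p.1 ∈ S.C) (x₁ x₂ x₃ : CSpace r × CSpace r) :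
    fderiv ℂ S.bil p x₁ x₂ x₃ - fderiv ℂ S.bil p x₂ x₁ x₃ + fderiv ℂ S.bil p x₃ x₁ x₂ = 0 := by
  have h := congrArg (fun ω => ω ![x₁, x₂, x₃]) (S.L_closed p ⟨hp, mem_univ _⟩)
  simp only [extDeriv_apply (S.L_differentiableAt hp p.2)] at h
  rw [Fin.sum_univ_three] at h
  have e0 : (0 : Fin 3).removeNth ![x₁, x₂, x₃] = ![x₂, x₃] := by ext i : 1; fin_cases i <;> rfl
  have e1 : (1 : Fin 3).removeNth ![x₁, x₂, x₃] = ![x₁, x₃] := by ext i : 1; fin_cases i <;> rfl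
  have e2 : (2 : Fin 3).removeNth ![x₁, x₂, x₃] = ![x₁, x₂] := by ext i : 1; fin_cases i <;> rfl
  rw [e0, e1, e2] at h
  simp only [← bil_apply, (S.hasFDerivAt_bil_apply hp _ _).fderiv] at h
  simp at h
  linear_combination h

/-- The mixed component of `L` is constant along the fibres. -/
theorem bil_mixed {u : CSpace r} (hu : u ∈ S.C) (z v e : CSpace r) :
    S.bil (u, z) (v, 0) (0, e) = S.mixed u v e := by
  have hd : Differentiable ℂ fun z => S.bil (u, z) (v, 0) (0, e) := fun z =>
    (HasFDerivAt.comp (f := fun z : CSpace r => (u, z)) z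
      (S.hasFDerivAt_bil_apply (p := (u, z)) hu (v, 0) (0, e))
      (hasFDerivAt_prodMk_right u z)).differentiableAt
  -- Deck transformations alter `(v, 0)` only by a vertical vector, which pairs to zero with `(0,
  -- e)`. So the component is entire and periodic in `z`, and Liouville applies.
  refine hd.apply_eq_apply_of_bounded (isBounded_range_of_periodVector_periodic S.d_pos
    (S.τ_pos u hu) hd.continuous fun z n => ?_) z 0
  have h := S.bil_deck n hu z (v, 0) (0, e)
  have h0 : ((0 : CSpace r), (0 : CSpace r)) = 0 := rfl
  rw [S.bil_decompose hu _ v (0 + fderiv ℂ (S.periodSection n) u v)] at h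
  simpa [h0, periodSection] using h

/-- The derivative of the horizontal component of `L` along the fibres. -/
theorem fderiv_bil_vert {u : CSpace r} (hu : u ∈ S.C) (z e v w : CSpace r) :
    fderiv ℂ S.bil (u, z) (0, e) (v, 0) (w, 0) =
      fderiv ℂ S.mixed u w v e - fderiv ℂ S.mixed u v w e := by
  have hm : ∀ a b, fderiv ℂ S.bil (u, z) (a, 0) (b, 0) (0, e) = fderiv ℂ S.mixed u a b e := by
    intro a b
    have h1 := HasFDerivAt.comp (f := fun u : CSpace r => (u, z)) u
      (S.hasFDerivAt_bil_apply (p := (u, z)) hu (b, 0) (0, e)) (hasFDerivAt_prodMk_left u z)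
    have h2 := ((S.differentiableAt_mixed hu).hasFDerivAt.clm_apply
      (hasFDerivAt_const b u)).clm_apply (hasFDerivAt_const e u)
    have h3 := h1.unique (h2.congr_of_eventuallyEq (eventually_of_mem (S.isOpen_C.mem_nhds hu)
      fun y hy => S.bil_mixed hy z b e))
    have h4 := congrArg (fun A => A a) h3
    simpa using h4
  have hs : ∀ a b c, fderiv ℂ S.bil (u, z) a b c = -fderiv ℂ S.bil (u, z) a c b := by
    intro a b c
    have h1 := S.hasFDerivAt_bil_apply (p := (u, z)) hu b c
    have h2 := (S.hasFDerivAt_bil_apply (p := (u, z)) hu c b).neg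
    have h3 := h1.unique (h2.congr_of_eventuallyEq (Eventually.of_forall fun y => S.bil_swap y b c))
    have h4 := congrArg (fun A => A a) h3
    simpa using h4
  -- Closedness on one vertical and two horizontal vectors; the two other derivatives are those of
  -- the mixed component, already known not to depend on `z`.
  have h := S.bil_closed (p := (u, z)) hu (0, e) (v, 0) (w, 0)
  rw [hs (v, 0) (0, e), hs (w, 0) (0, e), hm, hm] at h
  linear_combination h

/-- By `fderiv_bil_vert` the derivative in `z` is independent of `z`. -/
theorem bil_horiz_affine {u : CSpace r} (hu : u ∈ S.C) (z v w : CSpace r) :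
    S.bil (u, z) (v, 0) (w, 0) = S.horiz u v w +
      (fderiv ℂ S.mixed u w v z - fderiv ℂ S.mixed u v w z) := by
  set g : CSpace r → ℂ := fun z => S.bil (u, z) (v, 0) (w, 0) -
      (fderiv ℂ S.mixed u w v - fderiv ℂ S.mixed u v w) z with hg
  have hd : ∀ z, HasFDerivAt g (0 : CSpace r →L[ℂ] ℂ) z := by
    intro z
    have h1 := (HasFDerivAt.comp (f := fun z : CSpace r => (u, z)) z
      (S.hasFDerivAt_bil_apply (p := (u, z)) hu (v, 0) (w, 0))
      (hasFDerivAt_prodMk_right u z)).sub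
      (fderiv ℂ S.mixed u w v - fderiv ℂ S.mixed u v w).hasFDerivAt
    refine h1.congr_fderiv ?_
    ext e
    have := S.fderiv_bil_vert hu z e v w
    simp [this]
  have h := is_const_of_fderiv_eq_zero (𝕜 := ℂ) (f := g) (fun z => (hd z).differentiableAt)
    (fun z => (hd z).fderiv) z 0
  simp only [hg, map_zero, sub_zero] at h
  rw [horiz_apply, ← h]
  simp

/-- Deck invariance on two horizontal vectors: the increment of the affine function of `z` along a
lattice vector must balance the shear of the two vectors. -/
theorem fderiv_mixed_add {u : CSpace r} (hu : u ∈ S.C) (n : Fin r ⊕ Fin r → ℤ) (v w : CSpace r) :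
    fderiv ℂ S.mixed u w v (S.periodSection n u) - fderiv ℂ S.mixed u v w (S.periodSection n u) +
      (S.mixed u v (fderiv ℂ (S.periodSection n) u w) -
        S.mixed u w (fderiv ℂ (S.periodSection n) u v)) = 0 := by
  have h := S.bil_deck n hu 0 (v, 0) (w, 0)
  simp only [zero_add] at h
  rw [S.bil_decompose hu, S.bil_mixed hu, S.bil_mixed hu, S.bil_horiz_affine hu] at h
  rw [horiz_apply] at h
  linear_combination h

/-- For every constant vertical vector, the one-form `L(·, e)` on the base is closed. -/
theorem mixed_closed {u : CSpace r} (hu : u ∈ S.C) (v w e : CSpace r) :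
    fderiv ℂ S.mixed u v w e = fderiv ℂ S.mixed u w v e := by
  have h : fderiv ℂ S.mixed u w v - fderiv ℂ S.mixed u v w = 0 := by
    refine ContinuousLinearMap.coe_injective ((Pi.basisFun ℂ (Fin r)).ext fun i => ?_)
    rw [Pi.basisFun_apply]
    set n : Fin r ⊕ Fin r → ℤ := Pi.single (Sum.inl i) 1 with hn
    have hconst : S.periodSection n = fun _ => (S.d i : ℂ) • Pi.single i (1 : ℂ) := by
      ext u j
      rw [periodSection_apply]
      by_cases hij : j = i
      · subst hij; simp [hn]
      · simp [hn, hij]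
    have h1 := S.fderiv_mixed_add hu n v w
    have hd : (S.d i : ℂ) ≠ 0 := by exact_mod_cast (S.d_pos i).ne'
    simp only [hconst, map_smul, fderiv_fun_const, Pi.zero_apply, zero_apply, map_zero, sub_zero,
      add_zero, smul_eq_mul, ← mul_sub, mul_eq_zero, hd, false_or] at h1
    simpa using h1
  have := congrArg (fun A => A e) h
  exact (sub_eq_zero.1 this).symm

/-- What remains of `fderiv_mixed_add` after `mixed_closed`. This symmetry makes the contraction of
`L` with a moving lattice vector closed. -/
theorem mixed_fderiv_periodSection {u : CSpace r} (hu : u ∈ S.C) (n : Fin r ⊕ Fin r → ℤ)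
    (v w : CSpace r) : S.mixed u v (fderiv ℂ (S.periodSection n) u w) =
      S.mixed u w (fderiv ℂ (S.periodSection n) u v) := by
  have h := S.fderiv_mixed_add hu n v w
  rw [S.mixed_closed hu w v, sub_self, zero_add] at h
  exact sub_eq_zero.1 h

/-- `L` in terms of its mixed and horizontal components. -/
theorem bil_eq {u : CSpace r} (hu : u ∈ S.C) (z v e w f : CSpace r) :
    S.bil (u, z) (v, e) (w, f) = S.mixed u v f - S.mixed u w e + S.horiz u v w := by
  rw [S.bil_decompose hu, S.bil_mixed hu, S.bil_mixed hu, S.bil_horiz_affine hu,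
    S.mixed_closed hu w v, sub_self, add_zero]

theorem horiz_swap (u v w : CSpace r) : S.horiz u v w = -S.horiz u w v := S.bil_swap _ _ _

theorem horiz_closed {u : CSpace r} (hu : u ∈ S.C) (x y z : CSpace r) :
    fderiv ℂ S.horiz u x y z + fderiv ℂ S.horiz u y z x + fderiv ℂ S.horiz u z x y = 0 := by
  have h := S.bil_closed (p := (u, 0)) hu (x, 0) (y, 0) (z, 0)
  simp only [← S.fderiv_horiz hu] at h
  have hs : fderiv ℂ S.horiz u y z x = -fderiv ℂ S.horiz u y x z := by
    have h0 := (S.differentiableAt_horiz hu).hasFDerivAt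
    have h1 := (h0.clm_apply (hasFDerivAt_const z u)).clm_apply (hasFDerivAt_const x u)
    have h2 := ((h0.clm_apply (hasFDerivAt_const x u)).clm_apply (hasFDerivAt_const z u)).neg
    have h3 := h1.unique (h2.congr_of_eventuallyEq
      (Eventually.of_forall fun p => S.horiz_swap p z x))
    have h4 := congrArg (fun A => A y) h3
    simpa using h4
  rw [hs]
  linear_combination h

/-- The mixed component of `L` is nondegenerate. -/
theorem eq_zero_of_mixed_eq_zero {u : CSpace r} (hu : u ∈ S.C) {e : CSpace r}
    (h : ∀ v, S.mixed u v e = 0) : e = 0 := by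
  have h1 := S.L_nondegenerate (u, 0) ⟨hu, mem_univ _⟩ (0, e) fun w => by
    rw [← bil_apply, show w = (w.1, w.2) from rfl, S.bil_eq hu, h]
    simp
  exact congrArg Prod.snd h1

end LocalSK

end LagrangianFibration

/-! ### A constant homology basis that splits all fibres -/

section Splitting

namespace LocalSK

variable {r : ℕ} (S : LocalSK r)

/-- The `k`-th column of the period matrix after the change of homology basis `R`. -/
def column (R : Matrix (Fin r ⊕ Fin r) (Fin r ⊕ Fin r) ℤ) (k : Fin r ⊕ Fin r) :
    CSpace r → CSpace r := S.periodSection fun i => R i k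

theorem period_mul_apply (R : Matrix (Fin r ⊕ Fin r) (Fin r ⊕ Fin r) ℤ) (u : CSpace r) (i : Fin r)
    (k : Fin r ⊕ Fin r) :
    (S.period u * R.map (Int.cast : ℤ → ℂ)) i k = S.column R k u i := rfl

theorem realPeriod_mulVec (R : Matrix (Fin r ⊕ Fin r) (Fin r ⊕ Fin r) ℤ) (u : CSpace r)
    (y : Fin r ⊕ Fin r → ℝ) :
    realPeriod S.d (S.τ u) (R.map (Int.cast : ℤ → ℝ) *ᵥ y) =
      ∑ k, (y k : ℂ) • S.column R k u := by
  have h : (fun i => (((R.map (Int.cast : ℤ → ℝ) *ᵥ y) i : ℝ) : ℂ)) =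
      R.map (Int.cast : ℤ → ℂ) *ᵥ fun k => (y k : ℂ) := by
    ext i
    simp [Matrix.mulVec, dotProduct]
  rw [realPeriod, h, Matrix.mulVec_mulVec]
  ext i
  simp only [Matrix.mulVec, dotProduct, Finset.sum_apply, Pi.smul_apply, smul_eq_mul]
  exact Finset.sum_congr rfl fun k _ => mul_comm _ _

theorem isUnit_det_map {R : Matrix (Fin r ⊕ Fin r) (Fin r ⊕ Fin r) ℤ} (hR : IsUnit R.det) :
    IsUnit (R.map (Int.cast : ℤ → ℝ)).det := by
  have := hR.map (Int.castRingHom ℝ)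
  rwa [RingHom.map_det] at this

variable {S} in
theorem eq_zero_of_sum_smul_column {R : Matrix (Fin r ⊕ Fin r) (Fin r ⊕ Fin r) ℤ}
    (hR : IsUnit R.det) {u : CSpace r} (hu : u ∈ S.C) {y : Fin r ⊕ Fin r → ℝ}
    (h : ∑ k, (y k : ℂ) • S.column R k u = 0) : y = 0 := by
  rw [← realPeriod_mulVec] at h
  exact Matrix.eq_zero_of_mulVec_eq_zero (isUnit_det_map hR).ne_zero
    (eq_zero_of_realPeriod_eq_zero S.d_pos (S.τ_pos u hu) h)

variable {S} in
theorem exists_sum_smul_column {R : Matrix (Fin r ⊕ Fin r) (Fin r ⊕ Fin r) ℤ}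
    (hR : IsUnit R.det) {u : CSpace r} (hu : u ∈ S.C) (z : CSpace r) :
    ∃ y : Fin r ⊕ Fin r → ℝ, ∑ k, (y k : ℂ) • S.column R k u = z := by
  obtain ⟨y, hy⟩ := exists_realPeriod_eq S.d_pos (S.τ_pos u hu) z
  refine ⟨(R.map (Int.cast : ℤ → ℝ))⁻¹ *ᵥ y, ?_⟩
  rw [← realPeriod_mulVec, Matrix.mulVec_mulVec, Matrix.mul_nonsing_inv _ (isUnit_det_map hR),
    Matrix.one_mulVec, hy]

/-- The homology basis `R` splits the fibre over `u` into elliptic curves. -/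
def Splits (R : Matrix (Fin r ⊕ Fin r) (Fin r ⊕ Fin r) ℤ) (u : CSpace r) : Prop :=
  IsUnit R.det ∧ ∀ l, ∃ ζ : ℂ, 0 < ζ.im ∧
    S.column R (Sum.inr l) u = ζ • S.column R (Sum.inl l) u

/-- The ratio `q / p` is not real; the sign of `q` is chosen to put it in the upper half plane. -/
theorem exists_oriented_basis {p q : ℂ} (h : LinearIndependent ℝ ![p, q]) :
    ∃ q' ζ : ℂ, 0 < ζ.im ∧ q' = ζ * p ∧
      AddSubgroup.closure {p, q} = AddSubgroup.closure {p, q'} := by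
  rw [LinearIndependent.pair_iff] at h
  have hp : p ≠ 0 := by
    rintro rfl
    simpa using h 1 0 (by simp)
  have him : (q / p).im ≠ 0 := by
    intro h0
    have h1 : (((q / p).re : ℝ) : ℂ) = q / p := Complex.ext (by simp) (by simp [h0])
    have := h (q / p).re (-1) (by
      rw [Complex.real_smul, h1]; field_simp; simp)
    simp at this
  rcases lt_or_gt_of_ne him with h' | h'
  · refine ⟨-q, -(q / p), by simpa using h', by field_simp, ?_⟩
    ext z
    rw [AddSubgroup.mem_closure_pair, AddSubgroup.mem_closure_pair]
    exact exists_congr fun m => ⟨fun ⟨n, hn⟩ => ⟨-n, by simpa using hn⟩,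
      fun ⟨n, hn⟩ => ⟨-n, by simpa using hn⟩⟩
  · exact ⟨q, q / p, h', by field_simp, rfl⟩

variable {S} in
-- The generators of the elliptic factors, pulled back by `F`, are lattice vectors; their integral
-- coordinates in the symplectic basis are the columns of `R`.
theorem FibreCompletelySplit.exists_splits {u : CSpace r} (hu : u ∈ S.C)
    (h : S.FibreCompletelySplit u) : ∃ R, S.Splits R u := by
  obtain ⟨F, p, q, hli, hlat⟩ := h
  choose q' ζ hζ hq' hcl using fun l => exists_oriented_basis (hli l)
  simp only [hcl] at hlat
  have hP : ∀ l, ∃ n, periodVector S.d (S.τ u) n = F.symm (Pi.single l (p l)) := fun l =>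
    (hlat _).2 fun i => by
      rw [LinearEquiv.apply_symm_apply]
      by_cases hi : i = l
      · subst hi
        simpa using AddSubgroup.subset_closure (by simp)
      · rw [Pi.single_eq_of_ne hi]; exact zero_mem _
  have hQ : ∀ l, ∃ n, periodVector S.d (S.τ u) n = F.symm (Pi.single l (q' l)) := fun l =>
    (hlat _).2 fun i => by
      rw [LinearEquiv.apply_symm_apply]
      by_cases hi : i = l
      · subst hi
        simpa using AddSubgroup.subset_closure (by simp)
      · rw [Pi.single_eq_of_ne hi]; exact zero_mem _
  choose m hm using hP
  choose n hn using hQ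
  set R : Matrix (Fin r ⊕ Fin r) (Fin r ⊕ Fin r) ℤ :=
    Matrix.of fun i k => Sum.elim (fun l => m l i) (fun l => n l i) k with hR
  have hRl : ∀ l, S.column R (Sum.inl l) u = F.symm (Pi.single l (p l)) := hm
  have hRr : ∀ l, S.column R (Sum.inr l) u = F.symm (Pi.single l (q' l)) := hn
  -- The generators span the whole lattice, so each symplectic basis vector is an integral
  -- combination of them. This yields an integral inverse of `R`.
  have hinv : ∀ k, ∃ c : Fin r ⊕ Fin r → ℤ, R *ᵥ c = Pi.single k 1 := by
    intro k
    have h1 := (hlat (periodVector S.d (S.τ u) (Pi.single k 1))).1 ⟨_, rfl⟩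
    simp only [AddSubgroup.mem_closure_pair] at h1
    choose a b hab using h1
    refine ⟨Sum.elim a b, ?_⟩
    have h2 : realPeriod S.d (S.τ u) (R.map (Int.cast : ℤ → ℝ) *ᵥ
        fun k => ((Sum.elim a b k : ℤ) : ℝ)) = periodVector S.d (S.τ u) (Pi.single k 1) := by
      rw [realPeriod_mulVec, Fintype.sum_sum_type]
      simp only [hRl, hRr, Sum.elim_inl, Sum.elim_inr, ← map_smul, ← map_sum, ← map_add]
      rw [LinearEquiv.symm_apply_eq]
      ext i
      rw [← hab i]
      simp [Finset.sum_apply, Pi.single_apply]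
    rw [← realPeriod_intCast] at h2
    have h3 : R.map (Int.cast : ℤ → ℝ) *ᵥ (fun k => ((Sum.elim a b k : ℤ) : ℝ)) -
        (fun i => ((Pi.single k 1 : Fin r ⊕ Fin r → ℤ) i : ℝ)) = 0 := by
      refine eq_zero_of_realPeriod_eq_zero S.d_pos (S.τ_pos u hu) ?_
      rw [sub_eq_add_neg, realPeriod_add, h2, ← realPeriod_add, add_neg_cancel]
      ext i
      simp [realPeriod_apply]
    ext i
    have h4 := congrFun h3 i
    rw [Pi.sub_apply, Pi.zero_apply, sub_eq_zero] at h4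
    have h5 : (((R *ᵥ Sum.elim a b) i : ℤ) : ℝ) =
        ((Pi.single k 1 : Fin r ⊕ Fin r → ℤ) i : ℝ) := by
      rw [← h4]
      simp [Matrix.mulVec, dotProduct]
    exact_mod_cast h5
  choose c hc using hinv
  refine ⟨R, ?_, fun l => ⟨ζ l, hζ l, ?_⟩⟩
  · have : R * Matrix.of (fun i k => c k i) = 1 := by
      ext i k
      have := congrFun (hc k) i
      rw [Matrix.one_apply, Matrix.mul_apply]
      rw [Pi.single_apply] at this
      exact this
    exact (Matrix.isUnit_iff_isUnit_det _).1 (IsUnit.of_mul_eq_one _ this)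
  · rw [hRl, hRr, ← map_smul, hq' l]
    congr 1
    ext i
    by_cases hi : i = l
    · subst hi; simp
    · simp [hi]

theorem differentiableAt_column (R : Matrix (Fin r ⊕ Fin r) (Fin r ⊕ Fin r) ℤ)
    (k : Fin r ⊕ Fin r) {u : CSpace r} (hu : u ∈ S.C) : DifferentiableAt ℂ (S.column R k) u :=
  S.differentiableAt_periodSection _ hu

theorem isPreconnected_C : IsPreconnected S.C := by
  have := S.contractible_C
  exact isPreconnected_iff_preconnectedSpace.2 inferInstance

theorem nonempty_C : S.C.Nonempty := by
  have := S.contractible_C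
  exact nonempty_coe_sort.1 inferInstance

variable {S} in
theorem column_ne_zero {R : Matrix (Fin r ⊕ Fin r) (Fin r ⊕ Fin r) ℤ}
    (hR : IsUnit R.det) {u : CSpace r} (hu : u ∈ S.C) (k : Fin r ⊕ Fin r) :
    S.column R k u ≠ 0 := by
  intro h
  have := eq_zero_of_sum_smul_column hR hu (y := Pi.single k 1) (by
    rw [Finset.sum_eq_single k] <;> simp +contextual [h])
  simpa using congrFun this k

variable {S} in
-- A real ratio would be a real linear relation between two periods.
theorem im_ne_zero_of_column_eq_smul {R : Matrix (Fin r ⊕ Fin r) (Fin r ⊕ Fin r) ℤ}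
    (hR : IsUnit R.det) {u : CSpace r} (hu : u ∈ S.C) {l : Fin r} {ζ : ℂ}
    (h : S.column R (Sum.inr l) u = ζ • S.column R (Sum.inl l) u) : ζ.im ≠ 0 := by
  intro h0
  have h1 : ((ζ.re : ℝ) : ℂ) = ζ := Complex.ext (by simp) (by simp [h0])
  have := eq_zero_of_sum_smul_column hR hu
    (y := Pi.single (Sum.inr l) (1 : ℝ) - Pi.single (Sum.inl l) ζ.re) (by
    simp only [Pi.sub_apply, Complex.ofReal_sub, sub_smul, Finset.sum_sub_distrib]
    rw [Finset.sum_eq_single (Sum.inr l), Finset.sum_eq_single (Sum.inl l)]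
    · simp [h, h1]
    all_goals simp +contextual)
  simpa using congrFun this (Sum.inr l)

/-- If the generic fibre is completely split, there is a homology basis in which the second half
of the columns of the period matrix is proportional to the first half, over all of `C`. -/
theorem CompletelySplit.exists_basis (hS : S.CompletelySplit) :
    ∃ R : Matrix (Fin r ⊕ Fin r) (Fin r ⊕ Fin r) ℤ, IsUnit R.det ∧ (∃ u ∈ S.C, S.Splits R u) ∧
      ∀ u ∈ S.C, ∀ l, ∃ ζ : ℂ, S.column R (Sum.inr l) u = ζ • S.column R (Sum.inl l) u := by
  -- There are countably many integral matrices, and the nonempty open set `C` is not meagre.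
  obtain ⟨R, hR⟩ : ∃ R, ¬ IsMeagre {u | u ∈ S.C ∧ S.Splits R u} := by
    by_contra! hcon
    refine not_isMeagre_of_isOpen S.isOpen_C S.nonempty_C ?_
    have : Countable (Matrix (Fin r ⊕ Fin r) (Fin r ⊕ Fin r) ℤ) :=
      inferInstanceAs (Countable (Fin r ⊕ Fin r → Fin r ⊕ Fin r → ℤ))
    refine ((isMeagre_iUnion hcon).union hS).mono fun u hu => ?_
    by_cases h : S.FibreCompletelySplit u
    · obtain ⟨R, hR⟩ := h.exists_splits hu
      exact Or.inl (mem_iUnion.2 ⟨R, hu, hR⟩)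
    · exact Or.inr ⟨hu, h⟩
  have hint : (interior (closure {u | u ∈ S.C ∧ S.Splits R u})).Nonempty := by
    rw [nonempty_iff_ne_empty]
    exact fun h => hR (IsNowhereDense.isMeagre h)
  obtain ⟨u₁, hu₁⟩ := hint
  obtain ⟨u₀, hu₀, hu₀C, hu₀R⟩ := mem_closure_iff.1 (interior_subset hu₁) _ isOpen_interior hu₁
  refine ⟨R, hu₀R.1, ⟨u₀, hu₀C, hu₀R⟩, fun u hu l => ?_⟩
  -- The points split by `R` are dense near `u₀`, and the minors vanish at them; by continuity they
  -- vanish near `u₀`, and then on `C` by the identity theorem.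
  have hminor : ∀ i j, S.column R (Sum.inr l) u i * S.column R (Sum.inl l) u j -
      S.column R (Sum.inr l) u j * S.column R (Sum.inl l) u i = 0 := by
    intro i j
    set f : CSpace r → ℂ := fun u => S.column R (Sum.inr l) u i * S.column R (Sum.inl l) u j -
      S.column R (Sum.inr l) u j * S.column R (Sum.inl l) u i with hf
    have hd : DifferentiableOn ℂ f S.C := fun u hu => by
      have h1 := differentiableAt_pi.1 (S.differentiableAt_column R (Sum.inr l) hu)
      have h2 := differentiableAt_pi.1 (S.differentiableAt_column R (Sum.inl l) hu)
      exact (((h1 i).mul (h2 j)).sub ((h1 j).mul (h2 i))).differentiableWithinAt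
    refine hd.eqOn_zero_of_isPreconnected S.isOpen_C S.isPreconnected_C hu₀C ?_ u hu
    filter_upwards [(isOpen_interior.inter S.isOpen_C).mem_nhds ⟨hu₀, hu₀C⟩] with v hv
    by_contra hne
    have hopen : IsOpen (S.C ∩ f ⁻¹' {0}ᶜ) :=
      hd.continuousOn.isOpen_inter_preimage S.isOpen_C isOpen_compl_singleton
    obtain ⟨w, ⟨_, hw⟩, hwC, hwR⟩ := mem_closure_iff.1 (interior_subset hv.1) _ hopen ⟨hv.2, hne⟩
    obtain ⟨ζ, -, hζ⟩ := hwR.2 l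
    apply hw
    simp only [hf, mem_singleton_iff, hζ, Pi.smul_apply, smul_eq_mul]
    ring
  obtain ⟨i, hi⟩ := Function.ne_iff.1 (column_ne_zero hu₀R.1 hu (Sum.inl l))
  refine ⟨S.column R (Sum.inr l) u i / S.column R (Sum.inl l) u i, ?_⟩
  ext j
  have h := hminor i j
  rw [Pi.zero_apply] at hi
  rw [Pi.smul_apply, smul_eq_mul]
  field_simp
  linear_combination -h

variable {S} in
/-- If the generic fibre is completely split, so are all fibres, in a constant homology basis and
with holomorphic moduli. -/
structure Splitting (S : LocalSK r) where
  R : Matrix (Fin r ⊕ Fin r) (Fin r ⊕ Fin r) ℤ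
  R_unit : IsUnit R.det
  Z : Fin r → CSpace r → ℂ
  Z_holo : ∀ l, DifferentiableOn ℂ (Z l) S.C
  Z_pos : ∀ l, ∀ u ∈ S.C, 0 < (Z l u).im
  column_inr : ∀ u ∈ S.C, ∀ l, S.column R (Sum.inr l) u = Z l u • S.column R (Sum.inl l) u

/-- `Z` is locally a quotient of components of two columns, hence holomorphic. Its imaginary part
has no zero on the connected set `C` and is positive at a point split by `R`. -/
theorem CompletelySplit.nonempty_splitting (hS : S.CompletelySplit) : Nonempty S.Splitting := by
  obtain ⟨R, hR, ⟨u₀, hu₀, hs⟩, hcol⟩ := hS.exists_basis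
  choose! Z hZ using hcol
  have hZh : ∀ l, DifferentiableOn ℂ (fun u => Z u l) S.C := by
    intro l u hu
    obtain ⟨i, hi⟩ := Function.ne_iff.1 (column_ne_zero hR hu (Sum.inl l))
    have h1 := differentiableAt_pi.1 (S.differentiableAt_column R (Sum.inr l) hu) i
    have h2 := differentiableAt_pi.1 (S.differentiableAt_column R (Sum.inl l) hu) i
    refine ((h1.fun_mul (h2.fun_inv hi)).congr_of_eventuallyEq ?_).differentiableWithinAt
    filter_upwards [S.isOpen_C.mem_nhds hu, h2.continuousAt.eventually_ne hi] with v hv hvi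
    rw [hZ v hv l, Pi.smul_apply, smul_eq_mul, mul_inv_cancel_right₀ hvi]
  refine ⟨⟨R, hR, fun l u => Z u l, hZh, fun l u hu => ?_, hZ⟩⟩
  obtain ⟨ζ, hζ, h0⟩ := hs.2 l
  have hZ0 : Z u₀ l = ζ := by
    have := hZ u₀ hu₀ l
    rw [h0] at this
    exact (smul_left_injective ℂ (column_ne_zero hR hu₀ _) this).symm
  by_contra hneg
  have hc : ContinuousOn (fun u => (Z u l).im) S.C :=
    Complex.continuous_im.comp_continuousOn (hZh l).continuousOn
  obtain ⟨w, hw, hw0⟩ := S.isPreconnected_C.intermediate_value hu hu₀ hc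
    (show (0 : ℝ) ∈ Icc _ _ from ⟨not_lt.1 hneg, by rw [hZ0]; exact hζ.le⟩)
  exact im_ne_zero_of_column_eq_smul hR hw (hZ w hw l) hw0

namespace Splitting

variable {S} (T : S.Splitting)

/-- The first half of the columns of the split period matrix. -/
def block (u : CSpace r) : Matrix (Fin r) (Fin r) ℂ :=
  Matrix.of fun i l => S.column T.R (Sum.inl l) u i

theorem block_apply (u : CSpace r) (i l : Fin r) :
    T.block u i l = S.column T.R (Sum.inl l) u i := rfl

theorem block_mulVec (u : CSpace r) (c : CSpace r) :
    T.block u *ᵥ c = ∑ l, c l • S.column T.R (Sum.inl l) u := by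
  ext i
  simp only [Matrix.mulVec, dotProduct, Finset.sum_apply, Pi.smul_apply, smul_eq_mul, block_apply]
  exact Finset.sum_congr rfl fun k _ => mul_comm _ _

/-- All `2r` columns span `ℂ^r` over `ℝ`, and the second half consists of complex multiples of the
first, so the first half spans over `ℂ`. -/
theorem isUnit_block {u : CSpace r} (hu : u ∈ S.C) : IsUnit (T.block u).det := by
  rw [← Matrix.isUnit_iff_isUnit_det, ← Matrix.mulVec_surjective_iff_isUnit]
  intro z
  obtain ⟨y, hy⟩ := exists_sum_smul_column T.R_unit hu z
  refine ⟨fun l => y (Sum.inl l) + y (Sum.inr l) * T.Z l u, ?_⟩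
  rw [← hy, block_mulVec, Fintype.sum_sum_type, ← Finset.sum_add_distrib]
  refine Finset.sum_congr rfl fun l _ => ?_
  rw [T.column_inr u hu l, add_smul, mul_smul]

/-- The change of basis to the coordinates of the elliptic factors. -/
noncomputable def G (u : CSpace r) : Matrix (Fin r) (Fin r) ℂ := (T.block u)⁻¹

theorem G_mul_block {u : CSpace r} (hu : u ∈ S.C) : T.G u * T.block u = 1 :=
  Matrix.nonsing_inv_mul _ (T.isUnit_block hu)

theorem block_mul_G {u : CSpace r} (hu : u ∈ S.C) : T.block u * T.G u = 1 :=
  Matrix.mul_nonsing_inv _ (T.isUnit_block hu)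

theorem period_split {u : CSpace r} (hu : u ∈ S.C) :
    T.G u * S.period u * T.R.map (Int.cast : ℤ → ℂ) =
      Matrix.fromCols 1 (Matrix.diagonal fun l => T.Z l u) := by
  have h1 : S.period u * T.R.map (Int.cast : ℤ → ℂ) =
      Matrix.fromCols (T.block u) (T.block u * Matrix.diagonal fun l => T.Z l u) := by
    ext i k
    rw [period_mul_apply]
    rcases k with l | l
    · rfl
    · rw [T.column_inr u hu, Matrix.fromCols_apply_inr, Matrix.mul_diagonal, Pi.smul_apply,
        smul_eq_mul, mul_comm]
      rfl
  rw [Matrix.mul_assoc, h1, Matrix.mul_fromCols, ← Matrix.mul_assoc, T.G_mul_block hu,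
    Matrix.one_mul]

theorem differentiableAt_det {E ι : Type*} [NormedAddCommGroup E] [NormedSpace ℂ E] [Fintype ι]
    [DecidableEq ι] {M : E → Matrix ι ι ℂ} {x : E}
    (h : ∀ i j, DifferentiableAt ℂ (fun x => M x i j) x) :
    DifferentiableAt ℂ (fun x => (M x).det) x := by
  simp only [Matrix.det_apply']
  refine DifferentiableAt.fun_sum fun σ _ => (differentiableAt_const _).mul ?_
  exact (HasFDerivAt.finsetProd fun i _ => (h (σ i) i).hasFDerivAt).differentiableAt

theorem differentiableAt_inv_apply {E ι : Type*} [NormedAddCommGroup E] [NormedSpace ℂ E]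
    [Fintype ι] [DecidableEq ι] {M : E → Matrix ι ι ℂ} {x : E}
    (h : ∀ i j, DifferentiableAt ℂ (fun x => M x i j) x) (hx : IsUnit (M x).det) (i j : ι) :
    DifferentiableAt ℂ (fun x => (M x)⁻¹ i j) x := by
  simp only [Matrix.inv_def, Matrix.smul_apply, Ring.inverse_eq_inv', smul_eq_mul,
    Matrix.adjugate_apply]
  refine ((differentiableAt_det h).inv hx.ne_zero).mul (differentiableAt_det fun k l => ?_)
  by_cases hk : k = j
  · subst hk
    simp
  · simpa [Matrix.updateRow_ne hk] using h k l

theorem differentiableAt_G {u : CSpace r} (hu : u ∈ S.C) (i j : Fin r) :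
    DifferentiableAt ℂ (fun u => T.G u i j) u :=
  differentiableAt_inv_apply (fun i l => differentiableAt_pi.1
    (S.differentiableAt_column T.R (Sum.inl l) hu) i) (T.isUnit_block hu) i j

end Splitting

variable {S} in
/-- The splitting of the fibres underlying a normal form. -/
noncomputable def _root_.SplitNormalForm.toSplitting (N : SplitNormalForm S) : S.Splitting where
  R := N.R
  R_unit := N.R_unit
  Z := N.Z
  Z_holo := N.Z_holo
  Z_pos := N.Z_pos
  column_inr := by
    intro u hu l
    have h := N.period_split u hu
    rw [Matrix.mul_assoc] at h
    have hk : ∀ k, N.G u *ᵥ S.column N.R k u = fun i =>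
        (Matrix.fromCols (1 : Matrix (Fin r) (Fin r) ℂ) (Matrix.diagonal fun l => N.Z l u)) i k := by
      intro k
      rw [← h]
      rfl
    have h1 : N.G u * (Matrix.of fun i l => S.column N.R (Sum.inl l) u i) = 1 := by
      ext i l
      exact congrFun (hk (Sum.inl l)) i
    have hinj := Matrix.mulVec_injective_of_isUnit (IsUnit.of_mul_eq_one _ h1)
    apply hinj
    rw [Matrix.mulVec_smul, hk, hk]
    ext i
    by_cases hi : i = l
    · subst hi; simp
    · simp [hi]

end LocalSK

end Splitting

/-! ### The normal form -/

section NormalForm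

set_option maxSynthPendingDepth 3

namespace LocalSK

variable {r : ℕ} (S : LocalSK r)

/-- The one-form on the base obtained by contracting `L` with a lattice vector. -/
noncomputable def periodForm (n : Fin r ⊕ Fin r → ℤ) (u : CSpace r) : CSpace r →L[ℂ] ℂ :=
  (S.mixed u).flip (S.periodSection n u)

theorem periodForm_apply (n : Fin r ⊕ Fin r → ℤ) (u v : CSpace r) :
    S.periodForm n u v = S.mixed u v (S.periodSection n u) := rfl

theorem differentiableAt_periodForm (n : Fin r ⊕ Fin r → ℤ) {u : CSpace r} (hu : u ∈ S.C) :
    DifferentiableAt ℂ (S.periodForm n) u ∧ ∀ v w, fderiv ℂ (S.periodForm n) u v w =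
      fderiv ℂ S.mixed u v w (S.periodSection n u) +
        S.mixed u w (fderiv ℂ (S.periodSection n) u v) := by
  have h1 : HasFDerivAt (fun u => (S.mixed u).flip) _ u :=
    (ContinuousLinearMap.flipₗᵢ ℂ (CSpace r) (CSpace r) ℂ).toContinuousLinearEquiv
      |>.toContinuousLinearMap.hasFDerivAt.comp u (S.differentiableAt_mixed hu).hasFDerivAt
  have h2 := h1.clm_apply (S.differentiableAt_periodSection n hu).hasFDerivAt
  refine ⟨h2.differentiableAt, fun v w => ?_⟩
  have h3 : fderiv ℂ (S.periodForm n) u = _ := h2.fderiv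
  rw [h3]
  simp [add_comm]

/-- The derivative has one term from `mixed` and one from the moving lattice vector; `mixed_closed`
and `mixed_fderiv_periodSection` make each of them symmetric. -/
theorem periodForm_closed (n : Fin r ⊕ Fin r → ℤ) {u : CSpace r} (hu : u ∈ S.C) (v w : CSpace r) :
    fderiv ℂ (S.periodForm n) u v w = fderiv ℂ (S.periodForm n) u w v := by
  rw [(S.differentiableAt_periodForm n hu).2, (S.differentiableAt_periodForm n hu).2,
    S.mixed_closed hu v w, S.mixed_fderiv_periodSection hu n w v]

namespace Splitting

variable {S} (T : S.Splitting)

/-- The one-forms `da_ℓ`. -/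
noncomputable def form (l : Fin r) : CSpace r → CSpace r →L[ℂ] ℂ :=
  S.periodForm fun i => T.R i (Sum.inl l)

theorem form_apply (l : Fin r) (u v : CSpace r) :
    T.form l u v = S.mixed u v (S.column T.R (Sum.inl l) u) := rfl

theorem differentiableAt_form (l : Fin r) {u : CSpace r} (hu : u ∈ S.C) :
    DifferentiableAt ℂ (T.form l) u := (S.differentiableAt_periodForm _ hu).1

theorem form_closed (l : Fin r) {u : CSpace r} (hu : u ∈ S.C) (v w : CSpace r) :
    fderiv ℂ (T.form l) u v w = fderiv ℂ (T.form l) u w v := S.periodForm_closed _ hu v w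

/-- Contracting `L` with the second period of the factor gives `Z^ℓ` times `form l`. Both this and
`form l` are closed, which leaves `dZ^ℓ ∧ da_ℓ = 0`. -/
theorem fderiv_Z_wedge_form (l : Fin r) {u : CSpace r} (hu : u ∈ S.C) (v w : CSpace r) :
    fderiv ℂ (T.Z l) u v * T.form l u w = fderiv ℂ (T.Z l) u w * T.form l u v := by
  have hZ := (T.Z_holo l).differentiableAt (S.isOpen_C.mem_nhds hu)
  have h1 := hZ.hasFDerivAt.smul (T.differentiableAt_form l hu).hasFDerivAt
  have h2 : HasFDerivAt (S.periodForm fun i => T.R i (Sum.inr l)) _ u :=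
    h1.congr_of_eventuallyEq (by
      filter_upwards [S.isOpen_C.mem_nhds hu] with p hp
      ext v
      have := T.column_inr p hp l
      rw [Pi.smul_apply', smul_apply, periodForm_apply, form_apply,
        ← map_smul, ← this]
      rfl)
  have h3 := S.periodForm_closed (fun i => T.R i (Sum.inr l)) hu v w
  rw [h2.fderiv] at h3
  simp only [add_apply, smul_apply, ContinuousLinearMap.smulRight_apply, smul_eq_mul] at h3
  rw [T.form_closed l hu v w] at h3
  exact add_left_cancel h3

theorem mixed_block_mulVec (u v c : CSpace r) :
    S.mixed u v (T.block u *ᵥ c) = ∑ l, T.form l u v * c l := by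
  rw [block_mulVec, map_sum]
  refine Finset.sum_congr rfl fun l _ => ?_
  rw [map_smul, smul_eq_mul, mul_comm, form_apply]

/-- A relation with coefficients `c` gives a vertical vector `T.block u *ᵥ c` in the kernel of the
nondegenerate mixed component. -/
theorem linearIndependent_form {u : CSpace r} (hu : u ∈ S.C) :
    LinearIndependent ℂ fun l => T.form l u := by
  rw [Fintype.linearIndependent_iff]
  intro c hc
  have h0 : T.block u *ᵥ c = 0 := S.eq_zero_of_mixed_eq_zero hu fun v => by
    rw [mixed_block_mulVec]
    have := congrArg (fun A : CSpace r →L[ℂ] ℂ => A v) hc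
    simpa [mul_comm] using this
  exact congrFun (Matrix.eq_zero_of_mulVec_eq_zero (T.isUnit_block hu).ne_zero h0)

theorem form_ne_zero (l : Fin r) {u : CSpace r} (hu : u ∈ S.C) : T.form l u ≠ 0 :=
  (T.linearIndependent_form hu).ne_zero l

/-- The matrix of the forms `da_ℓ`. -/
noncomputable def formMatrix (u : CSpace r) : Matrix (Fin r) (Fin r) ℂ :=
  Matrix.of fun l k => T.form l u (Pi.single k 1)

theorem formMatrix_mulVec (u v : CSpace r) (l : Fin r) :
    (T.formMatrix u *ᵥ v) l = T.form l u v := by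
  conv_rhs => rw [pi_eq_sum_univ' v]
  simp [Matrix.mulVec, dotProduct, formMatrix, map_sum, mul_comm]

theorem isUnit_formMatrix {u : CSpace r} (hu : u ∈ S.C) : IsUnit (T.formMatrix u).det := by
  rw [← Matrix.isUnit_iff_isUnit_det, ← Matrix.linearIndependent_rows_iff_isUnit,
    Fintype.linearIndependent_iff]
  intro c hc
  refine Fintype.linearIndependent_iff.1 (T.linearIndependent_form hu) c ?_
  refine ContinuousLinearMap.coe_injective ((Pi.basisFun ℂ (Fin r)).ext fun k => ?_)
  have := congrFun hc k
  simpa [formMatrix, Finset.sum_apply] using this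

/-- The base part of the one-form `ω^ℓ`. -/
noncomputable def baseForm (l : Fin r) (u : CSpace r) : CSpace r →L[ℂ] ℂ :=
  (2⁻¹ : ℂ) • ∑ k, (T.formMatrix u)⁻¹ k l • S.horiz u (Pi.single k 1)

theorem differentiableAt_baseForm (l : Fin r) {u : CSpace r} (hu : u ∈ S.C) :
    DifferentiableAt ℂ (T.baseForm l) u := by
  have hinv : ∀ k, DifferentiableAt ℂ (fun u => (T.formMatrix u)⁻¹ k l) u := fun k =>
    differentiableAt_inv_apply (fun i j =>
      (T.differentiableAt_form i hu).clm_apply (differentiableAt_const _))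
      (T.isUnit_formMatrix hu) k l
  have hN : ∀ k, DifferentiableAt ℂ (fun u => S.horiz u (Pi.single k 1)) u := fun k =>
    (S.differentiableAt_horiz hu).clm_apply (differentiableAt_const _)
  have hs : DifferentiableAt ℂ
      (fun u => ∑ k, (T.formMatrix u)⁻¹ k l • S.horiz u (Pi.single k 1)) u :=
    DifferentiableAt.fun_sum fun k _ => (hinv k).fun_smul (hN k)
  exact hs.const_smul (2⁻¹ : ℂ)

/-- The forms `m^ℓ` are the components of half the horizontal part in the coframe `da_ℓ`;
antisymmetrization restores the factor 2. -/
theorem sum_form_mul_baseForm {u : CSpace r} (hu : u ∈ S.C) (v w : CSpace r) :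
    ∑ l, T.form l u v * T.baseForm l u w = 2⁻¹ * S.horiz u v w := by
  have h : v = (T.formMatrix u)⁻¹ *ᵥ fun l => T.form l u v := by
    have : (fun l => T.form l u v) = T.formMatrix u *ᵥ v :=
      funext fun l => (T.formMatrix_mulVec u v l).symm
    rw [this, Matrix.mulVec_mulVec, Matrix.nonsing_inv_mul _ (T.isUnit_formMatrix hu),
      Matrix.one_mulVec]
  have h2 : S.horiz u v w = ∑ k, v k * S.horiz u (Pi.single k 1) w := by
    conv_lhs => rw [pi_eq_sum_univ' v]
    simp [map_sum]
  have h3 : ∀ k, v k = ∑ l, (T.formMatrix u)⁻¹ k l * T.form l u v := fun k => congrFun h k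
  rw [h2, Finset.mul_sum]
  simp only [baseForm, smul_apply, sum_apply, smul_eq_mul, Finset.mul_sum]
  rw [Finset.sum_comm]
  refine Finset.sum_congr rfl fun k _ => ?_
  conv_rhs => rw [h3 k, Finset.sum_mul, Finset.mul_sum]
  exact Finset.sum_congr rfl fun l _ => by ring

theorem sum_wedge_baseForm {u : CSpace r} (hu : u ∈ S.C) (v w : CSpace r) :
    ∑ l, wedge (T.form l u) (T.baseForm l u) v w = S.horiz u v w := by
  simp only [wedge, Finset.sum_sub_distrib, T.sum_form_mul_baseForm hu]
  rw [S.horiz_swap u w v]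
  ring

/-- The uniformizing coordinate of the `ℓ`-th elliptic factor. -/
noncomputable def coord (l : Fin r) (p : CSpace r × CSpace r) : ℂ := (T.G p.1 *ᵥ p.2) l

theorem differentiableAt_coord (l : Fin r) {p : CSpace r × CSpace r} (hp : p.1 ∈ S.C) :
    DifferentiableAt ℂ (T.coord l) p := by
  unfold coord
  simp only [Matrix.mulVec, dotProduct]
  refine DifferentiableAt.fun_sum fun k _ => DifferentiableAt.fun_mul ?_ (by fun_prop)
  exact DifferentiableAt.fun_comp' p (T.differentiableAt_G hp l k) differentiableAt_fst

/-- The derivative of the identity `z = ∑ w^ℓ(u, z) · column_ℓ(u)`, paired with `v` by the mixed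
component. -/
theorem sum_form_mul_fderiv_coord {u : CSpace r} (hu : u ∈ S.C) (z v : CSpace r)
    (w : CSpace r × CSpace r) :
    ∑ l, T.form l u v * fderiv ℂ (T.coord l) (u, z) w +
      ∑ l, T.coord l (u, z) * S.mixed u v (fderiv ℂ (S.column T.R (Sum.inl l)) u w.1) =
        S.mixed u v w.2 := by
  have h1 : HasFDerivAt (fun p : CSpace r × CSpace r =>
      ∑ l, T.coord l p • S.column T.R (Sum.inl l) p.1) _ (u, z) :=
    HasFDerivAt.fun_sum fun l _ =>
      (T.differentiableAt_coord l (p := (u, z)) hu).hasFDerivAt.fun_smul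
        (HasFDerivAt.comp (g := S.column T.R (Sum.inl l)) (u, z)
          (S.differentiableAt_column T.R (Sum.inl l) hu).hasFDerivAt hasFDerivAt_fst)
  have h2 : HasFDerivAt (fun p : CSpace r × CSpace r =>
      ∑ l, T.coord l p • S.column T.R (Sum.inl l) p.1)
      (ContinuousLinearMap.snd ℂ (CSpace r) (CSpace r)) (u, z) := by
    refine hasFDerivAt_snd.congr_of_eventuallyEq ?_
    filter_upwards [S.isOpen_total.mem_nhds (show (u, z) ∈ _ from ⟨hu, mem_univ _⟩)] with p hp
    have := T.block_mulVec p.1 (T.G p.1 *ᵥ p.2)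
    rw [Matrix.mulVec_mulVec, T.block_mul_G hp.1, Matrix.one_mulVec] at this
    exact this.symm
  have h3 := congrArg (fun A => S.mixed u v (A w)) (h1.unique h2)
  simp only [sum_apply, map_sum, add_apply,
    smul_apply, ContinuousLinearMap.smulRight_apply, map_add, map_smul,
    smul_eq_mul, Finset.sum_add_distrib, ContinuousLinearMap.comp_apply,
    ContinuousLinearMap.coe_fst', ContinuousLinearMap.coe_snd'] at h3
  rw [← h3, add_comm]
  congr 1
  exact Finset.sum_congr rfl fun l _ => by rw [form_apply, mul_comm]

/-- The terms with derivatives of the periods cancel under antisymmetrization, by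
`mixed_fderiv_periodSection`. -/
theorem sum_wedge_coord {u : CSpace r} (hu : u ∈ S.C) (z : CSpace r) (v w : CSpace r × CSpace r) :
    ∑ l, (T.form l u v.1 * fderiv ℂ (T.coord l) (u, z) w -
      T.form l u w.1 * fderiv ℂ (T.coord l) (u, z) v) = S.mixed u v.1 w.2 - S.mixed u w.1 v.2 := by
  have h1 := T.sum_form_mul_fderiv_coord hu z v.1 w
  have h2 := T.sum_form_mul_fderiv_coord hu z w.1 v
  have h3 : ∑ l, T.coord l (u, z) * S.mixed u v.1 (fderiv ℂ (S.column T.R (Sum.inl l)) u w.1) =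
      ∑ l, T.coord l (u, z) * S.mixed u w.1 (fderiv ℂ (S.column T.R (Sum.inl l)) u v.1) :=
    Finset.sum_congr rfl fun l _ => by
      rw [show S.column T.R (Sum.inl l) = S.periodSection _ from rfl,
        S.mixed_fderiv_periodSection hu]
  rw [Finset.sum_sub_distrib]
  linear_combination h1 - h2 - h3

/-- The chain rule for `x(Z^ℓ(u), w^ℓ(u, z))`. The coefficient `c` of `dZ^ℓ` need not be known,
since that term is annihilated by `da_ℓ`. -/
theorem fderiv_weierstrassX_coord (l : Fin r) {u : CSpace r} (hu : u ∈ S.C) (z : CSpace r)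
    (hw : T.coord l (u, z) ∉ ellLattice (T.Z l u)) : ∃ c : ℂ, ∀ v : CSpace r × CSpace r,
      fderiv ℂ (fun p : CSpace r × CSpace r => weierstrassX (T.Z l p.1) (T.coord l p)) (u, z) v =
        c * fderiv ℂ (T.Z l) u v.1 +
          weierstrassY (T.Z l u) (T.coord l (u, z)) * fderiv ℂ (T.coord l) (u, z) v := by
  have hZ := (T.Z_holo l).differentiableAt (S.isOpen_C.mem_nhds hu)
  have hX := (differentiableAt_weierstrassX (T.Z_pos l u hu) hw).hasFDerivAt
  have h1 : HasFDerivAt (fun p : CSpace r × CSpace r => (T.Z l p.1, T.coord l p)) _ (u, z) :=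
    (HasFDerivAt.comp (g := T.Z l) (u, z) hZ.hasFDerivAt hasFDerivAt_fst).prodMk
      (T.differentiableAt_coord l (p := (u, z)) hu).hasFDerivAt
  have h2 := HasFDerivAt.comp (u, z) hX h1
  set F := fderiv ℂ (fun q : ℂ × ℂ => weierstrassX q.1 q.2) (T.Z l u, T.coord l (u, z)) with hF
  have h3 : F (0, 1) = weierstrassY (T.Z l u) (T.coord l (u, z)) := by
    have h4 := HasFDerivAt.comp (f := fun w : ℂ => (T.Z l u, w)) _ hX (hasFDerivAt_prodMk_right _ _)
    have h5 := (isWeierstrassUniformization_ellLattice (T.Z_pos l u hu)).hasDerivAt_x _ hw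
    exact h4.hasDerivAt.unique h5
  refine ⟨F (1, 0), fun v => ?_⟩
  have h6 : fderiv ℂ (fun p : CSpace r × CSpace r => weierstrassX (T.Z l p.1) (T.coord l p))
      (u, z) = _ := h2.fderiv
  rw [h6, ← h3]
  change F (fderiv ℂ (T.Z l) u v.1, fderiv ℂ (T.coord l) (u, z) v) = _
  have : ∀ a b : ℂ, F (a, b) = F (1, 0) * a + F (0, 1) * b := by
    intro a b
    have : (a, b) = a • ((1, 0) : ℂ × ℂ) + b • ((0, 1) : ℂ × ℂ) := by simp
    rw [this, map_add, map_smul, map_smul, smul_eq_mul, smul_eq_mul]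
    ring
  exact this _ _

theorem exists_base_primitive {u₀ : CSpace r} (hu₀ : u₀ ∈ S.C) :
    ∃ U : Set (CSpace r), IsOpen U ∧ u₀ ∈ U ∧ U ⊆ S.C ∧
    ∃ b : Fin r → CSpace r → ℂ, (∀ k, DifferentiableOn ℂ (b k) U) ∧
      ∀ u ∈ U, ∀ v v' : CSpace r, S.horiz u v v' =
        ∑ k, wedge (fderiv ℂ (b k) u) (ContinuousLinearMap.proj k) v v' := by
  obtain ⟨ε, hε, hb⟩ := Metric.isOpen_iff.1 S.isOpen_C u₀ hu₀
  obtain ⟨b, hbd⟩ := exists_primitive_of_closed_two_form (N := S.horiz) (x₀ := u₀) (R := ε)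
    (fun u hu => (S.differentiableAt_horiz (hb hu)).differentiableWithinAt)
    (fun u _ => S.horiz_swap u) (fun u hu => S.horiz_closed (hb hu))
  refine ⟨Metric.ball u₀ ε, Metric.isOpen_ball, Metric.mem_ball_self hε, hb,
    fun k u => b u (Pi.single k 1), fun k u hu =>
      ((hbd u hu).1.clm_apply (differentiableAt_const _)).differentiableWithinAt,
    fun u hu v v' => ?_⟩
  have hk : ∀ k v, fderiv ℂ (fun u => b u (Pi.single k 1)) u v =
      fderiv ℂ b u v (Pi.single k 1) := by
    intro k v
    rw [((hbd u hu).1.hasFDerivAt.clm_apply (hasFDerivAt_const _ u)).fderiv]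
    simp
  have hs : ∀ v w, ∑ k, fderiv ℂ b u v (Pi.single k 1) * w k = fderiv ℂ b u v w := by
    intro v w
    conv_rhs => rw [pi_eq_sum_univ' w]
    simp [map_sum, mul_comm]
  simp only [wedge, hk, ContinuousLinearMap.proj_apply, Finset.sum_sub_distrib, hs]
  exact ((hbd u hu).2 v v').symm

/-- The normal form of a split geometry, given primitives of the one-forms `da_ℓ`. -/
noncomputable def normalForm (a : Fin r → CSpace r → ℂ)
    (ha : ∀ l, ∀ u ∈ S.C, HasFDerivAt (a l) (T.form l u) u) : SplitNormalForm S :=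
  have hZd : ∀ l, ∀ u ∈ S.C, DifferentiableAt ℂ (T.Z l) u := fun l u hu =>
    (T.Z_holo l).differentiableAt (S.isOpen_C.mem_nhds hu)
  have haC : ∀ l, DifferentiableOn ℂ (a l) S.C := fun l u hu =>
    (ha l u hu).differentiableAt.differentiableWithinAt
  have hZdep : ∀ l, LocallyFunctionOf S.C (T.Z l) (a l) := fun l =>
    locallyFunctionOf_of_wedge_eq_zero S.isOpen_C (T.Z_holo l) (haC l)
      (fun u hu => by rw [(ha l u hu).fderiv]; exact T.form_ne_zero l hu)
      (fun u hu v w => by rw [(ha l u hu).fderiv]; exact T.fderiv_Z_wedge_form l hu v w)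
  { R := T.R
    R_unit := T.R_unit
    G := T.G
    G_holo := fun i j u hu => (T.differentiableAt_G hu i j).differentiableWithinAt
    Z := T.Z
    Z_holo := T.Z_holo
    Z_pos := T.Z_pos
    period_split := fun u hu => T.period_split hu
    a := a
    a_holo := haC
    a_indep := fun u hu => by
      simp only [(ha _ u hu).fderiv]
      exact T.linearIndependent_form hu
    c₁ := fun l u => weierstrassC₁ (T.Z l u)
    c₀ := fun l u => weierstrassC₀ (T.Z l u)
    c₁_holo := fun l => differentiableOn_weierstrassC₁.comp (T.Z_holo l) (T.Z_pos l)
    c₀_holo := fun l => differentiableOn_weierstrassC₀.comp (T.Z_holo l) (T.Z_pos l)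
    x := fun l u => weierstrassX (T.Z l u)
    y := fun l u => weierstrassY (T.Z l u)
    x_holo := fun l q hq => (DifferentiableAt.fun_comp' q
      (f := fun q : CSpace r × ℂ => (T.Z l q.1, q.2))
      (differentiableAt_weierstrassX (T.Z_pos l q.1 hq.1) hq.2)
      ((DifferentiableAt.fun_comp' q (hZd l q.1 hq.1) differentiableAt_fst).prodMk
        differentiableAt_snd)).differentiableWithinAt
    y_holo := fun l q hq => (DifferentiableAt.fun_comp' q
      (f := fun q : CSpace r × ℂ => (T.Z l q.1, q.2))
      (differentiableAt_weierstrassY (T.Z_pos l q.1 hq.1) hq.2)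
      ((DifferentiableAt.fun_comp' q (hZd l q.1 hq.1) differentiableAt_fst).prodMk
        differentiableAt_snd)).differentiableWithinAt
    curve := fun l u hu => isWeierstrassUniformization_ellLattice (T.Z_pos l u hu)
    c₁_dep := fun l => (hZdep l).comp_left isOpen_im_pos differentiableOn_weierstrassC₁ (T.Z_pos l)
    c₀_dep := fun l => (hZdep l).comp_left isOpen_im_pos differentiableOn_weierstrassC₀ (T.Z_pos l)
    Z_dep := hZdep
    m := T.baseForm
    m_holo := fun l u hu => (T.differentiableAt_baseForm l hu).differentiableWithinAt
    L_eq := by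
      intro u hu z hz v w
      have h1 := S.bil_eq hu z v.1 v.2 w.1 w.2
      rw [bil_apply, ← T.sum_wedge_coord hu z, ← T.sum_wedge_baseForm hu,
        ← Finset.sum_add_distrib] at h1
      refine h1.trans (Finset.sum_congr rfl fun l _ => ?_)
      obtain ⟨c, hc⟩ := T.fderiv_weierstrassX_coord l hu z (hz l).1
      have hy : weierstrassY (T.Z l u) (T.coord l (u, z)) ≠ 0 := (hz l).2
      have hwd := T.fderiv_Z_wedge_form l hu v.1 w.1
      simp only [wedge, (ha l u hu).fderiv, ContinuousLinearMap.comp_apply,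
        ContinuousLinearMap.coe_fst', add_apply,
        smul_apply, smul_eq_mul]
      change _ = T.form l u v.1 * ((weierstrassY (T.Z l u) (T.coord l (u, z)))⁻¹ *
          fderiv ℂ (fun p : CSpace r × CSpace r => weierstrassX (T.Z l p.1) (T.coord l p))
            (u, z) w + T.baseForm l u w.1) -
        T.form l u w.1 * ((weierstrassY (T.Z l u) (T.coord l (u, z)))⁻¹ *
          fderiv ℂ (fun p : CSpace r × CSpace r => weierstrassX (T.Z l p.1) (T.coord l p))
            (u, z) v + T.baseForm l u v.1)
      -- The factor `y` cancels in the `dw^ℓ` terms, and the `dZ^ℓ` terms cancel by `hwd`.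
      rw [hc, hc]
      field_simp
      linear_combination c * hwd
    base_exact := by
      intro u₀ hu₀
      obtain ⟨U, hU, hu₀U, hUC, b, hb, hbe⟩ := exists_base_primitive hu₀
      refine ⟨U, hU, hu₀U, hUC, b, hb, fun u hu v w => ?_⟩
      simp only [(ha _ u (hUC hu)).fderiv]
      rw [T.sum_wedge_baseForm (hUC hu), hbe u hu] }

theorem exists_primitive_form (l : Fin r) :
    ∃ a : CSpace r → ℂ, ∀ u ∈ S.C, HasFDerivAt a (T.form l u) u :=
  exists_primitive_of_closed_of_contractible S.isOpen_C S.contractible_C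
    (fun _ hu => (T.differentiableAt_form l hu).differentiableWithinAt)
    (fun _ hu => T.form_closed l hu)

end Splitting

end LocalSK

end NormalForm

/-! ### Consequences of a scale symmetry -/

section ScaleInvariance

set_option maxSynthPendingDepth 3

/-- Lattice vectors which tend to zero, in a convergent family of period lattices, vanish. -/
theorem eventually_eq_zero_of_tendsto_periodVector {r : ℕ} {d : Fin r → ℕ} (hd : ∀ i, 0 < d i)
    {X : Type*} {F : Filter X} {τ : X → Matrix (Fin r) (Fin r) ℂ} {τ₀ : Matrix (Fin r) (Fin r) ℂ}
    (hτ₀ : (τ₀.map Complex.im).PosDef) (hτ : Tendsto τ F (𝓝 τ₀)) {δ : X → Fin r ⊕ Fin r → ℤ}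
    (h : Tendsto (fun x => periodVector d (τ x) (δ x)) F (𝓝 0)) : ∀ᶠ x in F, δ x = 0 := by
  have him : Continuous fun M : Matrix (Fin r) (Fin r) ℂ => M.map Complex.im :=
    continuous_id.matrix_map Complex.continuous_im
  have hτim : Tendsto (fun x => (τ x).map Complex.im) F (𝓝 (τ₀.map Complex.im)) :=
    (him.tendsto τ₀).comp hτ
  have hinv : Tendsto (fun x => ((τ x).map Complex.im)⁻¹) F (𝓝 (τ₀.map Complex.im)⁻¹) := by
    refine (continuousAt_matrix_inv _ ?_).tendsto.comp hτim
    rw [Ring.inverse_eq_inv']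
    exact continuousAt_inv₀ hτ₀.det_pos.ne'
  have hdet : ∀ᶠ x in F, IsUnit ((τ x).map Complex.im).det := by
    have hc : Continuous fun M : Matrix (Fin r) (Fin r) ℝ => M.det := continuous_id.matrix_det
    exact (((hc.tendsto _).comp hτim).eventually_ne hτ₀.det_pos.ne').mono fun x hx => hx.isUnit
  have hw : Tendsto (fun x => fun i => (periodVector d (τ x) (δ x) i).im) F (𝓝 0) := by
    have hc : Continuous fun z : CSpace r => fun i => (z i).im := by fun_prop
    have h1 := (hc.tendsto 0).comp h
    rwa [show (fun i => ((0 : CSpace r) i).im) = 0 from funext fun _ => Complex.zero_im] at h1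
  have h2 : Tendsto (fun x => ((τ x).map Complex.im)⁻¹ *ᵥ
      fun i => (periodVector d (τ x) (δ x) i).im) F (𝓝 0) := by
    have hc : Continuous fun p : Matrix (Fin r) (Fin r) ℝ × (Fin r → ℝ) => p.1 *ᵥ p.2 :=
      continuous_fst.matrix_mulVec continuous_snd
    have h1 := (hc.tendsto _).comp (hinv.prodMk_nhds hw)
    simpa [Function.comp_def] using h1
  have hcoord : ∀ x, realPeriod d (τ x) (fun i => (δ x i : ℝ)) = periodVector d (τ x) (δ x) :=
    fun x => realPeriod_intCast _ _ _
  -- Applying the inverse of `Im τ` to the imaginary parts recovers these integers; they tend to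
  -- zero, so they are eventually zero.
  have hinr : ∀ᶠ x in F, ∀ j, δ x (Sum.inr j) = 0 := by
    refine eventually_all.2 fun j => ?_
    have h3 := (tendsto_pi_nhds.1 h2 j).eventually (Metric.ball_mem_nhds _ one_pos)
    filter_upwards [h3, hdet] with x hx hdx
    have h4 : (fun i => (periodVector d (τ x) (δ x) i).im) =
        (τ x).map Complex.im *ᵥ fun j => (δ x (Sum.inr j) : ℝ) := by
      ext i
      rw [← hcoord, realPeriod_apply]
      simp [Matrix.mulVec, dotProduct]
    rw [h4, Matrix.mulVec_mulVec, Matrix.nonsing_inv_mul _ hdx, Matrix.one_mulVec] at hx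
    have hx' : |((δ x (Sum.inr j) : ℤ) : ℝ)| < 1 := by simpa using hx
    exact Int.abs_lt_one_iff.1 (by exact_mod_cast hx')
  have hinl : ∀ᶠ x in F, ∀ i, δ x (Sum.inl i) = 0 := by
    refine eventually_all.2 fun i => ?_
    have h3 := (tendsto_pi_nhds.1 h i).eventually (Metric.ball_mem_nhds _ one_pos)
    filter_upwards [h3, hinr] with x hx hr
    rw [← hcoord, realPeriod_apply] at hx
    have hx' : ‖((d i * δ x (Sum.inl i) : ℤ) : ℂ)‖ < 1 := by simpa [hr] using hx
    rw [Complex.norm_intCast] at hx'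
    have h5 : (d i : ℤ) * δ x (Sum.inl i) = 0 := Int.abs_lt_one_iff.1 (by exact_mod_cast hx')
    exact (mul_eq_zero.1 h5).resolve_left (by exact_mod_cast (hd i).ne')
  filter_upwards [hinl, hinr] with x hl hr
  ext (i | i)
  · exact hl i
  · exact hr i

variable {r : ℕ}

/-- The generator of the scaling action, as a linear map. -/
noncomputable def eulerMap (wt : Fin r → ℝ) : CSpace r →L[ℂ] CSpace r :=
  ContinuousLinearMap.pi fun k => (wt k : ℂ) • ContinuousLinearMap.proj k

theorem eulerMap_apply (wt : Fin r → ℝ) (u : CSpace r) (k : Fin r) :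
    eulerMap wt u k = wt k * u k := rfl

/-- The scaling action, as a linear map. -/
noncomputable def scaleMap (wt : Fin r → ℝ) (s : ℂ) : CSpace r →L[ℂ] CSpace r :=
  ContinuousLinearMap.pi fun k => Complex.exp ((wt k : ℂ) * s) • ContinuousLinearMap.proj k

theorem scaleMap_apply (wt : Fin r → ℝ) (s : ℂ) (u : CSpace r) :
    scaleMap wt s u = scalePoint wt s u := rfl

theorem scalePoint_zero (wt : Fin r → ℝ) (u : CSpace r) : scalePoint wt 0 u = u := by
  ext k
  simp [scalePoint]

theorem continuous_scalePoint (wt : Fin r → ℝ) :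
    Continuous fun q : ℂ × CSpace r => scalePoint wt q.1 q.2 := by
  unfold scalePoint
  fun_prop

theorem hasDerivAt_scalePoint (wt : Fin r → ℝ) (u : CSpace r) (s : ℂ) :
    HasDerivAt (fun s => scalePoint wt s u) (eulerMap wt (scalePoint wt s u)) s := by
  rw [hasDerivAt_pi]
  intro k
  have h := (((hasDerivAt_id s).const_mul (wt k : ℂ)).cexp).mul_const (u k)
  refine h.congr_deriv ?_
  rw [eulerMap_apply]
  simp only [scalePoint, id]
  ring

namespace ScaleSymmetry

variable {S : LocalSK r} (A : ScaleSymmetry S)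

theorem dom_mem_nhds {u : CSpace r} (hu : u ∈ S.C) : A.dom ∈ 𝓝 ((0 : ℂ), u) :=
  A.isOpen_dom.mem_nhds (A.zero_mem_dom u hu)

theorem continuousAt_periodSection (n : Fin r ⊕ Fin r → ℤ) {u : CSpace r} (hu : u ∈ S.C) :
    ContinuousAt (S.periodSection n) u := (S.differentiableAt_periodSection n hu).continuousAt

theorem tendsto_scalePoint (u : CSpace r) :
    Tendsto (fun q : ℂ × CSpace r => scalePoint A.wt q.1 q.2) (𝓝 (0, u)) (𝓝 u) := by
  have := (continuous_scalePoint A.wt).tendsto (0, u)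
  rwa [scalePoint_zero] at this

/-- Close to the identity, the scaling action preserves the periods of the fibres. -/
theorem eventually_A_eq_one {u : CSpace r} (hu : u ∈ S.C) :
    ∀ᶠ q in 𝓝 ((0 : ℂ), u), A.A q = 1 ∧ S.τ (scalePoint A.wt q.1 q.2) = S.τ q.2 := by
  have hex : ∀ q, ∃ M : Matrix (Fin r ⊕ Fin r) (Fin r ⊕ Fin r) ℤ, q ∈ A.dom →
      A.A q * S.period q.2 =
        S.period (scalePoint A.wt q.1 q.2) * M.map (Int.cast : ℤ → ℂ) := by
    intro q
    by_cases hq : q ∈ A.dom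
    · obtain ⟨M, -, hM⟩ := A.fibre_iso q hq
      exact ⟨M, fun _ => hM⟩
    · exact ⟨0, fun h => absurd h hq⟩
  choose M hM using hex
  have hτc : ContinuousAt S.τ u := by
    refine continuousAt_pi.2 fun i => continuousAt_pi.2 fun j => ?_
    exact ((S.τ_holo i j).differentiableAt (S.isOpen_C.mem_nhds hu)).continuousAt
  have hA : Tendsto A.A (𝓝 (0, u)) (𝓝 1) := by
    have h1 : ContinuousAt A.A (0, u) := continuousAt_pi.2 fun i => continuousAt_pi.2 fun j =>
      ((A.A_holo i j).differentiableAt (A.dom_mem_nhds hu)).continuousAt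
    have h2 := h1.tendsto
    rwa [A.A_zero u hu] at h2
  -- The columns of `M` are coordinates of the images of the periods. Near `s = 0` such an image is
  -- close to the corresponding period, and their difference is a lattice vector, so it vanishes.
  have hone : ∀ k, ∀ᶠ q in 𝓝 ((0 : ℂ), u),
      (fun i => M q i k) - (Pi.single k 1 : Fin r ⊕ Fin r → ℤ) = 0 := by
    intro k
    refine eventually_eq_zero_of_tendsto_periodVector S.d_pos (S.τ_pos u hu)
      (hτc.tendsto.comp (A.tendsto_scalePoint u)) ?_
    have h1 : Tendsto (fun q : ℂ × CSpace r => A.A q *ᵥ S.periodSection (Pi.single k 1) q.2 -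
        S.periodSection (Pi.single k 1) (scalePoint A.wt q.1 q.2)) (𝓝 (0, u)) (𝓝 0) := by
      have hP := (continuousAt_periodSection (S := S) (Pi.single k 1) hu).tendsto
      have hc : Continuous fun p : Matrix (Fin r) (Fin r) ℂ × (Fin r → ℂ) => p.1 *ᵥ p.2 :=
        continuous_fst.matrix_mulVec continuous_snd
      have h2 := (((hc.tendsto _).comp (hA.prodMk_nhds (hP.comp
        (continuous_snd.tendsto ((0 : ℂ), u))))).sub (hP.comp (A.tendsto_scalePoint u)))
      simpa [Function.comp_def] using h2
    refine h1.congr' ?_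
    filter_upwards [A.dom_mem_nhds hu] with q hq
    have h3 : A.A q *ᵥ S.periodSection (Pi.single k 1) q.2 =
        S.periodSection (fun i => M q i k) (scalePoint A.wt q.1 q.2) := by
      have h4 : S.periodSection (Pi.single k 1) q.2 = fun i => S.period q.2 i k := by
        rw [LocalSK.periodSection, periodVector, LocalSK.period,
          show (fun i => ((Pi.single k 1 : Fin r ⊕ Fin r → ℤ) i : ℂ)) = Pi.single k 1 by
            ext i; by_cases hi : i = k <;> simp [hi]]
        rw [Matrix.mulVec_single_one]
        rfl
      rw [h4]
      ext i
      exact congrFun (congrFun (hM q hq) i) k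
    rw [h3]
    simp only [LocalSK.periodSection, Function.comp_apply]
    rw [periodVector, periodVector, periodVector, ← Matrix.mulVec_sub]
    congr 1
    ext i
    simp
  filter_upwards [eventually_all.2 hone, A.dom_mem_nhds hu] with q hq hqd
  have hMq : M q = 1 := by
    ext i k
    have := congrFun (sub_eq_zero.1 (hq k)) i
    rw [Matrix.one_apply, ← Pi.single_apply]
    exact this
  have h := hM q hqd
  -- With `M = 1` the first block reads `A Δ = Δ`, whence `A = 1`; the second block then compares
  -- the two values of `τ`.
  rw [hMq, Matrix.map_one _ Int.cast_zero Int.cast_one, Matrix.mul_one, LocalSK.period,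
    LocalSK.period, periodMatrix, periodMatrix, Matrix.mul_fromCols, Matrix.fromCols_inj.eq_iff] at h
  have hA1 : A.A q = 1 := by
    ext i j
    have h5 := congrFun (congrFun h.1 i) j
    rw [invFactorMatrix, Matrix.diagonal_map (by simp), Matrix.mul_diagonal] at h5
    have hd : ((S.d j : ℤ) : ℂ) ≠ 0 := by exact_mod_cast (S.d_pos j).ne'
    apply mul_right_cancel₀ hd
    rw [h5, Matrix.one_apply, Matrix.diagonal_apply]
    split_ifs with hij <;> simp [hij]
  have h6 := h.2
  rw [hA1, Matrix.one_mul] at h6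
  exact ⟨hA1, h6.symm⟩

/-- The mixed component of the symplectic form has weight one. -/
theorem eventually_mixed {u : CSpace r} (hu : u ∈ S.C) :
    ∀ᶠ q in 𝓝 ((0 : ℂ), u), ∀ v e, S.mixed (scalePoint A.wt q.1 q.2) (scalePoint A.wt q.1 v) e =
      Complex.exp q.1 * S.mixed q.2 v e := by
  -- `A = 1` is needed on a neighbourhood of `q`, because the lift is differentiated in the base
  -- direction.
  filter_upwards [(A.eventually_A_eq_one hu).eventually_nhds, A.dom_mem_nhds hu] with q hq hqd v e
  obtain ⟨s, p⟩ := q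
  have hp : p ∈ S.C := (A.mem_of_dom _ hqd).1
  have hsp : scalePoint A.wt s p ∈ S.C := (A.mem_of_dom _ hqd).2
  have hcont : Tendsto (fun x : CSpace r × CSpace r => (s, x.1)) (𝓝 (p, 0)) (𝓝 (s, p)) := by
    have hc : Continuous fun x : CSpace r × CSpace r => (s, x.1) := by fun_prop
    exact hc.tendsto (p, 0)
  have ht : HasFDerivAt (fun p => A.t (s, p)) (fderiv ℂ (fun p => A.t (s, p)) p) p :=
    (DifferentiableAt.fun_comp' p (f := fun p => (s, p))
      (A.t_holo.differentiableAt (A.isOpen_dom.mem_nhds hqd))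
      (by fun_prop)).hasFDerivAt
  have hF : HasFDerivAt (fun x : CSpace r × CSpace r =>
      (scalePoint A.wt s x.1, A.A (s, x.1) *ᵥ x.2 + A.t (s, x.1)))
      (((scaleMap A.wt s).comp (ContinuousLinearMap.fst ℂ (CSpace r) (CSpace r))).prod
        (ContinuousLinearMap.snd ℂ (CSpace r) (CSpace r) +
          (fderiv ℂ (fun p => A.t (s, p)) p).comp (ContinuousLinearMap.fst ℂ _ _))) (p, 0) := by
    have h1 : HasFDerivAt (fun x : CSpace r × CSpace r =>
        (scaleMap A.wt s x.1, x.2 + A.t (s, x.1))) _ (p, 0) :=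
      (HasFDerivAt.comp (g := scaleMap A.wt s) (p, (0 : CSpace r))
        (scaleMap A.wt s).hasFDerivAt hasFDerivAt_fst).prodMk
        (hasFDerivAt_snd.add (HasFDerivAt.comp (g := fun p => A.t (s, p)) (p, (0 : CSpace r))
          ht hasFDerivAt_fst))
    refine h1.congr_of_eventuallyEq ?_
    filter_upwards [hcont.eventually hq] with x hx
    rw [hx.1, Matrix.one_mulVec, scaleMap_apply]
  have h := congrArg (fun ω => twoFormToBilin _ ω (v, 0) (0, e)) (A.L_weight _ hqd 0)
  rw [hF.fderiv] at h
  have h2 : S.bil (scalePoint A.wt s p, A.A (s, p) *ᵥ 0 + A.t (s, p))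
      (scalePoint A.wt s v, 0 + fderiv ℂ (fun p => A.t (s, p)) p v)
      (scalePoint A.wt s 0, e + fderiv ℂ (fun p => A.t (s, p)) p 0) =
        Complex.exp s * S.bil (p, 0) (v, 0) (0, e) := by
    refine Eq.trans ?_ h
    rw [twoFormToBilin_apply, ContinuousAlternatingMap.compContinuousLinearMap_apply,
      LocalSK.bil_apply]
    congr 1
    ext i : 1
    fin_cases i <;> rfl
  -- The translation `t` affects only the point of the fibre and the vertical part of the image of
  -- `(v, 0)`; neither is seen by the pairing with a vertical vector.
  rw [S.bil_eq hsp, S.bil_eq hp, ← scaleMap_apply A.wt s 0] at h2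
  simpa using h2

/-- The scaling action multiplies the one-forms `L(·, Π n)` by `λ`. -/
theorem eventually_periodForm (n : Fin r ⊕ Fin r → ℤ) {u : CSpace r} (hu : u ∈ S.C) (v : CSpace r) :
    ∀ᶠ s in 𝓝 (0 : ℂ), S.periodForm n (scalePoint A.wt s u) (scalePoint A.wt s v) =
      Complex.exp s * S.periodForm n u v := by
  have hc : Tendsto (fun s : ℂ => (s, u)) (𝓝 0) (𝓝 (0, u)) := by
    have hc : Continuous fun s : ℂ => (s, u) := by fun_prop
    exact hc.tendsto 0
  filter_upwards [hc.eventually (A.eventually_mixed hu),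
    hc.eventually (A.eventually_A_eq_one hu)] with s h1 h2
  rw [S.periodForm_apply, S.periodForm_apply, ← h1, LocalSK.periodSection, LocalSK.periodSection,
    h2.2]

/-- The infinitesimal form of `eventually_periodForm` at `s = 0`: the Lie derivative of the form
along the Euler field is the form itself. -/
theorem fderiv_periodForm_euler (n : Fin r ⊕ Fin r → ℤ) {u : CSpace r} (hu : u ∈ S.C)
    (v : CSpace r) : fderiv ℂ (S.periodForm n) u (eulerMap A.wt u) v +
      S.periodForm n u (eulerMap A.wt v) = S.periodForm n u v := by
  have hσ := hasDerivAt_scalePoint A.wt u 0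
  have hσv := hasDerivAt_scalePoint A.wt v 0
  rw [scalePoint_zero] at hσ hσv
  have hθ : HasFDerivAt (S.periodForm n) (fderiv ℂ (S.periodForm n) u) (scalePoint A.wt 0 u) := by
    rw [scalePoint_zero]
    exact (S.differentiableAt_periodForm n hu).1.hasFDerivAt
  have h0' := hθ.comp_hasDerivAt (0 : ℂ) hσ
  have h0 : HasDerivAt (fun s => S.periodForm n (scalePoint A.wt s u))
      (fderiv ℂ (S.periodForm n) u (eulerMap A.wt u)) 0 := h0'
  have h1 := h0.clm_apply hσv
  rw [scalePoint_zero, scalePoint_zero] at h1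
  have h2 := (Complex.hasDerivAt_exp 0).mul_const (S.periodForm n u v)
  rw [Complex.exp_zero, one_mul] at h2
  exact h1.unique (h2.congr_of_eventuallyEq (A.eventually_periodForm n hu v))

/-- Cartan's formula: for a closed form, the Lie derivative along the Euler field is the
differential of the contraction. It yields a canonical primitive, without an integration constant to
adjust. -/
theorem hasFDerivAt_periodForm_euler (n : Fin r ⊕ Fin r → ℤ) {u : CSpace r} (hu : u ∈ S.C) :
    HasFDerivAt (fun u => S.periodForm n u (eulerMap A.wt u)) (S.periodForm n u) u := by
  have h := (S.differentiableAt_periodForm n hu).1.hasFDerivAt.clm_apply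
    (eulerMap A.wt).hasFDerivAt
  refine h.congr_fderiv ?_
  ext v
  rw [← A.fderiv_periodForm_euler n hu v, ← S.periodForm_closed n hu v]
  simp [add_comm]

/-- The function `a` satisfies Euler's equation `da(E) = a`, so `e^{-ts} a(e^{ts} ∘ u)` has zero
derivative along the orbit segment. -/
theorem homogeneousWeightOne_periodForm_euler (n : Fin r ⊕ Fin r → ℤ) :
    HomogeneousWeightOne S.C A.wt fun u => S.periodForm n u (eulerMap A.wt u) := by
  intro u hu s hs
  set a : CSpace r → ℂ := fun u => S.periodForm n u (eulerMap A.wt u) with ha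
  set g : ℝ → ℂ := fun t => Complex.exp (-((t : ℂ) * s)) * a (scalePoint A.wt (t * s) u) with hg
  have hderiv : ∀ t ∈ Icc (0 : ℝ) 1, HasDerivAt g 0 t := by
    intro t ht
    have h1 : HasDerivAt (fun t : ℝ => (t : ℂ) * s) s t := by
      simpa using (Complex.ofRealCLM.hasDerivAt (x := t)).mul_const s
    have h2 := (hasDerivAt_scalePoint A.wt u (t * s)).scomp t h1
    have h3 := ((A.hasFDerivAt_periodForm_euler n (hs t ht)).restrictScalars ℝ).comp_hasDerivAt t h2
    have h4 := (h1.neg.cexp).mul h3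
    refine h4.congr_deriv ?_
    simp only [ContinuousLinearMap.coe_restrictScalars', map_smul, smul_eq_mul,
      Function.comp_apply]
    ring
  have h := constant_of_has_deriv_right_zero (fun t ht => (hderiv t ht).continuousAt.continuousWithinAt)
    (fun t ht => (hderiv t (Ico_subset_Icc_self ht)).hasDerivWithinAt) 1 (right_mem_Icc.2 zero_le_one)
  simp only [hg, Complex.ofReal_one, one_mul, Complex.ofReal_zero, zero_mul, neg_zero,
    Complex.exp_zero, scalePoint_zero] at h
  rw [← h, ← mul_assoc, ← Complex.exp_add, add_neg_cancel, Complex.exp_zero, one_mul]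

end ScaleSymmetry

namespace LocalSK.Splitting

variable {S : LocalSK r} (T : S.Splitting)

theorem Z_eq_of_τ_eq {u u' : CSpace r} (hu : u ∈ S.C) (hu' : u' ∈ S.C) (h : S.τ u = S.τ u')
    (l : Fin r) : T.Z l u = T.Z l u' := by
  have hcol : ∀ k, S.column T.R k u = S.column T.R k u' := fun k => by
    rw [column, periodSection, periodSection, h]
  have h1 := T.column_inr u hu l
  rw [hcol, hcol, T.column_inr u' hu' l] at h1
  exact (smul_left_injective ℂ (column_ne_zero T.R_unit hu' _) h1).symm

/-- The matrix `R` and the moduli determine `G (Δ τ)`. Its first block determines `G`, and then its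
second determines `τ`. -/
theorem τ_eq_of_Z_eq {u u' : CSpace r} (hu : u ∈ S.C) (hu' : u' ∈ S.C)
    (h : ∀ l, T.Z l u = T.Z l u') : S.τ u = S.τ u' := by
  have hR : IsUnit (T.R.map (Int.cast : ℤ → ℂ)).det := by
    have := T.R_unit.map (Int.castRingHom ℂ)
    rwa [RingHom.map_det] at this
  have h1 : T.G u * S.period u = T.G u' * S.period u' := by
    have h0 := T.period_split hu
    simp only [h] at h0
    have h3 := congrArg (fun M => M * (T.R.map (Int.cast : ℤ → ℂ))⁻¹)
      (h0.trans (T.period_split hu').symm)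
    simpa only [Matrix.mul_assoc, Matrix.mul_nonsing_inv _ hR, Matrix.mul_one] using h3
  rw [period, period, periodMatrix, periodMatrix, Matrix.mul_fromCols, Matrix.mul_fromCols,
    Matrix.fromCols_inj.eq_iff] at h1
  have hG : T.G u = T.G u' := by
    ext i j
    have h5 := congrFun (congrFun h1.1 i) j
    rw [invFactorMatrix, Matrix.diagonal_map (by simp), Matrix.mul_diagonal,
      Matrix.mul_diagonal] at h5
    exact mul_right_cancel₀ (by exact_mod_cast (S.d_pos j).ne') h5
  have h2 := congrArg (fun M => T.block u * M) h1.2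
  simp only [← Matrix.mul_assoc] at h2
  rwa [← hG, T.block_mul_G hu, Matrix.one_mul, Matrix.one_mul] at h2

/-- `Z` depends on `u` only through `τ`, which is constant along short orbits. -/
theorem fderiv_Z_euler (A : ScaleSymmetry S) (l : Fin r) {u : CSpace r} (hu : u ∈ S.C) :
    fderiv ℂ (T.Z l) u (eulerMap A.wt u) = 0 := by
  have hσ := hasDerivAt_scalePoint A.wt u 0
  have hZ := ((T.Z_holo l).differentiableAt (S.isOpen_C.mem_nhds hu)).hasFDerivAt
  rw [← scalePoint_zero A.wt u] at hZ
  have h1 := hZ.comp_hasDerivAt (0 : ℂ) hσ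
  have hc : Tendsto (fun s : ℂ => (s, u)) (𝓝 0) (𝓝 (0, u)) := by
    have hc : Continuous fun s : ℂ => (s, u) := by fun_prop
    exact hc.tendsto 0
  have h2 : HasDerivAt (T.Z l ∘ fun s => scalePoint A.wt s u) 0 0 := by
    refine (hasDerivAt_const (0 : ℂ) (T.Z l u)).congr_of_eventuallyEq ?_
    filter_upwards [hc.eventually (A.eventually_A_eq_one hu),
      hc.eventually (A.dom_mem_nhds hu)] with s hs hd
    exact T.Z_eq_of_τ_eq (A.mem_of_dom _ hd).2 hu hs.2 l
  have h3 := h1.unique h2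
  rwa [scalePoint_zero] at h3

/-- In the presence of a scale symmetry, the moduli of the elliptic factors are constant. -/
theorem exists_Z_eq_const (A : ScaleSymmetry S) (l : Fin r) : ∃ Z₀ : ℂ, ∀ u ∈ S.C, T.Z l u = Z₀ := by
  refine S.isOpen_C.exists_is_const_of_fderiv_eq_zero S.isPreconnected_C (T.Z_holo l) ?_
  intro u hu
  by_contra hne
  have hc : ContinuousAt (fderiv ℂ (T.Z l)) u :=
    (T.Z_holo l).continuousOn_fderiv_complex S.isOpen_C |>.continuousAt (S.isOpen_C.mem_nhds hu)
  -- Near `u` the differential of `Z` is nonzero and kills the Euler field, so the form proportional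
  -- to it kills that field too. But this contraction is a primitive of the form, which would then
  -- vanish at `u`.
  have ha : ∀ᶠ p in 𝓝 u, T.form l p (eulerMap A.wt p) = 0 := by
    filter_upwards [S.isOpen_C.mem_nhds hu, hc.eventually_ne hne] with p hp hpne
    obtain ⟨v, hv⟩ : ∃ v, fderiv ℂ (T.Z l) p v ≠ 0 := by
      by_contra! hall
      exact hpne (ContinuousLinearMap.ext hall)
    have h := T.fderiv_Z_wedge_form l hp v (eulerMap A.wt p)
    rw [T.fderiv_Z_euler A l hp, zero_mul] at h
    exact (mul_eq_zero.1 h).resolve_left hv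
  have h1 : HasFDerivAt (fun p => T.form l p (eulerMap A.wt p)) (T.form l u) u :=
    A.hasFDerivAt_periodForm_euler _ hu
  have h2 := h1.unique ((hasFDerivAt_const (0 : ℂ) u).congr_of_eventuallyEq ha)
  exact T.form_ne_zero l hu h2

end LocalSK.Splitting

end ScaleInvariance

/-! ### The theorem -/

theorem mainTheorem1 {r : ℕ} (S : LocalSK r) (hS : S.CompletelySplit) :
    Nonempty (SplitNormalForm S) ∧
    ∀ A : ScaleSymmetry S,
      (∃ N : SplitNormalForm S,
        (∀ l, HomogeneousWeightOne S.C A.wt (N.a l)) ∧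
        (∀ l, ∃ k₁ k₀ : ℂ, ∀ u ∈ S.C, N.c₁ l u = k₁ ∧ N.c₀ l u = k₀)) ∧
      (∀ N : SplitNormalForm S, ∀ l, ∃ Z₀ : ℂ, ∀ u ∈ S.C, N.Z l u = Z₀) ∧
      (∃ τ₀ : Matrix (Fin r) (Fin r) ℂ, ∀ u ∈ S.C, S.τ u = τ₀) ∧
      S.Isotrivial := by
  obtain ⟨T⟩ := hS.nonempty_splitting
  refine ⟨?_, fun A => ?_⟩
  · choose a ha using T.exists_primitive_form
    exact ⟨T.normalForm a ha⟩
  have hZ := T.exists_Z_eq_const A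
  have hτ : ∀ u ∈ S.C, ∀ u' ∈ S.C, S.τ u = S.τ u' := fun u hu u' hu' =>
    T.τ_eq_of_Z_eq hu hu' fun l => by
      obtain ⟨Z₀, h⟩ := hZ l
      rw [h u hu, h u' hu']
  obtain ⟨u₁, hu₁⟩ := S.nonempty_C
  -- Under a scale symmetry the primitives are the contractions with the Euler field. For an
  -- arbitrary normal form, the constancy of `τ` already forces that of its moduli, through
  -- `toSplitting`.
  refine ⟨⟨T.normalForm (fun l u => T.form l u (eulerMap A.wt u))
      fun l u hu => A.hasFDerivAt_periodForm_euler _ hu, fun l =>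
        A.homogeneousWeightOne_periodForm_euler _, fun l => ?_⟩,
    fun N l => ⟨N.Z l u₁, fun u hu => N.toSplitting.Z_eq_of_τ_eq hu hu₁ (hτ u hu u₁ hu₁) l⟩,
    ⟨S.τ u₁, fun u hu => hτ u hu u₁ hu₁⟩, fun u₀ hu₀ => ?_⟩
  · obtain ⟨Z₀, h⟩ := hZ l
    exact ⟨weierstrassC₁ Z₀, weierstrassC₀ Z₀, fun u hu =>
      ⟨congrArg weierstrassC₁ (h u hu), congrArg weierstrassC₀ (h u hu)⟩⟩
  · filter_upwards [S.isOpen_C.mem_nhds hu₀] with u hu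
    exact hτ u hu u₀ hu₀
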